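/- **Setting.** Let $n\ge 2$, $r\ge1$, and let $X^*=[x^*_1,\dots,x^*_q]\in\mathbb R^{n\times q}$ have rank $r$ and reduced SVD $X^*=U^*\Sigma V^{*\top}$. Put $B^*=\Sigma V^{*\top}$ with columns $b^*_k$, let $\sigma_{\max},\sigma_{\min}$ be the largest and smallest diagonal entries of $\Sigma$, and let $\kappa=\sigma_{\max}/\sigma_{\min}$. Assume $\max_k\|b^*_k\|\le\mu\sqrt{r/q}\,\sigma_{\max}$ for some $\mu\ge1$. There are $L=\tilde L\rho$ nodes, split into $\tilde L$ mini-batches of $\rho\ge1$ nodes; node $(\vartheta,\ell)$ is the $\ell$-th node of mini-batch $\vartheta$. Each node $\ell$ has matrices $(A_k)_\ell\in\mathbb R^{\tilde m\times n}$, $k\in[q]$, and $(y_k)_\ell=(A_k)_\ell x^*_k$, and a second, independent set of such data used only for the threshold; all entries of all matrices are i.i.d. standard Gaussian. Put $m=L\tilde m$. A fixed set of at most $\tau L$ nodes, $\tau<0.4\,\tilde L/L$, is Byzantine: at each communication these nodes send arbitrary (measurable) functions of the data of all nodes and of the random choices the center has made before. **Algorithm.** Good nodes send $\alpha_\ell=\frac{9\kappa^2\mu^2}{\tilde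 m q}\sum_k\|(y_k)_\ell\|^2$ (from the threshold data); the center sets $\alpha=\mathrm{Median}_{\vartheta}\{\frac1\rho\sum_{\ell}\alpha_{(\vartheta,\ell)}\}$. Let $(X_0)_\ell=\sum_k(A_k)_\ell^\top((y_k)_\ell)_{\rm trunc}e_k^\top$, where truncation sets entries with $|y|>\sqrt\alpha$ to $0$. The center draws an $n\times r$ matrix $U_{\rm rand}$ with i.i.d. standard Gaussian entries and sets $U_{(\vartheta)}=U_{\rm rand}$ for all $\vartheta$. For $T_{pow}$ iterations and every $\vartheta$: the nodes of mini-batch $\vartheta$ send $V_\ell=(X_0)_\ell^\top U_{(\vartheta)}$, the center returns $V_{(\vartheta)}=\sum_{\ell}V_{(\vartheta,\ell)}$, the nodes send $U_\ell=(X_0)_\ell V_{(\vartheta)}$, and the center returns $U_{(\vartheta)}\leftarrow QR(\sum_\ell U_{(\vartheta,\ell)})$, the orthonormal factor of a QR decomposition. Finally (Subspace Median) the center orthonormalizes the $U_{(\vartheta)}$ by QR, computes an approximate geometric median $P_{gm}$ of the projection matrices $U_{(\vartheta)}U_{(\vartheta)}^\top$ (as vectors in $\mathbb R^{n^2}$),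 and outputs as $U_{out}$ a $U_{(\vartheta)}$ that minimizes $\|U_{(\vartheta)}U_{(\vartheta)}^\top-P_{gm}\|_F$. The approximate geometric median of points $z_1,\dots,z_{\tilde L}$ is computed by the path following algorithm of Cohen et al. with $T_{gm}$ iterations: with $f(x)=\sum_i\|x-z_i\|$, $x^{(0)}=\frac1{\tilde L}\sum_i z_i$, $t_i=\frac{1}{400f(x^{(0)})}(1+\frac1{600})^{i-1}$ and $f_t(x)=\sum_i\big(g_i-\log(1+g_i)\big)$, $g_i=\sqrt{1+t^2\|x-z_i\|^2}$, its (randomized) line searches produce $x^{(i)}$, $1\le i\le T_{gm}+1$, and the output is $x^{(T_{gm}+1)}$ (or $x^{(0)}$ if $f(x^{(0)})=0$). It has failure probability at most $c_{approxGM}\ge0$: on every fixed input with $f(x^{(0)})\neq0$, with probability at least $1-c_{approxGM}$ over its internal randomness (which is independent of everything else), each $x^{(i)}$, $1\le i\le T_{gm}+1$, is within $\epsilon_c/t_i$ of the minimizer of $f_{t_i}$, where $\epsilon_c\in(0,1]$ is its tolerance parameter. For $U_1,U_2$ with orthonormal columns let $SD_F(U_1,U_2)=\|(I-U_1U_1^\top)U_2\|_F$,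 and let $\psi(a,b)=(1-a)\log\frac{1-a}{1-b}+a\log\frac ab$. **Statement.** There are numerical constants $C_0,K\ge1$ and $c,c'\in(0,1)$ such that the following holds in every such setting, for every $\delta_0\in(0,1)$ and all $C_s,C_{pow},C_{gm}\ge C_0$. Let $T_{gm}=\lceil C_{gm}\log\frac{Lr}{\delta_0}\rceil$, $T_{pow}=\lceil C_{pow}\kappa^2\log\frac n{\delta_0}\rceil$, and assume $$mq\ \ge\ C_s\,\tilde L\cdot\kappa^6\mu^2(n+q)r^2/\delta_0^2 .$$ 1. With probability at least $$1-c_{approxGM}-\exp\!\big(-\tilde L\,\psi(0.4-\tau L/\tilde L,\ e^{-c(n+q)}+n^{-10})\big)-n^{-10}-L\exp\!\big(-c'\tilde m q\,\delta_0^2/(r^2\kappa^4\mu^2)\big),$$ $SD_F(U^*,U_{out})\le\delta_0$. 2. If moreover $C_s,C_{pow}\ge C_0L$ (that is, if $L$ is treated as a numerical constant, on which the constants may depend), then $SD_F(U^*,U_{out})\le\delta_0$ with probability at least $$1-c_{approxGM}-\exp\!\big(-L\,\psi(0.4-\tau,\ e^{-c(n+q)}+n^{-10})\big)-L\exp\!\big(-c'\tilde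 m q\,\delta_0^2/(r^2\kappa^4)\big).$$ 3. The number of scalars exchanged between any node and the center lies between $N$ and $K N$ for $N=C_{pow}\,\kappa^2(n+q)\,r\log\frac n{\delta_0}$; in particular, if $q\le n$, it is at most $K\,C_{pow}\,\kappa^2\,n r\log\frac n{\delta_0}$, i.e. of order $nr\,T_{pow}$. -/

import Mathlib

open MeasureTheory ProbabilityTheory

noncomputable section

namespace ByzLRCS

/-! ## Matrices, singular values, subspace distance -/

/-- Frobenius norm. -/
def frob {a b : ℕ} (M : Matrix (Fin a) (Fin b) ℝ) : ℝ := Real.sqrt (∑ i, ∑ j, M i j ^ 2)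

/-- `SD_F(U₁, U₂) = ‖(I - U₁ U₁ᵀ) U₂‖_F` for matrices with orthonormal columns. -/
def subspaceDist {n r : ℕ} (U₁ U₂ : Matrix (Fin n) (Fin r) ℝ) : ℝ :=
  frob ((1 - U₁ * U₁.transpose) * U₂)

/-- A reduced singular value decomposition `X = U diag(σ) Vᵀ` of a matrix of rank `r`. -/
structure ReducedSVD {n q : ℕ} (X : Matrix (Fin n) (Fin q) ℝ) (r : ℕ) where
  U : Matrix (Fin n) (Fin r) ℝ
  σ : Fin r → ℝ
  V : Matrix (Fin q) (Fin r) ℝ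
  U_orthonormal : U.transpose * U = 1
  V_orthonormal : V.transpose * V = 1
  σ_pos : ∀ i, 0 < σ i
  σ_antitone : Antitone σ
  eq : X = U * Matrix.diagonal σ * V.transpose

namespace ReducedSVD

variable {n q r : ℕ} {X : Matrix (Fin n) (Fin q) ℝ}

def sigmaMax (D : ReducedSVD X r) : ℝ := ⨆ i, D.σ i

def sigmaMin (D : ReducedSVD X r) : ℝ := ⨅ i, D.σ i

/-- The condition number `κ`. -/
def kappa (D : ReducedSVD X r) : ℝ := D.sigmaMax / D.sigmaMin

/-- `B = diag(σ) Vᵀ`, so that `X = U B`. -/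
def B (D : ReducedSVD X r) : Matrix (Fin r) (Fin q) ℝ := Matrix.diagonal D.σ * D.V.transpose

/-- Incoherence of the right singular vectors: `‖b_k‖ ≤ μ √(r/q) σ_max` for every column `b_k`
of `B`. -/
def Incoherent (D : ReducedSVD X r) (μ : ℝ) : Prop :=
  ∀ k : Fin q, Real.sqrt (∑ i, D.B i k ^ 2) ≤ μ * Real.sqrt ((r : ℝ) / q) * D.sigmaMax

end ReducedSVD

/-- Orthonormalization of the columns of an `n × r` matrix by a QR decomposition `M = QR(M) R`,
`R` upper triangular.  Sign conventions, and the choices made for rank deficient `M`, are left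
open; they only have to be measurable in `M`. -/
structure QRMap (n r : ℕ) where
  toFun : Matrix (Fin n) (Fin r) ℝ → Matrix (Fin n) (Fin r) ℝ
  orthonormal : ∀ M, (toFun M).transpose * toFun M = 1
  factor : ∀ M, ∃ R : Matrix (Fin r) (Fin r) ℝ, (∀ i j, j < i → R i j = 0) ∧ M = toFun M * R
  measurable_entries : ∀ i j,
    Measurable fun M : Fin n → Fin r → ℝ => toFun (Matrix.of M) i j

/-- The binary Kullback-Leibler divergence `ψ(a, b)`. -/
def psi (a b : ℝ) : ℝ :=
  (1 - a) * Real.log ((1 - a) / (1 - b)) + a * Real.log (a / b)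

/-- The median of finitely many reals (mean of the two middle values for an even number). -/
def median {K : ℕ} (a : Fin K → ℝ) : ℝ :=
  if h : 0 < K then
    (a (Tuple.sort a ⟨(K - 1) / 2, by omega⟩) + a (Tuple.sort a ⟨K / 2, by omega⟩)) / 2
  else 0

/-! ## Approximate geometric median by path following

The nearly linear time algorithm of Cohen et al. follows the path of minimizers of the penalized
objectives `f_t` along `t_1 < t_2 < …`; the `i`-th step is a line search, started at the previous
iterate, that has to end within `ε_c / t_i` of the minimizer of `f_{t_i}`. -/

section GeometricMedian

variable {K : ℕ} {E : Type} [NormedAddCommGroup E] [NormedSpace ℝ E]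

/-- `f(x) = ∑ ‖x - z_i‖`. -/
def gmObjective (z : Fin K → E) (x : E) : ℝ := ∑ i, ‖x - z i‖

/-- `x⁽⁰⁾`, the average of the points. -/
def gmCenter (z : Fin K → E) : E := (K : ℝ)⁻¹ • ∑ i, z i

/-- The penalized objective
`f_t(x) = ∑ (g_i - log (1 + g_i))`, `g_i = √(1 + t² ‖x - z_i‖²)`. -/
def gmPenalized (z : Fin K → E) (t : ℝ) (x : E) : ℝ :=
  ∑ i, (Real.sqrt (1 + t ^ 2 * ‖x - z i‖ ^ 2)
    - Real.log (1 + Real.sqrt (1 + t ^ 2 * ‖x - z i‖ ^ 2)))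

/-- The path parameter `t_{i+1} = (1 + 1/600)^i / (400 f(x⁽⁰⁾))`. -/
def gmPath (z : Fin K → E) (i : ℕ) : ℝ :=
  1 / (400 * gmObjective z (gmCenter z)) * (1 + 1 / 600) ^ i

variable [MeasurableSpace E] (K E) in
/-- A randomized implementation of the algorithm: `iterate z s i` is the iterate `x⁽ⁱ⁺¹⁾` on the
input points `z` and the random seed `s`. -/
structure MedianRoutine (S : Type) [MeasurableSpace S] where
  iterate : (Fin K → E) → S → ℕ → E
  measurable_iterate : ∀ i, Measurable fun p : (Fin K → E) × S => iterate p.1 p.2 i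

variable [MeasurableSpace E] {S : Type} [MeasurableSpace S]

/-- In a run with `T` iterations, all line searches (the initial one and one for each iteration)
met their tolerance `ε_c`. -/
def MedianRoutine.LineSearchesSucceed (A : MedianRoutine K E S) (T : ℕ) (εc : ℝ)
    (z : Fin K → E) (s : S) : Prop :=
  ∀ i ≤ T, ∃ xc : E, IsMinOn (gmPenalized z (gmPath z i)) Set.univ xc ∧
    ‖A.iterate z s i - xc‖ ≤ εc / gmPath z i

/-- `A`, run for `T` iterations with seed law `ν`, is path following with tolerance `εc` and
failure probability at most `c`, on every fixed input (with `f(x⁽⁰⁾) ≠ 0`, so that the `t_i` are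
defined). -/
def MedianRoutine.IsPathFollowing (A : MedianRoutine K E S) (ν : Measure S) (T : ℕ)
    (εc c : ℝ) : Prop :=
  ∀ z : Fin K → E, gmObjective z (gmCenter z) ≠ 0 →
    1 - c ≤ ν.real {s | A.LineSearchesSucceed T εc z s}

open Classical in
/-- The output after `T` iterations, `x⁽ᵀ⁺¹⁾`.  If `f(x⁽⁰⁾) = 0`, all the points coincide and
`x⁽⁰⁾` is returned. -/
def MedianRoutine.output (A : MedianRoutine K E S) (T : ℕ) (z : Fin K → E) (s : S) : E :=
  if gmObjective z (gmCenter z) = 0 then gmCenter z else A.iterate z s T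

end GeometricMedian

/-- Vectorization of an `n × n` matrix, with the Euclidean norm. -/
def vec {n : ℕ} (M : Matrix (Fin n) (Fin n) ℝ) : EuclideanSpace ℝ (Fin n × Fin n) :=
  WithLp.toLp 2 fun p => M p.1 p.2

/-! ## Federated data and the attack -/

/-- The nodes: `(ϑ, ℓ)` is the `ℓ`-th of the `ρ` nodes of the `ϑ`-th of the `Lt` mini-batches. -/
abbrev Node (Lt ρ : ℕ) : Type := Fin Lt × Fin ρ

/-- Measurement matrices: `A ℓ k` is the `mt × n` matrix `(A_k)_ℓ` of node `ℓ`. -/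
abbrev Sensing (n q mt Lt ρ : ℕ) : Type := Node Lt ρ → Fin q → Fin mt → Fin n → ℝ

/-- All the data of all the nodes, with sample splitting: the first component is used for the
threshold, the second one for the power methods. -/
abbrev Data (n q mt Lt ρ : ℕ) : Type := Sensing n q mt Lt ρ × Sensing n q mt Lt ρ

/-- Data together with the random `n × r` start of the power methods. -/
abbrev World (n q r mt Lt ρ : ℕ) : Type := Data n q mt Lt ρ × (Fin n → Fin r → ℝ)

/-- I.i.d. standard Gaussian measurement matrices. -/
def sensingLaw (n q mt Lt ρ : ℕ) : Measure (Sensing n q mt Lt ρ) :=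
  Measure.pi fun _ => Measure.pi fun _ => Measure.pi fun _ => Measure.pi fun _ => gaussianReal 0 1

/-- The law of the data and of the i.i.d. standard Gaussian start. -/
def worldLaw (n q r mt Lt ρ : ℕ) : Measure (World n q r mt Lt ρ) :=
  ((sensingLaw n q mt Lt ρ).prod (sensingLaw n q mt Lt ρ)).prod
    (Measure.pi fun _ => Measure.pi fun _ => gaussianReal 0 1)

/-- What the Byzantine nodes send.  The attack is omniscient and colluding: every message may
depend on the data of all nodes and, once the center has drawn it, on the random start (hence also
on all earlier messages).  The values at good nodes are not used. -/
structure Attack (n q r mt Lt ρ : ℕ) where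
  alpha : Node Lt ρ → Data n q mt Lt ρ → ℝ
  V : ℕ → Node Lt ρ → World n q r mt Lt ρ → Matrix (Fin q) (Fin r) ℝ
  U : ℕ → Node Lt ρ → World n q r mt Lt ρ → Matrix (Fin n) (Fin r) ℝ
  measurable_alpha : ∀ ℓ, Measurable (alpha ℓ)
  measurable_V : ∀ t ℓ i j, Measurable fun w => V t ℓ w i j
  measurable_U : ∀ t ℓ i j, Measurable fun w => U t ℓ w i j

/-- Everything that determines a run of the initialization up to randomness. -/
structure Protocol (n q r mt Lt ρ : ℕ) where
  /-- the unknown matrix -/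
  X : Matrix (Fin n) (Fin q) ℝ
  /-- algorithm parameter `κ` -/
  κ : ℝ
  /-- algorithm parameter `μ` -/
  μ : ℝ
  /-- the Byzantine nodes, the same ones in all iterations -/
  byz : Finset (Node Lt ρ)
  attack : Attack n q r mt Lt ρ
  qr : QRMap n r

/-- A message: a real matrix. -/
structure Message where
  rows : ℕ
  cols : ℕ
  entries : Matrix (Fin rows) (Fin cols) ℝ

/-- The number of scalars in a message. -/
def Message.size (M : Message) : ℕ := M.rows * M.cols

namespace Protocol

variable {n q r mt Lt ρ : ℕ} (p : Protocol n q r mt Lt ρ)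

/-- The measurement `((y_k)_ℓ)_i = ((A_k)_ℓ x_k)_i`. -/
def y (A : Sensing n q mt Lt ρ) (ℓ : Node Lt ρ) (k : Fin q) (i : Fin mt) : ℝ :=
  ∑ j, A ℓ k i j * p.X j k

/-! ### The threshold -/

/-- `α_ℓ` as received by the center. -/
def alphaNode (d : Data n q mt Lt ρ) (ℓ : Node Lt ρ) : ℝ :=
  if ℓ ∈ p.byz then p.attack.alpha ℓ d
  else 9 * p.κ ^ 2 * p.μ ^ 2 / ((mt : ℝ) * q) * ∑ k, ∑ i, p.y d.1 ℓ k i ^ 2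

/-- The threshold `α`: the median over the mini-batches of the mini-batch means. -/
def alpha (d : Data n q mt Lt ρ) : ℝ :=
  median fun ϑ : Fin Lt => (∑ ℓ : Fin ρ, p.alphaNode d (ϑ, ℓ)) / ρ

/-- `(X₀)_ℓ = ∑_k (A_k)_ℓᵀ ((y_k)_ℓ)_trunc e_kᵀ`, truncated at `|y| ≤ √α`. -/
def X0 (d : Data n q mt Lt ρ) (ℓ : Node Lt ρ) : Matrix (Fin n) (Fin q) ℝ :=
  Matrix.of fun j k => ∑ i, d.2 ℓ k i j *
    (if |p.y d.2 ℓ k i| ≤ Real.sqrt (p.alpha d) then p.y d.2 ℓ k i else 0)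

/-! ### The federated power methods, one iteration -/

/-- `V_ℓ` as received by the center, when the current estimates are `U`. -/
def VNode (w : World n q r mt Lt ρ) (t : ℕ) (U : Fin Lt → Matrix (Fin n) (Fin r) ℝ)
    (ℓ : Node Lt ρ) : Matrix (Fin q) (Fin r) ℝ :=
  if ℓ ∈ p.byz then p.attack.V t ℓ w else (p.X0 w.1 ℓ).transpose * U ℓ.1

/-- `V_(ϑ)`, the sum over a mini-batch. -/
def VBatch (w : World n q r mt Lt ρ) (t : ℕ) (U : Fin Lt → Matrix (Fin n) (Fin r) ℝ)
    (ϑ : Fin Lt) : Matrix (Fin q) (Fin r) ℝ :=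
  ∑ ℓ : Fin ρ, p.VNode w t U (ϑ, ℓ)

/-- `U_ℓ` as received by the center. -/
def UNode (w : World n q r mt Lt ρ) (t : ℕ) (U : Fin Lt → Matrix (Fin n) (Fin r) ℝ)
    (ℓ : Node Lt ρ) : Matrix (Fin n) (Fin r) ℝ :=
  if ℓ ∈ p.byz then p.attack.U t ℓ w else p.X0 w.1 ℓ * p.VBatch w t U ℓ.1

/-- The estimates `U_(ϑ)` after `t` iterations; all mini-batches share the random start. -/
def powerIterate (w : World n q r mt Lt ρ) : ℕ → Fin Lt → Matrix (Fin n) (Fin r) ℝ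
  | 0 => fun _ => Matrix.of w.2
  | t + 1 => fun ϑ => p.qr.toFun (∑ ℓ : Fin ρ, p.UNode w t (powerIterate w t) (ϑ, ℓ))

/-! ### Subspace median -/

/-- The orthonormalized inputs of the subspace median. -/
def basis (w : World n q r mt Lt ρ) (Tpow : ℕ) (ϑ : Fin Lt) : Matrix (Fin n) (Fin r) ℝ :=
  p.qr.toFun (p.powerIterate w Tpow ϑ)

/-- Their (vectorized) projection matrices. -/
def proj (w : World n q r mt Lt ρ) (Tpow : ℕ) (ϑ : Fin Lt) :
    EuclideanSpace ℝ (Fin n × Fin n) :=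
  vec (p.basis w Tpow ϑ * (p.basis w Tpow ϑ).transpose)

/-- `ϑ` is a best mini-batch: its projection matrix is closest to the approximate geometric median
of all of them. -/
def IsBest {S : Type} [MeasurableSpace S]
    (gm : MedianRoutine Lt (EuclideanSpace ℝ (Fin n × Fin n)) S) (Tpow Tgm : ℕ)
    (w : World n q r mt Lt ρ) (s : S) (ϑ : Fin Lt) : Prop :=
  ∀ ϑ' : Fin Lt, ‖p.proj w Tpow ϑ - gm.output Tgm (p.proj w Tpow) s‖ ≤
    ‖p.proj w Tpow ϑ' - gm.output Tgm (p.proj w Tpow) s‖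

/-- `U_out` is one of the estimates of the best mini-batches (ties are broken in any way). -/
def IsOutput {S : Type} [MeasurableSpace S]
    (gm : MedianRoutine Lt (EuclideanSpace ℝ (Fin n × Fin n)) S) (Tpow Tgm : ℕ)
    (w : World n q r mt Lt ρ) (s : S) (Uout : Matrix (Fin n) (Fin r) ℝ) : Prop :=
  ∃ ϑ : Fin Lt, p.IsBest gm Tpow Tgm w s ϑ ∧ Uout = p.basis w Tpow ϑ

/-! ### Communication -/

/-- All the messages exchanged, in both directions, between node `ℓ` and the center. -/
def transcript (w : World n q r mt Lt ρ) (Tpow : ℕ) (ℓ : Node Lt ρ) : List Message :=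
  [⟨1, 1, fun _ _ => p.alphaNode w.1 ℓ⟩, ⟨1, 1, fun _ _ => p.alpha w.1⟩,
    ⟨n, r, Matrix.of w.2⟩] ++
  (List.range Tpow).flatMap fun t =>
    [⟨q, r, p.VNode w t (p.powerIterate w t) ℓ⟩, ⟨q, r, p.VBatch w t (p.powerIterate w t) ℓ.1⟩,
      ⟨n, r, p.UNode w t (p.powerIterate w t) ℓ⟩, ⟨n, r, p.powerIterate w (t + 1) ℓ.1⟩]

/-- Communication cost of node `ℓ`: the number of scalars exchanged. -/
def commCost (w : World n q r mt Lt ρ) (Tpow : ℕ) (ℓ : Node Lt ρ) : ℕ :=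
  ((p.transcript w Tpow ℓ).map Message.size).sum

end Protocol

end ByzLRCS

end

/-!
Truncation at the threshold makes `X₀` of a mini-batch an average of bounded multiples of Gaussian
vectors, whose mean has the column space of `X*`. On half-nets of the unit balls its deviation is
controlled by Chernoff bounds for Gaussian chaos, so `X₀ = U* G + W` with `W` of norm at most a
multiple of `δ₀ / √r` times the smallest singular value of the signal. For such a matrix the
power method, from a random start, reaches accuracy of order `δ₀` in the subspace distance after
`log (n / η)` iterations, up to a probability of order `η` over the start.

All mini-batches share the start, so their failures are dependent. By Markov's inequality the
probability that more than a twentieth of the mini-batches without Byzantine nodes fail is still of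
order `η`. Fewer than 40% of the mini-batches contain Byzantine nodes, so at least 55% of the
projection matrices lie close to that of `U*`; the geometric median of any points with such a
majority stays close to them, and so does the mini-batch that is closest to it. Taking `η` of order
`n ^ (-10)`, or `n ^ (-10 L)`, makes the resulting probabilities better than required.
-/

namespace ByzLRCS

open scoped RealInnerProductSpace ENNReal Matrix

/-! ## Half-nets of the unit ball -/

section Nets

variable {E F : Type*} [NormedAddCommGroup E]

theorem packingNumber_half_closedBall_le (E : Type*) [NormedAddCommGroup E] [NormedSpace ℝ E]
    [FiniteDimensional ℝ E] :
    Metric.packingNumber (1 / 2) (Metric.closedBall (0 : E) 1) ≤ 5 ^ Module.finrank ℝ E := by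
  classical
  refine iSup_le fun C => iSup₂_le fun hball hsep => ?_
  by_contra! hlarge
  obtain ⟨t, htC, htcard⟩ :=
    Set.exists_subset_encard_eq (Order.add_one_le_of_lt hlarge)
  have htfin : t.Finite := Set.finite_of_encard_eq_coe (k := 5 ^ Module.finrank ℝ E + 1)
    (by simp [htcard])
  lift t to Finset E using htfin
  have hcard : (t.image fun y => (2 : ℝ) • y).card ≤ 5 ^ Module.finrank ℝ E := by
    apply Besicovitch.card_le_of_separated
    · simp only [Finset.forall_mem_image, norm_smul, Real.norm_ofNat]
      intro y hy
      linarith [mem_closedBall_zero_iff.1 (hball (htC hy))]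
    · simp only [Finset.forall_mem_image, ← smul_sub, norm_smul, Real.norm_ofNat]
      intro y hy z hz hne
      have hlt : ((1 / 2 : NNReal) : ℝ≥0∞) < edist y z :=
        hsep (htC hy) (htC hz) fun h => hne (by rw [h])
      rw [edist_dist, dist_eq_norm, ← ENNReal.toReal_lt_toReal (by simp) (by simp),
        ENNReal.toReal_ofReal (norm_nonneg _)] at hlt
      norm_num at hlt
      linarith
  rw [Finset.card_image_of_injective _ (smul_right_injective E two_ne_zero)] at hcard
  rw [Set.encard_coe_eq_coe_finsetCard] at htcard
  norm_cast at htcard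
  omega

theorem exists_finset_isCover_closedBall (E : Type*) [NormedAddCommGroup E] [NormedSpace ℝ E]
    [FiniteDimensional ℝ E] :
    ∃ N : Finset E, N.card ≤ 5 ^ Module.finrank ℝ E ∧ (∀ y ∈ N, ‖y‖ ≤ 1) ∧
      Metric.IsCover (1 / 2) (Metric.closedBall (0 : E) 1) N := by
  have hpack := packingNumber_half_closedBall_le E
  have hcov := (Metric.coveringNumber_le_packingNumber (1 / 2) (Metric.closedBall (0 : E) 1)).trans
    hpack
  have hfin : Metric.coveringNumber (1 / 2) (Metric.closedBall (0 : E) 1) ≠ ⊤ :=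
    ne_top_of_le_ne_top (by exact_mod_cast ENat.natCast_ne_top (5 ^ Module.finrank ℝ E)) hcov
  obtain ⟨N, hball, hNfin, hN, hcard⟩ := Metric.exists_set_encard_eq_coveringNumber hfin
  lift N to Finset E using hNfin
  rw [← hcard, Set.encard_coe_eq_coe_finsetCard] at hcov
  exact ⟨N, by exact_mod_cast hcov, fun y hy => mem_closedBall_zero_iff.1 (hball hy), hN⟩

theorem exists_norm_sub_le_of_isCover {N : Finset E}
    (hN : Metric.IsCover (1 / 2) (Metric.closedBall (0 : E) 1) N) {x : E} (hx : ‖x‖ ≤ 1) :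
    ∃ y ∈ N, ‖x - y‖ ≤ 1 / 2 := by
  have hmem := Metric.isCover_iff_subset_iUnion_closedBall.1 hN (mem_closedBall_zero_iff.2 hx)
  simpa [dist_eq_norm] using hmem

theorem norm_normalize_le_one [NormedSpace ℝ E] (x : E) : ‖NormedSpace.normalize x‖ ≤ 1 := by
  rcases eq_or_ne x 0 with rfl | hx
  · simp
  · exact (NormedSpace.norm_normalize hx).le

theorem inner_normalize_self [InnerProductSpace ℝ E] (x : E) :
    ⟪NormedSpace.normalize x, x⟫ = ‖x‖ := by
  rw [NormedSpace.normalize, real_inner_smul_left, real_inner_self_eq_norm_sq, sq, ← mul_assoc]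
  rcases eq_or_ne x 0 with rfl | hx
  · simp
  · rw [inv_mul_cancel₀ (norm_ne_zero_iff.2 hx), one_mul]

theorem norm_le_two_mul_of_isCover [InnerProductSpace ℝ E] {N : Finset E}
    (hN : Metric.IsCover (1 / 2) (Metric.closedBall (0 : E) 1) N) {w : E} {t : ℝ}
    (h : ∀ u ∈ N, ⟪u, w⟫ ≤ t) : ‖w‖ ≤ 2 * t := by
  obtain ⟨y, hy, hxy⟩ := exists_norm_sub_le_of_isCover hN (norm_normalize_le_one w)
  have hnear : ⟪NormedSpace.normalize w - y, w⟫ ≤ 1 / 2 * ‖w‖ :=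
    (real_inner_le_norm _ _).trans (by gcongr)
  rw [inner_sub_left, inner_normalize_self] at hnear
  linarith [h y hy]

theorem opNorm_le_two_mul_of_isCover [NormedSpace ℝ E] [NormedAddCommGroup F] [NormedSpace ℝ F]
    {N : Finset E} (hN : Metric.IsCover (1 / 2) (Metric.closedBall (0 : E) 1) N)
    (T : E →L[ℝ] F) {t : ℝ} (h : ∀ u ∈ N, ‖T u‖ ≤ t) : ‖T‖ ≤ 2 * t := by
  have ht : 0 ≤ t := by
    obtain ⟨y, hy, -⟩ := exists_norm_sub_le_of_isCover hN (x := 0) (by simp)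
    exact (norm_nonneg _).trans (h y hy)
  have hself : ‖T‖ ≤ t + ‖T‖ * (1 / 2) := by
    refine ContinuousLinearMap.opNorm_le_of_unit_norm (by positivity) fun x hx => ?_
    obtain ⟨y, hy, hxy⟩ := exists_norm_sub_le_of_isCover hN hx.le
    calc ‖T x‖ = ‖T y + T (x - y)‖ := by rw [← map_add, add_sub_cancel]
      _ ≤ ‖T y‖ + ‖T (x - y)‖ := norm_add_le _ _
      _ ≤ t + ‖T‖ * (1 / 2) := by
        gcongr
        · exact h y hy
        · exact (T.le_opNorm _).trans (by gcongr)
  linarith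

end Nets

/-! ## Robustness of the path following median -/

section Median

/-- The derivative along `u` of the penalty `g - log (1 + g)`, `g = √(1 + t² ‖v‖²)`, at `v`. -/
noncomputable def penaltySlope {E : Type*} [NormedAddCommGroup E] [InnerProductSpace ℝ E]
    (t : ℝ) (v u : E) : ℝ :=
  t ^ 2 * ⟪v, u⟫ / (1 + Real.sqrt (1 + t ^ 2 * ‖v‖ ^ 2))

section Slope

variable {E : Type*} [NormedAddCommGroup E] [InnerProductSpace ℝ E] {t d : ℝ} {v u : E}

theorem hasDerivAt_penalty (t : ℝ) (v u : E) :
    HasDerivAt (fun s : ℝ => Real.sqrt (1 + t ^ 2 * ‖v + s • u‖ ^ 2)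
      - Real.log (1 + Real.sqrt (1 + t ^ 2 * ‖v + s • u‖ ^ 2))) (penaltySlope t v u) 0 := by
  have hline : HasDerivAt (fun s : ℝ => v + s • u) u 0 := by
    simpa using ((hasDerivAt_id (0 : ℝ)).smul_const u).const_add v
  have hradicand : HasDerivAt (fun s : ℝ => 1 + t ^ 2 * ‖v + s • u‖ ^ 2)
      (t ^ 2 * (2 * ⟪v, u⟫)) 0 := by
    simpa only [zero_smul, add_zero] using (hline.norm_sq.const_mul (t ^ 2)).const_add 1
  have hsqrt := hradicand.sqrt (by positivity)
  have hpenalty := hsqrt.sub ((hsqrt.const_add 1).log (by positivity))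
  simp only [zero_smul, add_zero] at hpenalty
  refine hpenalty.congr_deriv ?_
  unfold penaltySlope
  have : 0 < Real.sqrt (1 + t ^ 2 * ‖v‖ ^ 2) := Real.sqrt_pos.2 (by positivity)
  field_simp
  ring

theorem neg_mul_norm_le_penaltySlope (ht : 0 ≤ t) (v u : E) :
    -(t * ‖u‖) ≤ penaltySlope t v u := by
  have hsqrt : t * ‖v‖ ≤ Real.sqrt (1 + t ^ 2 * ‖v‖ ^ 2) := by
    apply Real.le_sqrt_of_sq_le
    nlinarith
  have hinner : -(‖v‖ * ‖u‖) ≤ ⟪v, u⟫ :=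
    neg_le_of_abs_le (abs_real_inner_le_norm v u)
  unfold penaltySlope
  rw [le_div_iff₀ (by positivity)]
  have hdenom : t * ‖u‖ * (t * ‖v‖) ≤ t * ‖u‖ * (1 + Real.sqrt (1 + t ^ 2 * ‖v‖ ^ 2)) := by
    gcongr
    linarith
  nlinarith [mul_le_mul_of_nonneg_left hinner (sq_nonneg t)]

theorem lt_penaltySlope (ht : 0 < t) (hd : ‖v - u‖ ≤ d) (hu : 10 * d + 9 / t < ‖u‖) :
    9 / 11 * (t * ‖u‖) < penaltySlope t v u := by
  have hd0 : 0 ≤ d := (norm_nonneg _).trans hd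
  have hupos : 0 < ‖u‖ := by
    have : 0 < 9 / t := by positivity
    linarith
  have hnorm : ‖v‖ ≤ ‖u‖ + d := by linarith [norm_le_norm_add_norm_sub' v u]
  have hinner : ‖u‖ * (‖u‖ - d) ≤ ⟪v, u⟫ := by
    have hsplit : ⟪v, u⟫ = ‖u‖ ^ 2 + ⟪v - u, u⟫ := by
      rw [inner_sub_left, real_inner_self_eq_norm_sq]
      ring
    have := neg_le_of_abs_le ((abs_real_inner_le_norm (v - u) u).trans
      (mul_le_mul_of_nonneg_right hd (norm_nonneg _)))
    nlinarith
  have hsqrt : Real.sqrt (1 + t ^ 2 * ‖v‖ ^ 2) ≤ 1 + t * (‖u‖ + d) := by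
    rw [Real.sqrt_le_left (by positivity)]
    have hv : t * ‖v‖ ≤ t * (‖u‖ + d) := by gcongr
    have hv0 : 0 ≤ t * ‖v‖ := by positivity
    nlinarith
  have hscaled : 10 * (t * d) + 9 < t * ‖u‖ := by
    calc 10 * (t * d) + 9 = t * (10 * d + 9 / t) := by field_simp
      _ < t * ‖u‖ := by gcongr
  unfold penaltySlope
  rw [lt_div_iff₀ (by positivity)]
  calc 9 / 11 * (t * ‖u‖) * (1 + Real.sqrt (1 + t ^ 2 * ‖v‖ ^ 2))
      ≤ t * ‖u‖ * (9 / 11 * (2 + t * (‖u‖ + d))) := by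
        have : 0 < t * ‖u‖ := by positivity
        nlinarith
    _ < t * ‖u‖ * (t * (‖u‖ - d)) := by
        exact mul_lt_mul_of_pos_left (by nlinarith) (by positivity)
    _ = t ^ 2 * (‖u‖ * (‖u‖ - d)) := by ring
    _ ≤ t ^ 2 * ⟪v, u⟫ := by gcongr

end Slope

variable {K : ℕ} {E : Type} [NormedAddCommGroup E] [InnerProductSpace ℝ E] {z : Fin K → E}
  {zs : E} {d : ℝ} {G : Finset (Fin K)}

theorem sum_penaltySlope_eq_zero {t : ℝ} {x : E}
    (hx : IsMinOn (gmPenalized z t) Set.univ x) (u : E) :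
    ∑ i, penaltySlope t (x - z i) u = 0 := by
  have hderiv : HasDerivAt (fun s : ℝ => gmPenalized z t (x + s • u))
      (∑ i, penaltySlope t (x - z i) u) 0 := by
    simpa only [gmPenalized, add_sub_right_comm] using
      HasDerivAt.fun_sum fun i (_ : i ∈ Finset.univ) => hasDerivAt_penalty t (x - z i) u
  have hmin : IsLocalMin (fun s : ℝ => gmPenalized z t (x + s • u)) 0 :=
    Filter.Eventually.of_forall fun s => by simpa using hx (Set.mem_univ (x + s • u))
  exact hmin.hasDerivAt_eq_zero hderiv

/-- Otherwise the directional derivative towards `zs` at the minimizer would not vanish: the points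
of `G` contribute more to it than the other ones can compensate, as `0.55 · 9 / 11 = 0.45`. -/
theorem norm_sub_le_of_isMinOn_gmPenalized {t : ℝ} (ht : 0 < t) {x : E}
    (hx : IsMinOn (gmPenalized z t) Set.univ x) (hG : G.Nonempty)
    (hnear : ∀ i ∈ G, ‖z i - zs‖ ≤ d) (hcard : 0.55 * (K : ℝ) ≤ G.card) :
    ‖x - zs‖ ≤ 10 * d + 9 / t := by
  by_contra! hfar
  set u := x - zs
  have hnearSum : G.card * (9 / 11 * (t * ‖u‖)) < ∑ i ∈ G, penaltySlope t (x - z i) u := by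
    rw [← nsmul_eq_mul, ← Finset.sum_const]
    refine Finset.sum_lt_sum_of_nonempty hG fun i hi => lt_penaltySlope ht ?_ hfar
    rw [sub_sub_sub_cancel_left, norm_sub_rev]
    exact hnear i hi
  have hfarSum : -((K - G.card) * (t * ‖u‖)) ≤ ∑ i ∈ Gᶜ, penaltySlope t (x - z i) u := by
    have hcompl : (Gᶜ.card : ℝ) = K - G.card := by
      simp [Finset.card_compl, Nat.cast_sub (card_finset_fin_le G)]
    rw [← hcompl, ← mul_neg, ← nsmul_eq_mul, ← Finset.sum_const]
    exact Finset.sum_le_sum fun i _ => neg_mul_norm_le_penaltySlope ht.le _ _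
  have htotal := Finset.sum_add_sum_compl G fun i => penaltySlope t (x - z i) u
  rw [sum_penaltySlope_eq_zero hx] at htotal
  have hmajority : 0 ≤ ((G.card : ℝ) * (9 / 11) - (K - G.card)) * (t * ‖u‖) := by
    apply mul_nonneg _ (by positivity)
    norm_num at hcard
    linarith
  linarith

theorem MedianRoutine.norm_output_sub_le {S : Type} [MeasurableSpace S] [MeasurableSpace E]
    (A : MedianRoutine K E S) {T : ℕ} {εc : ℝ} (hε : εc ≤ 1) {s : S}
    (hs : gmObjective z (gmCenter z) ≠ 0 → A.LineSearchesSucceed T εc z s) (hG : G.Nonempty)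
    (hnear : ∀ i ∈ G, ‖z i - zs‖ ≤ d) (hcard : 0.55 * (K : ℝ) ≤ G.card) :
    ‖A.output T z s - zs‖ ≤
      10 * d + 4000 * gmObjective z (gmCenter z) / (1 + 1 / 600) ^ T := by
  have hobj : 0 ≤ gmObjective z (gmCenter z) := Finset.sum_nonneg fun _ _ => norm_nonneg _
  obtain ⟨i, hi⟩ := id hG
  unfold MedianRoutine.output
  split_ifs with h0
  · have hcenter : gmCenter z = z i := by
      rw [← sub_eq_zero, ← norm_eq_zero]
      exact (Finset.sum_eq_zero_iff_of_nonneg fun _ _ => norm_nonneg _).1 h0 i (Finset.mem_univ i)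
    rw [h0, hcenter, mul_zero, zero_div, add_zero]
    linarith [hnear i hi, norm_nonneg (z i - zs)]
  · obtain ⟨xc, hxc, hdist⟩ := hs h0 T le_rfl
    have : 0 < gmObjective z (gmCenter z) := lt_of_le_of_ne hobj (Ne.symm h0)
    have ht : 0 < gmPath z T := by unfold gmPath; positivity
    have hmin := norm_sub_le_of_isMinOn_gmPenalized ht hxc hG hnear hcard
    have hpath : 4000 * gmObjective z (gmCenter z) / (1 + 1 / 600) ^ T = 10 / gmPath z T := by
      unfold gmPath
      field_simp
      norm_num
    calc ‖A.iterate z s T - zs‖ ≤ ‖A.iterate z s T - xc‖ + ‖xc - zs‖ :=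
          norm_sub_le_norm_sub_add_norm_sub _ _ _
      _ ≤ 1 / gmPath z T + (10 * d + 9 / gmPath z T) := by
          gcongr
          exact hdist.trans (by gcongr)
      _ = _ := by rw [hpath]; ring

end Median

/-! ## Sums of independent variables -/

section Chernoff

variable {I : Type*} [Fintype I] {Ω : Type*} [MeasurableSpace Ω] {γ : Measure Ω}
  [IsProbabilityMeasure γ] {f : I → Ω → ℝ}

theorem lintegral_exp_sum_pi_le (hf : ∀ i, Measurable (f i)) {b : I → ℝ}
    (hb : ∀ i, ∫⁻ a, ENNReal.ofReal (Real.exp (f i a)) ∂γ ≤ ENNReal.ofReal (Real.exp (b i))) :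
    ∫⁻ ω, ENNReal.ofReal (Real.exp (∑ i, f i (ω i))) ∂Measure.pi (fun _ : I => γ) ≤
      ENNReal.ofReal (Real.exp (∑ i, b i)) := by
  have hind : iIndepFun (fun i (ω : I → Ω) => ENNReal.ofReal (Real.exp (f i (ω i))))
      (Measure.pi fun _ => γ) :=
    iIndepFun_pi (X := fun i a => ENNReal.ofReal (Real.exp (f i a)))
      fun i => (by fun_prop : Measurable _).aemeasurable
  have hexp : ∀ a : I → ℝ, ENNReal.ofReal (Real.exp (∑ i, a i)) =
      ∏ i, ENNReal.ofReal (Real.exp (a i)) := fun a => by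
    rw [Real.exp_sum, ENNReal.ofReal_prod_of_nonneg fun i _ => (Real.exp_pos _).le]
  simp_rw [hexp]
  rw [lintegral_prod_eq_prod_lintegral_of_indepFun Finset.univ _ hind fun i => by fun_prop]
  refine Finset.prod_le_prod' fun i _ => ?_
  rw [(measurePreserving_eval (fun _ : I => γ) i).lintegral_comp
    (f := fun a => ENNReal.ofReal (Real.exp (f i a))) (by fun_prop)]
  exact hb i

theorem chernoff_pi (hf : ∀ i, Measurable (f i)) {b : I → ℝ}
    (hb : ∀ i, ∫⁻ a, ENNReal.ofReal (Real.exp (f i a)) ∂γ ≤ ENNReal.ofReal (Real.exp (b i)))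
    (t : ℝ) :
    Measure.pi (fun _ : I => γ) {ω | t + ∑ i, b i ≤ ∑ i, f i (ω i)} ≤
      ENNReal.ofReal (Real.exp (-t)) := by
  set μ := Measure.pi (fun _ : I => γ)
  set E := ENNReal.ofReal (Real.exp (t + ∑ i, b i))
  have hmarkov : E * μ {ω | t + ∑ i, b i ≤ ∑ i, f i (ω i)} ≤
      E * ENNReal.ofReal (Real.exp (-t)) :=
    calc E * μ {ω | t + ∑ i, b i ≤ ∑ i, f i (ω i)}
        ≤ E * μ {ω | E ≤ ENNReal.ofReal (Real.exp (∑ i, f i (ω i)))} := by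
          gcongr
          exact fun h => ENNReal.ofReal_le_ofReal (Real.exp_le_exp.2 h)
      _ ≤ ∫⁻ ω, ENNReal.ofReal (Real.exp (∑ i, f i (ω i))) ∂μ :=
          mul_meas_ge_le_lintegral (by fun_prop) _
      _ ≤ ENNReal.ofReal (Real.exp (∑ i, b i)) := lintegral_exp_sum_pi_le hf hb
      _ = E * ENNReal.ofReal (Real.exp (-t)) := by
          rw [← ENNReal.ofReal_mul (Real.exp_pos _).le, ← Real.exp_add]
          ring_nf
  exact (ENNReal.mul_le_mul_iff_right (by simp [Real.exp_pos]) ENNReal.ofReal_ne_top).1 hmarkov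

theorem chernoff_pi_quadratic (hf : ∀ i, Measurable (f i)) {c : I → ℝ} (hc : ∀ i, 0 ≤ c i)
    (hb : ∀ i, ∀ lam : ℝ, ∫⁻ a, ENNReal.ofReal (Real.exp (lam * f i a)) ∂γ ≤
      ENNReal.ofReal (Real.exp (lam ^ 2 * c i / 2))) {t S : ℝ}
    (ht : 0 ≤ t) (hS : ∑ i, c i ≤ S) : Measure.pi (fun _ : I => γ) {ω | t ≤ ∑ i, f i (ω i)} ≤
      ENNReal.ofReal (Real.exp (-(t ^ 2 / (2 * S)))) := by
  have hS0 : 0 ≤ S := (Finset.sum_nonneg fun i _ => hc i).trans hS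
  rcases hS0.eq_or_lt with rfl | hSpos
  · simpa using prob_le_one
  refine (measure_mono fun ω hω => ?_).trans (chernoff_pi (f := fun i a => t / S * f i a)
    (fun i => by fun_prop) (b := fun i => (t / S) ^ 2 * c i / 2) (fun i => hb i (t / S))
    (t ^ 2 / (2 * S)))
  simp only [Set.mem_ofPred_eq] at hω ⊢
  rw [← Finset.mul_sum, ← Finset.sum_div, ← Finset.mul_sum]
  calc t ^ 2 / (2 * S) + (t / S) ^ 2 * (∑ i, c i) / 2
      ≤ t ^ 2 / (2 * S) + (t / S) ^ 2 * S / 2 := by gcongr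
    _ = t / S * t := by field_simp; ring
    _ ≤ t / S * ∑ i, f i (ω i) := by gcongr

end Chernoff

section Levy

variable {I : Type*} [Fintype I] {Ω : Type*} {η ξ : I → Ω → ℝ} {s₀ ε : ℝ} {ω : Ω} {i₀ i₁ : I}
  {J : Finset I}

/-- The sum of the `ξ i` over the random index set `{i | η i ≤ s}`. -/
noncomputable def levelSum (η ξ : I → Ω → ℝ) (s : ℝ) (ω : Ω) : ℝ :=
  ∑ i, if η i ω ≤ s then ξ i ω else 0

/-- `i₀` realizes the lowest level, among those up to `s₀`, at which the level sum exceeds `ε`. -/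
structure IsFirstCrossing (η ξ : I → Ω → ℝ) (s₀ ε : ℝ) (ω : Ω) (i₀ : I) : Prop where
  level_le : η i₀ ω ≤ s₀
  lt_levelSum : ε < levelSum η ξ (η i₀ ω) ω
  levelSum_le : ∀ i₁, η i₁ ω < η i₀ ω → levelSum η ξ (η i₁ ω) ω ≤ ε

/-- The event that the level sums exceed `ε` at some level up to `s₀`, and that `J` is the index
set of the level sum that does so first. -/
def crossingEvent (η ξ : I → Ω → ℝ) (s₀ ε : ℝ) (J : Finset I) : Set Ω :=
  ⋃ i₀, {ω | IsFirstCrossing η ξ s₀ ε ω i₀} ∩ {ω | ∀ i, i ∈ J ↔ η i ω ≤ η i₀ ω}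

/-- `R` keeps the levels `η` and changes the sign of `ξ i` exactly for `i ∈ A`. -/
structure FlipsSigns (η ξ : I → Ω → ℝ) (A : Set I) (R : Ω → Ω) : Prop where
  level_eq : ∀ i ω, η i (R ω) = η i ω
  eq_neg : ∀ i ∈ A, ∀ ω, ξ i (R ω) = -ξ i ω
  eq_self : ∀ i ∉ A, ∀ ω, ξ i (R ω) = ξ i ω

theorem exists_levelSum_eq {s : ℝ} (h : levelSum η ξ s ω ≠ 0) :
    ∃ i, η i ω ≤ s ∧ levelSum η ξ (η i ω) ω = levelSum η ξ s ω := by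
  classical
  obtain ⟨j, -, hj⟩ := Finset.exists_ne_zero_of_sum_ne_zero h
  obtain ⟨i, hi, hmax⟩ := (Finset.univ.filter fun i => η i ω ≤ s).exists_max_image
    (fun i => η i ω) ⟨j, by simpa using of_not_not fun hjs => hj (if_neg hjs)⟩
  simp only [Finset.mem_filter, Finset.mem_univ, true_and] at hi hmax
  have hlevel : ∀ j, η j ω ≤ η i ω ↔ η j ω ≤ s := fun j => ⟨fun h => h.trans hi, hmax j⟩
  exact ⟨i, hi, by simp only [levelSum, hlevel]⟩

theorem exists_isFirstCrossing (hε : 0 ≤ ε) {s : ℝ} (hs : s ≤ s₀) (h : ε < levelSum η ξ s ω) :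
    ∃ i₀, IsFirstCrossing η ξ s₀ ε ω i₀ := by
  classical
  obtain ⟨j, hj, hsum⟩ := exists_levelSum_eq (hε.trans_lt h).ne'
  obtain ⟨i₀, hi₀, hmin⟩ :=
    (Finset.univ.filter fun i => η i ω ≤ s₀ ∧ ε < levelSum η ξ (η i ω) ω).exists_min_image
      (fun i => η i ω) ⟨j, by simpa [hsum] using ⟨hj.trans hs, h⟩⟩
  simp only [Finset.mem_filter, Finset.mem_univ, true_and] at hi₀ hmin
  refine ⟨i₀, hi₀.1, hi₀.2, fun i₁ hi₁ => ?_⟩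
  by_contra! hcross
  exact (hmin i₁ ⟨hi₁.le.trans hi₀.1, hcross⟩).not_gt hi₁

theorem IsFirstCrossing.level_unique (h₀ : IsFirstCrossing η ξ s₀ ε ω i₀)
    (h₁ : IsFirstCrossing η ξ s₀ ε ω i₁) : η i₀ ω = η i₁ ω := by
  rcases lt_trichotomy (η i₀ ω) (η i₁ ω) with h | h | h
  · exact absurd h₀.lt_levelSum (h₁.levelSum_le i₀ h).not_gt
  · exact h
  · exact absurd h₁.lt_levelSum (h₀.levelSum_le i₁ h).not_gt

theorem subset_iUnion_crossingEvent (hε : 0 ≤ ε) :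
    {ω | ∃ s ≤ s₀, ε < levelSum η ξ s ω} ⊆ ⋃ J, crossingEvent η ξ s₀ ε J := by
  classical
  rintro ω ⟨s, hs, hω⟩
  obtain ⟨i₀, hi₀⟩ := exists_isFirstCrossing hε hs hω
  exact Set.mem_iUnion.2 ⟨Finset.univ.filter fun i => η i ω ≤ η i₀ ω,
    Set.mem_iUnion.2 ⟨i₀, hi₀, by simp⟩⟩

theorem pairwise_disjoint_crossingEvent :
    Pairwise (Function.onFun Disjoint (crossingEvent η ξ s₀ ε)) := by
  refine fun J J' hJ => Set.disjoint_left.2 fun ω hω hω' => hJ ?_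
  obtain ⟨i₀, hcross, hmem⟩ := Set.mem_iUnion.1 hω
  obtain ⟨i₁, hcross', hmem'⟩ := Set.mem_iUnion.1 hω'
  ext i
  rw [hmem, hmem', hcross.level_unique hcross']

theorem FlipsSigns.crossing {R : Ω → Ω} (hR : FlipsSigns η ξ (J : Set I)ᶜ R)
    (hω : ω ∈ crossingEvent η ξ s₀ ε J) :
    R ω ∈ crossingEvent η ξ s₀ ε J ∧
      2 * ε < levelSum η ξ s₀ ω + levelSum η ξ s₀ (R ω) := by
  obtain ⟨i₀, hcross, hmem⟩ := Set.mem_iUnion.1 hω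
  have hlow : ∀ s ≤ η i₀ ω, levelSum η ξ s (R ω) = levelSum η ξ s ω := fun s hs => by
    refine Finset.sum_congr rfl fun i _ => ?_
    rw [hR.level_eq]
    refine if_ctx_congr Iff.rfl (fun h => hR.eq_self i ?_ ω) fun _ => rfl
    simpa using (hmem i).2 (h.trans hs)
  have hsum : levelSum η ξ s₀ ω + levelSum η ξ s₀ (R ω) = 2 * levelSum η ξ (η i₀ ω) ω := by
    simp only [levelSum, ← Finset.sum_add_distrib, Finset.mul_sum]
    refine Finset.sum_congr rfl fun i _ => ?_
    rw [hR.level_eq]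
    by_cases hi : i ∈ J
    · have hle := (hmem i).1 hi
      rw [if_pos (hle.trans hcross.level_le), if_pos (hle.trans hcross.level_le), if_pos hle,
        hR.eq_self i (by simpa using hi)]
      ring
    · rw [if_neg fun h => hi ((hmem i).2 h), hR.eq_neg i hi]
      split_ifs <;> ring
  refine ⟨Set.mem_iUnion.2 ⟨i₀, ⟨?_, ?_, fun i₁ hi₁ => ?_⟩, ?_⟩, ?_⟩
  · exact (hR.level_eq _ _).trans_le hcross.level_le
  · rw [hR.level_eq, hlow _ le_rfl]
    exact hcross.lt_levelSum
  · rw [hR.level_eq, hR.level_eq] at hi₁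
    rw [hR.level_eq, hlow _ hi₁.le]
    exact hcross.levelSum_le i₁ hi₁
  · simpa only [Set.mem_ofPred_eq, hR.level_eq] using hmem
  · linarith [hcross.lt_levelSum]

variable [MeasurableSpace Ω]

theorem measurable_levelSum {S : Ω → ℝ} (hη : ∀ i, Measurable (η i)) (hξ : ∀ i, Measurable (ξ i))
    (hS : Measurable S) : Measurable fun ω => levelSum η ξ (S ω) ω :=
  Finset.measurable_sum _ fun i _ =>
    Measurable.ite (measurableSet_le (hη i) hS) (hξ i) measurable_const

theorem measurableSet_crossingEvent (hη : ∀ i, Measurable (η i)) (hξ : ∀ i, Measurable (ξ i)) :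
    MeasurableSet (crossingEvent η ξ s₀ ε J) := by
  have hsum := fun i => measurable_levelSum hη hξ (hη i)
  have hpred : ∀ {S T : Ω → ℝ}, Measurable S → Measurable T → Measurable fun ω => S ω ≤ T ω :=
    fun hS hT => measurableSet_setOfPred.1 (measurableSet_le hS hT)
  have hcross : ∀ i₀, Measurable fun ω => η i₀ ω ≤ s₀ ∧ ¬levelSum η ξ (η i₀ ω) ω ≤ ε ∧
      ∀ i₁, ¬η i₀ ω ≤ η i₁ ω → levelSum η ξ (η i₁ ω) ω ≤ ε := fun i₀ =>
    (hpred (hη i₀) measurable_const).and ((hpred (hsum i₀) measurable_const).not.and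
      (Measurable.forall fun i₁ =>
        (hpred (hη i₀) (hη i₁)).not.imp (hpred (hsum i₁) measurable_const)))
  refine MeasurableSet.iUnion fun i₀ => MeasurableSet.inter ?_ ?_
  · convert measurableSet_setOfPred.2 (hcross i₀) using 3
    simp only [not_le]
    exact ⟨fun h => ⟨h.1, h.2, h.3⟩, fun h => ⟨h.1, h.2.1, h.2.2⟩⟩
  · exact measurableSet_setOfPred.2
      (Measurable.forall fun i => measurable_const.iff (hpred (hη i) (hη i₀)))

variable {μ : Measure Ω}

theorem measure_crossingEvent_le (hη : ∀ i, Measurable (η i)) (hξ : ∀ i, Measurable (ξ i))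
    {R : Ω → Ω} (hR : MeasurePreserving R μ μ) (hflip : FlipsSigns η ξ (J : Set I)ᶜ R) :
    μ (crossingEvent η ξ s₀ ε J) ≤
      2 * μ (crossingEvent η ξ s₀ ε J ∩ {ω | ε < levelSum η ξ s₀ ω}) := by
  set B := crossingEvent η ξ s₀ ε J ∩ {ω | ε < levelSum η ξ s₀ ω}
  have hB : MeasurableSet B := (measurableSet_crossingEvent hη hξ).inter
    (measurableSet_lt measurable_const (measurable_levelSum hη hξ measurable_const))
  have hsub : crossingEvent η ξ s₀ ε J ⊆ B ∪ R ⁻¹' B := fun ω hω => by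
    obtain ⟨hRω, hsum⟩ := hflip.crossing hω
    by_cases h : ε < levelSum η ξ s₀ ω
    · exact Or.inl ⟨hω, h⟩
    · exact Or.inr ⟨hRω, by simp only [Set.mem_ofPred_eq]; linarith⟩
  calc μ (crossingEvent η ξ s₀ ε J) ≤ μ B + μ (R ⁻¹' B) :=
        (measure_mono hsub).trans (measure_union_le _ _)
    _ = 2 * μ B := by rw [hR.measure_preimage hB.nullMeasurableSet, two_mul]

/-- Lévy's maximal inequality: reflect the summands that enter after the first crossing. -/
theorem measure_exists_lt_levelSum_le (hη : ∀ i, Measurable (η i)) (hξ : ∀ i, Measurable (ξ i))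
    {R : Set I → Ω → Ω} (hR : ∀ A, MeasurePreserving (R A) μ μ)
    (hflip : ∀ A, FlipsSigns η ξ A (R A)) (hε : 0 ≤ ε) :
    μ {ω | ∃ s ≤ s₀, ε < levelSum η ξ s ω} ≤ 2 * μ {ω | ε < levelSum η ξ s₀ ω} := by
  classical
  have hfinal : MeasurableSet {ω | ε < levelSum η ξ s₀ ω} :=
    measurableSet_lt measurable_const (measurable_levelSum hη hξ measurable_const)
  calc μ {ω | ∃ s ≤ s₀, ε < levelSum η ξ s ω}
      ≤ μ (⋃ J, crossingEvent η ξ s₀ ε J) := measure_mono (subset_iUnion_crossingEvent hε)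
    _ ≤ ∑ J, μ (crossingEvent η ξ s₀ ε J) := measure_iUnion_fintype_le _ _
    _ ≤ ∑ J, 2 * μ (crossingEvent η ξ s₀ ε J ∩ {ω | ε < levelSum η ξ s₀ ω}) :=
      Finset.sum_le_sum fun J _ => measure_crossingEvent_le hη hξ (hR _) (hflip _)
    _ = 2 * μ (⋃ J, crossingEvent η ξ s₀ ε J ∩ {ω | ε < levelSum η ξ s₀ ω}) := by
      rw [← Finset.mul_sum, measure_iUnion, tsum_fintype]
      · exact fun J J' h => (pairwise_disjoint_crossingEvent h).mono Set.inter_subset_left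
          Set.inter_subset_left
      · exact fun J => (measurableSet_crossingEvent hη hξ).inter hfinal
    _ ≤ 2 * μ {ω | ε < levelSum η ξ s₀ ω} := by
      gcongr
      exact Set.iUnion_subset fun J => Set.inter_subset_right

end Levy

/-! ## Gaussian vectors -/

section Reflection

variable {E : Type*} [NormedAddCommGroup E] [InnerProductSpace ℝ E]

theorem inner_reflection_span (x a : E) : ⟪x, (ℝ ∙ x).reflection a⟫ = ⟪x, a⟫ := by
  have h := (ℝ ∙ x).reflection.inner_map_map x a
  rwa [Submodule.reflection_mem_subspace_eq_self (Submodule.mem_span_singleton_self x)] at h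

theorem inner_reflection_of_mem_orthogonal {K : Submodule ℝ E} [K.HasOrthogonalProjection] {u : E}
    (hu : u ∈ Kᗮ) (a : E) : ⟪u, K.reflection a⟫ = -⟪u, a⟫ := by
  have h := K.reflection.inner_map_map u a
  rw [Submodule.reflection_mem_subspace_orthogonalComplement_eq_neg hu, inner_neg_left] at h
  linarith

theorem inner_starProjection_orthogonal_span (x u : E) :
    ⟪x, (ℝ ∙ x)ᗮ.starProjection u⟫ = 0 :=
  Submodule.mem_orthogonal_singleton_iff_inner_right.1 (Submodule.starProjection_apply_mem _ u)

open Classical in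
/-- Reflects `ω i` in the line through `x i`, for `i ∈ A`: this preserves `⟪x i, ω i⟫` and flips
the sign of the component of `ω i` orthogonal to `x i`. -/
noncomputable def reflectOn {I : Type*} (x : I → E) (A : Set I) (ω : I → E) (i : I) : E :=
  (if i ∈ A then (ℝ ∙ x i).reflection else LinearIsometryEquiv.refl ℝ E) (ω i)

theorem flipsSigns_reflectOn {I : Type*} (x : I → E) (v : I → ℝ) (u : E) (A : Set I) :
    FlipsSigns (fun i ω => |⟪x i, ω i⟫|)
      (fun i ω => v i * (⟪x i, ω i⟫ * ⟪(ℝ ∙ x i)ᗮ.starProjection u, ω i⟫)) A (reflectOn x A) where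
  level_eq i ω := by
    unfold reflectOn
    split_ifs
    · rw [inner_reflection_span]
    · rfl
  eq_neg i hi ω := by
    simp only [reflectOn, hi, if_true, inner_reflection_span, inner_reflection_of_mem_orthogonal
      (Submodule.starProjection_apply_mem _ u)]
    ring
  eq_self i hi ω := by simp only [reflectOn, hi, if_false, LinearIsometryEquiv.coe_refl, id]

end Reflection

section Gaussian

variable {E : Type*} [NormedAddCommGroup E] [InnerProductSpace ℝ E] [FiniteDimensional ℝ E]
  [MeasurableSpace E] [BorelSpace E] {I : Type*} [Fintype I]

theorem map_inner_stdGaussian (c : E) :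
    (stdGaussian E).map (fun a => ⟪c, a⟫) = gaussianReal 0 (‖c‖ ^ 2).toNNReal := by
  have h := IsGaussian.map_eq_gaussianReal (μ := stdGaussian E) (innerSL ℝ c)
  rw [integral_strongDual_stdGaussian, variance_dual_stdGaussian] at h
  simpa using h

theorem lintegral_comp_inner_stdGaussian {e : E} (he : ‖e‖ = 1) {f : ℝ → ℝ≥0∞}
    (hf : Measurable f) :
    ∫⁻ a, f ⟪e, a⟫ ∂stdGaussian E = ∫⁻ y, f y ∂gaussianReal 0 1 := by
  rw [← lintegral_map hf (by fun_prop), map_inner_stdGaussian, he, one_pow, Real.toNNReal_one]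

theorem measurePreserving_reflectOn (x : I → E) (A : Set I) :
    MeasurePreserving (reflectOn x A) (Measure.pi fun _ => stdGaussian E)
      (Measure.pi fun _ => stdGaussian E) :=
  measurePreserving_pi _ _ fun _ =>
    ⟨LinearIsometryEquiv.continuous _ |>.measurable, stdGaussian_map _⟩

theorem indepFun_inner_stdGaussian {x u : E} (h : ⟪x, u⟫ = 0) :
    IndepFun (fun a => ⟪x, a⟫) (fun a => ⟪u, a⟫) (stdGaussian E) := by
  apply HasGaussianLaw.indepFun_of_covariance_eq_zero
  · have hid : HasGaussianLaw (fun a : E => a) (stdGaussian E) := IsGaussian.hasGaussianLaw_id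
    exact hid.map ((innerSL ℝ x).prod (innerSL ℝ u))
  · rw [← covarianceBilin_apply_eq_cov (μ := stdGaussian E) IsGaussian.memLp_two_id x u,
      covarianceBilin_stdGaussian, innerSL_apply_apply]
    exact h

theorem map_inner_prod_stdGaussian {x u : E} (h : ⟪x, u⟫ = 0) :
    (stdGaussian E).map (fun a => (⟪x, a⟫, ⟪u, a⟫)) =
      (gaussianReal 0 (‖x‖ ^ 2).toNNReal).prod (gaussianReal 0 (‖u‖ ^ 2).toNNReal) := by
  rw [(indepFun_iff_map_prod_eq_prod_map_map (by fun_prop) (by fun_prop)).1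
    (indepFun_inner_stdGaussian h), map_inner_stdGaussian, map_inner_stdGaussian]

theorem lintegral_exp_mul_gaussianReal (v : NNReal) (t : ℝ) :
    ∫⁻ y, ENNReal.ofReal (Real.exp (t * y)) ∂(gaussianReal 0 v) =
      ENNReal.ofReal (Real.exp (v * t ^ 2 / 2)) := by
  have hmgf := mgf_gaussianReal (p := gaussianReal 0 v) (X := id) (μ := 0) (v := v) (by simp) t
  rw [← ofReal_integral_eq_lintegral_ofReal (integrable_exp_mul_gaussianReal t)
    (Filter.Eventually.of_forall fun _ => (Real.exp_pos _).le)]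
  congr 1
  simpa [mgf] using hmgf

theorem lintegral_exp_trunc_mul_le {x u : E} (h : ⟪x, u⟫ = 0) (s lam : ℝ) :
    ∫⁻ a, ENNReal.ofReal (Real.exp (lam * if |⟪x, a⟫| ≤ s then ⟪x, a⟫ * ⟪u, a⟫ else 0))
      ∂(stdGaussian E) ≤ ENNReal.ofReal (Real.exp (lam ^ 2 * (s ^ 2 * ‖u‖ ^ 2) / 2)) := by
  let trunc : ℝ → ℝ := fun y => if |y| ≤ s then y else 0
  have htrunc : ∀ y, trunc y ^ 2 ≤ s ^ 2 := fun y => by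
    simp only [trunc]
    split_ifs with hy
    · exact sq_le_sq' (by linarith [neg_abs_le y]) ((le_abs_self y).trans hy)
    · rw [zero_pow two_ne_zero]
      positivity
  have hmeas : Measurable trunc :=
    Measurable.ite (measurableSet_le (by fun_prop) measurable_const) measurable_id measurable_const
  have hexp : Measurable fun p : ℝ × ℝ =>
      ENNReal.ofReal (Real.exp (lam * trunc p.1 * p.2)) := by fun_prop
  calc ∫⁻ a, ENNReal.ofReal (Real.exp (lam * if |⟪x, a⟫| ≤ s then ⟪x, a⟫ * ⟪u, a⟫ else 0))
        ∂(stdGaussian E)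
      = ∫⁻ a, ENNReal.ofReal (Real.exp (lam * trunc ⟪x, a⟫ * ⟪u, a⟫)) ∂(stdGaussian E) := by
        simp only [trunc, mul_assoc, ite_mul, zero_mul]
    _ = ∫⁻ y, ∫⁻ z, ENNReal.ofReal (Real.exp (lam * trunc y * z))
          ∂(gaussianReal 0 (‖u‖ ^ 2).toNNReal) ∂(gaussianReal 0 (‖x‖ ^ 2).toNNReal) := by
        rw [← lintegral_map hexp (by fun_prop) (g := fun a => (⟪x, a⟫, ⟪u, a⟫)),
          map_inner_prod_stdGaussian h, lintegral_prod _ hexp.aemeasurable]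
    _ ≤ ∫⁻ _, ENNReal.ofReal (Real.exp (lam ^ 2 * (s ^ 2 * ‖u‖ ^ 2) / 2))
          ∂(gaussianReal 0 (‖x‖ ^ 2).toNNReal) := by
        refine lintegral_mono fun y => ?_
        rw [lintegral_exp_mul_gaussianReal, Real.coe_toNNReal _ (by positivity)]
        gcongr ENNReal.ofReal (Real.exp (?_ / 2))
        calc ‖u‖ ^ 2 * (lam * trunc y) ^ 2 = lam ^ 2 * (trunc y ^ 2 * ‖u‖ ^ 2) := by ring
          _ ≤ lam ^ 2 * (s ^ 2 * ‖u‖ ^ 2) :=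
            mul_le_mul_of_nonneg_left (mul_le_mul_of_nonneg_right (htrunc y) (by positivity))
              (by positivity)
    _ = ENNReal.ofReal (Real.exp (lam ^ 2 * (s ^ 2 * ‖u‖ ^ 2) / 2)) := by simp

theorem measure_trunc_sum_ge_le (x u : I → E) (hxu : ∀ i, ⟪x i, u i⟫ = 0) (hu : ∀ i, ‖u i‖ ≤ 1)
    (v : I → ℝ) {s ε S : ℝ} (hε : 0 ≤ ε) (hS : ∑ i, v i ^ 2 ≤ S) :
    Measure.pi (fun _ : I => stdGaussian E) {ω | ε ≤ ∑ i,
        v i * if |⟪x i, ω i⟫| ≤ s then ⟪x i, ω i⟫ * ⟪u i, ω i⟫ else 0} ≤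
      ENNReal.ofReal (Real.exp (-(ε ^ 2 / (2 * (s ^ 2 * S))))) := by
  refine chernoff_pi_quadratic (γ := stdGaussian E)
    (f := fun i a => v i * if |⟪x i, a⟫| ≤ s then ⟪x i, a⟫ * ⟪u i, a⟫ else 0) (fun i => ?_)
    (c := fun i => s ^ 2 * v i ^ 2) (fun i => by positivity) (fun i lam => ?_) hε ?_
  · exact measurable_const.mul (Measurable.ite (measurableSet_le (by fun_prop) measurable_const)
      (by fun_prop) measurable_const)
  · simp only [← mul_assoc lam]
    refine (lintegral_exp_trunc_mul_le (hxu i) s (lam * v i)).trans ?_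
    gcongr ENNReal.ofReal (Real.exp (?_ / 2))
    calc (lam * v i) ^ 2 * (s ^ 2 * ‖u i‖ ^ 2) ≤ (lam * v i) ^ 2 * (s ^ 2 * 1 ^ 2) := by
          gcongr
          exact hu i
      _ = lam ^ 2 * (s ^ 2 * v i ^ 2) := by ring
  · rw [← Finset.mul_sum]
    gcongr

/-- Uniformity over the truncation level `s` comes from Lévy's inequality, as reflections in the
lines through the `x i` do not affect which terms are truncated. -/
theorem measure_exists_trunc_sum_gt_le (x : I → E) (v : I → ℝ) {u : E} (hu : ‖u‖ ≤ 1)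
    {s₀ ε S : ℝ} (hε : 0 ≤ ε) (hS : ∑ i, v i ^ 2 ≤ S) :
    Measure.pi (fun _ : I => stdGaussian E) {ω | ∃ s ≤ s₀, ε < ∑ i, if |⟪x i, ω i⟫| ≤ s then
        v i * (⟪x i, ω i⟫ * ⟪(ℝ ∙ x i)ᗮ.starProjection u, ω i⟫) else 0} ≤
      2 * ENNReal.ofReal (Real.exp (-(ε ^ 2 / (2 * (s₀ ^ 2 * S))))) := by
  refine (measure_exists_lt_levelSum_le (fun i => by fun_prop) (fun i => by fun_prop)
    (measurePreserving_reflectOn x) (flipsSigns_reflectOn x v u) hε).trans ?_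
  gcongr
  refine le_trans (measure_mono fun ω hω => ?_) (measure_trunc_sum_ge_le x _
    (fun i => inner_starProjection_orthogonal_span (x i) u)
    (fun i => (Submodule.norm_starProjection_apply_le _ u).trans hu) v hε hS)
  simpa only [Set.mem_ofPred_eq, mul_ite, mul_zero] using hω.le

/-! ### Truncated second moments -/

/-- `y ↦ y² 1{|y| ≤ b}`, the contribution of a measurement `y` that is truncated at level `b`. -/
noncomputable def truncSq (b y : ℝ) : ℝ := if |y| ≤ b then y ^ 2 else 0

/-- `𝔼[ζ² 1{|ζ| ≤ b}]` for a standard Gaussian `ζ`. -/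
noncomputable def truncMean (b : ℝ) : ℝ := ∫ y, truncSq b y ∂(gaussianReal 0 1)

theorem truncSq_le_sq (b y : ℝ) : truncSq b y ≤ y ^ 2 := by
  unfold truncSq
  split_ifs <;> [rfl; positivity]

theorem truncSq_mem_Icc (b y : ℝ) : truncSq b y ∈ Set.Icc 0 (b ^ 2) := by
  unfold truncSq
  split_ifs with h
  · exact ⟨sq_nonneg y, sq_le_sq' (by linarith [neg_abs_le y]) ((le_abs_self y).trans h)⟩
  · exact ⟨le_rfl, sq_nonneg b⟩

@[fun_prop]
theorem measurable_truncSq (b : ℝ) : Measurable (truncSq b) :=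
  Measurable.ite (measurableSet_le (by fun_prop) measurable_const) (by fun_prop) measurable_const

theorem truncMean_pos {b : ℝ} (hb : 0 < b) : 0 < truncMean b := by
  unfold truncMean
  rw [integral_pos_iff_support_of_nonneg (fun y => (truncSq_mem_Icc b y).1)
    (Integrable.of_mem_Icc 0 (b ^ 2) (by fun_prop) (.of_forall (truncSq_mem_Icc b)))]
  have hsupport : Set.Ioo 0 b ⊆ Function.support (truncSq b) := fun y hy => by
    have : |y| ≤ b := by
      rw [abs_of_pos hy.1]
      exact hy.2.le
    simp [truncSq, this, hy.1.ne']
  refine pos_iff_ne_zero.2 fun h0 => ?_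
  have hvolume := gaussianReal_absolutelyContinuous' 0 (one_ne_zero (α := NNReal))
    (measure_mono_null hsupport h0)
  simp only [Real.volume_Ioo, sub_zero, ENNReal.ofReal_eq_zero] at hvolume
  exact hb.not_ge hvolume

theorem lintegral_exp_truncSq_le {e : E} (he : ‖e‖ = 1) (b c lam : ℝ) :
    ∫⁻ a, ENNReal.ofReal (Real.exp (lam * (c * (truncSq b ⟪e, a⟫ - truncMean b))))
      ∂(stdGaussian E) ≤ ENNReal.ofReal (Real.exp (lam ^ 2 * (c ^ 2 * b ^ 4 / 4) / 2)) := by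
  have hoeffding := hasSubgaussianMGF_of_mem_Icc (μ := gaussianReal 0 1) (X := truncSq b)
    (by fun_prop) (.of_forall (truncSq_mem_Icc b))
  rw [show ∫ y, truncSq b y ∂(gaussianReal 0 1) = truncMean b from rfl] at hoeffding
  have hmgf := hoeffding.mgf_le (lam * c)
  have hint := hoeffding.integrable_exp_mul (lam * c)
  simp only [mgf, mul_assoc] at hmgf hint
  rw [lintegral_comp_inner_stdGaussian he
    (f := fun y => ENNReal.ofReal (Real.exp (lam * (c * (truncSq b y - truncMean b)))))
    (by fun_prop), ← ofReal_integral_eq_lintegral_ofReal hint (.of_forall fun _ => by positivity)]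
  apply ENNReal.ofReal_le_ofReal (hmgf.trans (Real.exp_le_exp.2 (le_of_eq ?_)))
  simp
  ring

theorem measure_truncSq_sum_ge_le (e : I → E) (c : I → ℝ) (he : ∀ i, c i ≠ 0 → ‖e i‖ = 1) (b : ℝ)
    {t S : ℝ} (ht : 0 ≤ t) (hS : ∑ i, c i ^ 2 ≤ S) : Measure.pi (fun _ : I => stdGaussian E)
        {ω | t ≤ ∑ i, c i * (truncSq b ⟪e i, ω i⟫ - truncMean b)} ≤
      ENNReal.ofReal (Real.exp (-(2 * t ^ 2 / (b ^ 4 * S)))) := by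
  have hchernoff := chernoff_pi_quadratic (γ := stdGaussian E)
    (f := fun i a => c i * (truncSq b ⟪e i, a⟫ - truncMean b)) (fun i => by fun_prop)
    (c := fun i => c i ^ 2 * b ^ 4 / 4) (fun i => by positivity) (fun i lam => by
      rcases eq_or_ne (c i) 0 with hc | hc
      · simp [hc]
      · exact lintegral_exp_truncSq_le (he i hc) b (c i) lam) ht (S := S * b ^ 4 / 4)
    (by rw [← Finset.sum_div, ← Finset.sum_mul]; gcongr)
  convert hchernoff using 4
  rw [mul_comm (b ^ 4), mul_div_assoc', div_div_eq_mul_div]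
  ring

/-! ### Second moments -/

/-- `𝔼 exp(ζ² / 4)` for a standard Gaussian `ζ`. -/
noncomputable def expSqMean : ℝ := ∫ y, Real.exp (y ^ 2 / 4) ∂(gaussianReal 0 1)

theorem integrable_exp_sq : Integrable (fun y : ℝ => Real.exp (y ^ 2 / 4)) (gaussianReal 0 1) := by
  rw [gaussianReal_of_var_ne_zero _ one_ne_zero]
  rw [integrable_withDensity_iff (measurable_gaussianPDF 0 1)
    (Filter.Eventually.of_forall fun y => gaussianPDF_lt_top)]
  have h := (integrable_exp_neg_mul_sq (b := 1 / 4) (by norm_num)).const_mul (√(2 * Real.pi))⁻¹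
  refine h.congr (Filter.Eventually.of_forall fun y => ?_)
  simp only [toReal_gaussianPDF, gaussianPDFReal, NNReal.coe_one, mul_one, sub_zero]
  rw [mul_left_comm, ← Real.exp_add]
  congr 2
  ring

theorem one_le_expSqMean : 1 ≤ expSqMean := by
  have h : ∫ _ : ℝ, (1 : ℝ) ∂(gaussianReal 0 1) = 1 := by simp
  rw [← h]
  exact integral_mono (integrable_const _) integrable_exp_sq
    fun y => Real.one_le_exp (by positivity)

theorem lintegral_exp_sq_le {e : E} (he : ‖e‖ = 1) {s : ℝ} (hs : s ∈ Set.Icc 0 1) :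
    ∫⁻ a, ENNReal.ofReal (Real.exp (s * (⟪e, a⟫ ^ 2 / 4))) ∂(stdGaussian E) ≤
      ENNReal.ofReal (Real.exp (s * (expSqMean - 1))) := by
  obtain ⟨hs0, hs1⟩ := hs
  rw [lintegral_comp_inner_stdGaussian he
    (f := fun y => ENNReal.ofReal (Real.exp (s * (y ^ 2 / 4)))) (by fun_prop)]
  calc ∫⁻ y, ENNReal.ofReal (Real.exp (s * (y ^ 2 / 4))) ∂(gaussianReal 0 1)
      ≤ ∫⁻ y, ENNReal.ofReal (1 - s + s * Real.exp (y ^ 2 / 4)) ∂(gaussianReal 0 1) := by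
        refine lintegral_mono fun y => ENNReal.ofReal_le_ofReal ?_
        simpa using convexOn_exp.2 (Set.mem_univ 0) (Set.mem_univ (y ^ 2 / 4))
          (sub_nonneg.2 hs1) hs0 (by ring)
    _ = ENNReal.ofReal (1 - s + s * expSqMean) := by
        have hint := integrable_exp_sq.const_mul s
        rw [← ofReal_integral_eq_lintegral_ofReal (f := fun y => 1 - s + s * Real.exp (y ^ 2 / 4))
          ((integrable_const _).add hint)
          (.of_forall fun y => add_nonneg (sub_nonneg.2 hs1) (by positivity)),
          integral_add (integrable_const _) hint, integral_const_mul]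
        simp [expSqMean]
    _ ≤ ENNReal.ofReal (Real.exp (s * (expSqMean - 1))) := by
        apply ENNReal.ofReal_le_ofReal
        linarith [Real.add_one_le_exp (s * (expSqMean - 1))]

theorem measure_sq_sum_ge_le (e : I → E) (w : I → ℝ) {W : ℝ} (hW : 0 < W) (hw0 : ∀ i, 0 ≤ w i)
    (hw : ∀ i, w i ≤ W) (he : ∀ i, w i ≠ 0 → ‖e i‖ = 1) :
    Measure.pi (fun _ : I => stdGaussian E)
        {ω | 4 * expSqMean * ∑ i, w i ≤ ∑ i, w i * ⟪e i, ω i⟫ ^ 2} ≤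
      ENNReal.ofReal (Real.exp (-((∑ i, w i) / W))) := by
  have hchernoff := chernoff_pi (γ := stdGaussian E)
    (f := fun i a => w i / W * (⟪e i, a⟫ ^ 2 / 4)) (fun i => by fun_prop)
    (b := fun i => w i / W * (expSqMean - 1)) (fun i => by
      rcases eq_or_ne (w i) 0 with hwi | hwi
      · simp [hwi]
      · exact lintegral_exp_sq_le (he i hwi)
          ⟨div_nonneg (hw0 i) hW.le, (div_le_one hW).2 (hw i)⟩) ((∑ i, w i) / W)
  refine (measure_mono fun ω hω => ?_).trans hchernoff
  simp only [Set.mem_ofPred_eq] at hω ⊢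
  have hsum : ∑ i, w i / W * (⟪e i, ω i⟫ ^ 2 / 4) =
      (∑ i, w i * ⟪e i, ω i⟫ ^ 2) / (4 * W) := by
    rw [Finset.sum_div]
    exact Finset.sum_congr rfl fun i _ => by field_simp
  rw [← Finset.sum_mul, ← Finset.sum_div, hsum, le_div_iff₀ (by positivity)]
  refine le_trans (le_of_eq ?_) hω
  field_simp
  ring

end Gaussian

/-! ## The power method -/

section LogConvex

variable {c : ℕ → ℝ} (hc : ∀ k, 0 ≤ c k) (hlog : ∀ k, c (k + 1) ^ 2 ≤ c k * c (k + 2))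

include hc hlog

theorem pow_le_of_logConvex (k : ℕ) : c k ^ (k + 1) ≤ c (k + 1) ^ k * c 0 := by
  induction k with
  | zero => simp
  | succ k ih =>
    rcases (hc (k + 1)).eq_or_lt with hk | hk
    · rw [← hk, zero_pow (by omega)]
      exact mul_nonneg (pow_nonneg (hc _) _) (hc 0)
    · refine le_of_mul_le_mul_left ?_ (pow_pos hk k)
      calc c (k + 1) ^ k * c (k + 1) ^ (k + 1 + 1) = (c (k + 1) ^ 2) ^ (k + 1) := by ring
        _ ≤ (c k * c (k + 2)) ^ (k + 1) := pow_le_pow_left₀ (sq_nonneg _) (hlog k) _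
        _ = c k ^ (k + 1) * c (k + 2) ^ (k + 1) := mul_pow _ _ _
        _ ≤ c (k + 1) ^ k * c 0 * c (k + 2) ^ (k + 1) :=
          mul_le_mul_of_nonneg_right ih (pow_nonneg (hc _) _)
        _ = c (k + 1) ^ k * (c (k + 1 + 1) ^ (k + 1) * c 0) := by ring

theorem mul_le_of_logConvex {b : ℝ} (hb : 0 ≤ b) (m : ℕ)
    (hm : b ^ (m + 1) * c 0 ≤ c (m + 1)) : b * c m ≤ c (m + 1) := by
  refine le_of_pow_le_pow_left₀ (Nat.succ_ne_zero m) (hc _) ?_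
  calc (b * c m) ^ (m + 1) = b ^ (m + 1) * c m ^ (m + 1) := mul_pow _ _ _
    _ ≤ b ^ (m + 1) * (c (m + 1) ^ m * c 0) := by
      gcongr
      exact pow_le_of_logConvex hc hlog m
    _ = c (m + 1) ^ m * (b ^ (m + 1) * c 0) := by ring
    _ ≤ c (m + 1) ^ m * c (m + 1) := mul_le_mul_of_nonneg_left hm (pow_nonneg (hc _) m)
    _ = c (m + 1) ^ (m + 1) := by ring

end LogConvex

section Power

variable {E F : Type*} [NormedAddCommGroup E] [InnerProductSpace ℝ E] [FiniteDimensional ℝ E]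
  [NormedAddCommGroup F] [InnerProductSpace ℝ F]

theorem inner_apply_lt_of_inner_eigenvectorBasis_eq_zero {H : E →ₗ[ℝ] E} (hH : H.IsSymmetric)
    {N : ℕ} (hN : Module.finrank ℝ E = N) {a : ℝ} {u : E} (hu : u ≠ 0)
    (horth : ∀ i, a ≤ hH.eigenvalues hN i → ⟪hH.eigenvectorBasis hN i, u⟫ = 0) :
    ⟪u, H u⟫ < a * ‖u‖ ^ 2 := by
  set e := hH.eigenvectorBasis hN
  have hquad : ⟪u, H u⟫ = ∑ i, hH.eigenvalues hN i * ⟪e i, u⟫ ^ 2 := by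
    rw [← e.sum_inner_mul_inner]
    refine Finset.sum_congr rfl fun i _ => ?_
    rw [← hH, hH.apply_eigenvectorBasis hN, inner_smul_left, real_inner_comm]
    simp only [RCLike.ofReal_real_eq_id, id_eq, conj_trivial, e]
    ring
  obtain ⟨i, hi⟩ : ∃ i, ⟪e i, u⟫ ≠ 0 := by
    by_contra! hzero
    refine hu (e.repr.map_eq_zero_iff.1 ?_)
    ext i
    simpa [e.repr_apply_apply] using hzero i
  have hlt : ∀ j, ⟪e j, u⟫ ≠ 0 → hH.eigenvalues hN j < a := fun j hj =>
    not_le.1 fun hle => hj (horth j hle)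
  rw [hquad, ← e.sum_sq_inner_right, Finset.mul_sum]
  refine Finset.sum_lt_sum (fun j _ => ?_) ⟨i, Finset.mem_univ i,
    mul_lt_mul_of_pos_right (hlt i hi) (by positivity)⟩
  rcases eq_or_ne ⟪e j, u⟫ 0 with hj | hj
  · simp [hj]
  · exact mul_le_mul_of_nonneg_right (hlt j hj).le (by positivity)

theorem finrank_le_card_eigenvalues_ge {H : E →ₗ[ℝ] E} (hH : H.IsSymmetric) {N : ℕ}
    (hN : Module.finrank ℝ E = N) {a : ℝ} (S : Submodule ℝ E)
    (hS : ∀ u ∈ S, a * ‖u‖ ^ 2 ≤ ⟪u, H u⟫) :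
    Module.finrank ℝ S ≤ (Finset.univ.filter fun i => a ≤ hH.eigenvalues hN i).card := by
  set J := Finset.univ.filter fun i => a ≤ hH.eigenvalues hN i with hJ
  by_contra! hlt
  let coords : S →ₗ[ℝ] J → ℝ :=
    LinearMap.pi fun i => (innerₛₗ ℝ (hH.eigenvectorBasis hN i)).comp S.subtype
  have hker := LinearMap.ker_ne_bot_of_finrank_lt (f := coords) (by
    rwa [Module.finrank_fintype_fun_eq_card, Fintype.card_coe])
  obtain ⟨u, hu, hu0⟩ := (Submodule.ne_bot_iff _).1 hker
  refine (hS u u.2).not_gt (inner_apply_lt_of_inner_eigenvectorBasis_eq_zero hH hN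
    (by simpa using hu0) fun i hi => ?_)
  exact congrFun (LinearMap.mem_ker.1 hu) ⟨i, by simpa [hJ] using hi⟩

theorem exists_orthonormal_eigenvectors {H : E →ₗ[ℝ] E} (hH : H.IsSymmetric) {a : ℝ}
    (S : Submodule ℝ E) (hS : ∀ u ∈ S, a * ‖u‖ ^ 2 ≤ ⟪u, H u⟫) {r : ℕ}
    (hr : Module.finrank ℝ S = r) :
    ∃ (Q : Fin r → E) (l : Fin r → ℝ), Orthonormal ℝ Q ∧ (∀ i, H (Q i) = l i • Q i) ∧
      ∀ i, a ≤ l i := by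
  obtain ⟨J, hJS, hJ⟩ := Finset.exists_subset_card_eq
    (hr.symm.le.trans (finrank_le_card_eigenvalues_ge hH rfl S hS))
  let g : Fin r ≃ J := (J.equivFinOfCardEq hJ).symm
  refine ⟨fun i => hH.eigenvectorBasis rfl (g i), fun i => hH.eigenvalues rfl (g i),
    (hH.eigenvectorBasis rfl).orthonormal.comp _ (Subtype.val_injective.comp g.injective),
    fun i => hH.apply_eigenvectorBasis rfl _, fun i => by simpa using hJS (g i).2⟩

omit [FiniteDimensional ℝ E] in
theorem pow_mul_sqrt_sum_sq_inner_le {H : E →ₗ[ℝ] E} (hH : H.IsSymmetric) {a : ℝ} (ha : 0 ≤ a)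
    {ι : Type*} [Fintype ι] {Q : ι → E} {l : ι → ℝ} (hQ : Orthonormal ℝ Q)
    (heigen : ∀ i, H (Q i) = l i • Q i) (hal : ∀ i, a ≤ l i) (T : ℕ) (z : E) :
    a ^ T * √(∑ i, ⟪Q i, z⟫ ^ 2) ≤ ‖(H ^ T) z‖ := by
  have hpow : ∀ i, ⟪Q i, (H ^ T) z⟫ = l i ^ T * ⟪Q i, z⟫ := fun i => by
    induction T with
    | zero => simp
    | succ T ih =>
      rw [pow_succ', Module.End.mul_apply, ← hH, heigen, inner_smul_left, ih, conj_trivial]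
      ring
  refine le_of_sq_le_sq ?_ (norm_nonneg _)
  rw [mul_pow, Real.sq_sqrt (Finset.sum_nonneg fun _ _ => sq_nonneg _), Finset.mul_sum]
  refine le_trans (Finset.sum_le_sum fun i _ => ?_)
    (hQ.sum_inner_products_le (x := (H ^ T) z) (s := Finset.univ))
  rw [hpow, Real.norm_eq_abs, sq_abs, mul_pow]
  have := hal i
  gcongr

variable [FiniteDimensional ℝ F]

theorem inner_comp_adjoint (M : F →ₗ[ℝ] E) (u v : E) :
    ⟪u, (M ∘ₗ M.adjoint) v⟫ = ⟪M.adjoint u, M.adjoint v⟫ := by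
  rw [LinearMap.comp_apply, LinearMap.adjoint_inner_left]

theorem exists_orthonormal_pow_mul_sqrt_le (M : F →ₗ[ℝ] E) {θ : ℝ} (hθ : 0 ≤ θ)
    (S : Submodule ℝ E) (hM : ∀ u ∈ S, θ * ‖u‖ ≤ ‖M.adjoint u‖) {r : ℕ}
    (hr : Module.finrank ℝ S = r) :
    ∃ Q : Fin r → E, Orthonormal ℝ Q ∧ ∀ (T : ℕ) (z : E),
      (θ ^ 2) ^ T * √(∑ i, ⟪Q i, z⟫ ^ 2) ≤ ‖((M ∘ₗ M.adjoint) ^ T) z‖ := by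
  have hsymm := M.isSymmetric_self_comp_adjoint
  obtain ⟨Q, l, hQ, heigen, hl⟩ := exists_orthonormal_eigenvectors hsymm (a := θ ^ 2) S
    (fun u hu => by
      rw [inner_comp_adjoint, real_inner_self_eq_norm_sq, ← mul_pow]
      exact pow_le_pow_left₀ (by positivity) (hM u hu) 2) hr
  exact ⟨Q, hQ, pow_mul_sqrt_sum_sq_inner_le hsymm (sq_nonneg θ) hQ heigen hl⟩

/-- The norms of the iterates `z, M†z, M M†z, M† M M†z, …` of the power method, including the
half steps. They form a log-convex sequence. -/
noncomputable def halfStepNorm (M : F →ₗ[ℝ] E) (z : E) (k : ℕ) : ℝ :=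
  if Even k then ‖((M ∘ₗ M.adjoint) ^ (k / 2)) z‖
  else ‖M.adjoint (((M ∘ₗ M.adjoint) ^ (k / 2)) z)‖

theorem halfStepNorm_two_mul (M : F →ₗ[ℝ] E) (z : E) (j : ℕ) :
    halfStepNorm M z (2 * j) = ‖((M ∘ₗ M.adjoint) ^ j) z‖ := by
  simp [halfStepNorm]

theorem halfStepNorm_two_mul_add_one (M : F →ₗ[ℝ] E) (z : E) (j : ℕ) :
    halfStepNorm M z (2 * j + 1) = ‖M.adjoint (((M ∘ₗ M.adjoint) ^ j) z)‖ := by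
  have hhalf : (2 * j + 1) / 2 = j := by omega
  simp [halfStepNorm, hhalf]

theorem halfStepNorm_nonneg (M : F →ₗ[ℝ] E) (z : E) (k : ℕ) : 0 ≤ halfStepNorm M z k := by
  unfold halfStepNorm
  split_ifs <;> positivity

theorem halfStepNorm_sq_le (M : F →ₗ[ℝ] E) (z : E) (k : ℕ) :
    halfStepNorm M z (k + 1) ^ 2 ≤ halfStepNorm M z k * halfStepNorm M z (k + 2) := by
  rcases Nat.even_or_odd' k with ⟨j, rfl | rfl⟩
  · rw [show 2 * j + 2 = 2 * (j + 1) by ring, halfStepNorm_two_mul_add_one, halfStepNorm_two_mul,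
      halfStepNorm_two_mul, ← real_inner_self_eq_norm_sq, ← inner_comp_adjoint, pow_succ',
      Module.End.mul_apply]
    exact real_inner_le_norm _ _
  · rw [show 2 * j + 1 + 1 = 2 * (j + 1) by ring,
      show 2 * j + 1 + 2 = 2 * (j + 1) + 1 by ring, halfStepNorm_two_mul_add_one,
      halfStepNorm_two_mul_add_one, halfStepNorm_two_mul, ← real_inner_self_eq_norm_sq]
    conv_lhs => rw [pow_succ', Module.End.mul_apply, inner_comp_adjoint, real_inner_comm]
    rw [pow_succ', Module.End.mul_apply]
    exact real_inner_le_norm _ _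

/-- By log-convexity, the norm grows the most in the last half step. -/
theorem mul_norm_adjoint_pow_apply_le (M : F →ₗ[ℝ] E) {b : ℝ} (hb : 0 ≤ b) (T : ℕ) (z : E)
    (hgrowth : b ^ (2 * T + 2) * ‖z‖ ≤ ‖((M ∘ₗ M.adjoint) ^ (T + 1)) z‖) :
    b * ‖M.adjoint (((M ∘ₗ M.adjoint) ^ T) z)‖ ≤ ‖((M ∘ₗ M.adjoint) ^ (T + 1)) z‖ := by
  have hzero : halfStepNorm M z 0 = ‖z‖ := by simp [halfStepNorm]
  have hlast : halfStepNorm M z (2 * T + 1 + 1) = ‖((M ∘ₗ M.adjoint) ^ (T + 1)) z‖ :=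
    halfStepNorm_two_mul M z (T + 1)
  have hstep := mul_le_of_logConvex (halfStepNorm_nonneg M z) (halfStepNorm_sq_le M z) hb
    (2 * T + 1) (by rwa [hlast, hzero])
  rwa [hlast, halfStepNorm_two_mul_add_one] at hstep

/-- The vectors `Q` span the dominant eigenspace of `M M†`. -/
theorem exists_orthonormal_power_method (M : F →ₗ[ℝ] E) (P : E →ₗ[ℝ] E) {ε θ : ℝ} (hθ : 0 < θ)
    (hε : 0 ≤ ε) (hP : ∀ w, ‖P (M w)‖ ≤ ε * ‖w‖) (S : Submodule ℝ E)
    (hM : ∀ u ∈ S, θ * ‖u‖ ≤ ‖M.adjoint u‖) {r : ℕ} (hr : Module.finrank ℝ S = r) :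
    ∃ Q : Fin r → E, Orthonormal ℝ Q ∧ ∀ (T : ℕ) (z : E),
      ‖z‖ ≤ 4 ^ (T + 1) * √(∑ i, ⟪Q i, z⟫ ^ 2) →
      ‖P (((M ∘ₗ M.adjoint) ^ (T + 1)) z)‖ ≤ 2 * ε / θ * ‖((M ∘ₗ M.adjoint) ^ (T + 1)) z‖ ∧
      (θ / 2) ^ (2 * T + 2) * ‖z‖ ≤ ‖((M ∘ₗ M.adjoint) ^ (T + 1)) z‖ := by
  obtain ⟨Q, hQ, hpow⟩ := exists_orthonormal_pow_mul_sqrt_le M hθ.le S hM hr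
  refine ⟨Q, hQ, fun T z hz => ?_⟩
  have hgrowth : (θ / 2) ^ (2 * T + 2) * ‖z‖ ≤ ‖((M ∘ₗ M.adjoint) ^ (T + 1)) z‖ :=
    calc (θ / 2) ^ (2 * T + 2) * ‖z‖
        ≤ (θ / 2) ^ (2 * T + 2) * (4 ^ (T + 1) * √(∑ i, ⟪Q i, z⟫ ^ 2)) := by gcongr
      _ = (θ ^ 2) ^ (T + 1) * √(∑ i, ⟪Q i, z⟫ ^ 2) := by
        rw [show 2 * T + 2 = 2 * (T + 1) by ring, pow_mul, ← mul_assoc, ← mul_pow]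
        ring
      _ ≤ ‖((M ∘ₗ M.adjoint) ^ (T + 1)) z‖ := hpow (T + 1) z
  refine ⟨?_, hgrowth⟩
  calc ‖P (((M ∘ₗ M.adjoint) ^ (T + 1)) z)‖
      = ‖P (M (M.adjoint (((M ∘ₗ M.adjoint) ^ T) z)))‖ := by
        rw [pow_succ', Module.End.mul_apply, LinearMap.comp_apply]
    _ ≤ ε * ‖M.adjoint (((M ∘ₗ M.adjoint) ^ T) z)‖ := hP _
    _ = 2 * ε / θ * (θ / 2 * ‖M.adjoint (((M ∘ₗ M.adjoint) ^ T) z)‖) := by field_simp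
    _ ≤ 2 * ε / θ * ‖((M ∘ₗ M.adjoint) ^ (T + 1)) z‖ := by
        gcongr
        exact mul_norm_adjoint_pow_apply_le M (by positivity) T z hgrowth

end Power

/-! ## Matrices as operators between Euclidean spaces -/

section Matrices

variable {a b n q r : ℕ}

theorem frob_sq_eq_sum (M : Matrix (Fin a) (Fin b) ℝ) : frob M ^ 2 = ∑ i, ∑ j, M i j ^ 2 :=
  Real.sq_sqrt (Finset.sum_nonneg fun _ _ => Finset.sum_nonneg fun _ _ => sq_nonneg _)

theorem frob_sq_eq_trace (M : Matrix (Fin a) (Fin b) ℝ) : frob M ^ 2 = (Mᵀ * M).trace := by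
  rw [frob_sq_eq_sum, Finset.sum_comm]
  simp only [Matrix.trace, Matrix.diag, Matrix.mul_apply, Matrix.transpose_apply, pow_two]

theorem frob_sq_eq_sum_norm_sq (M : Matrix (Fin a) (Fin b) ℝ) :
    frob M ^ 2 = ∑ j, ‖M.toEuclideanLin (EuclideanSpace.single j 1)‖ ^ 2 := by
  rw [frob_sq_eq_sum, Finset.sum_comm]
  refine Finset.sum_congr rfl fun j _ => ?_
  rw [EuclideanSpace.real_norm_sq_eq]
  exact Finset.sum_congr rfl fun i _ => by simp [Matrix.toLpLin_apply]

theorem norm_vec_sq (M : Matrix (Fin n) (Fin n) ℝ) : ‖vec M‖ ^ 2 = frob M ^ 2 := by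
  rw [frob_sq_eq_sum, EuclideanSpace.real_norm_sq_eq, Fintype.sum_prod_type]
  rfl

theorem toEuclideanLin_mul_apply {c : ℕ} (M : Matrix (Fin a) (Fin b) ℝ)
    (N : Matrix (Fin b) (Fin c) ℝ) (x : EuclideanSpace ℝ (Fin c)) :
    (M * N).toEuclideanLin x = M.toEuclideanLin (N.toEuclideanLin x) := by
  rw [Matrix.toLpLin_mul_same, LinearMap.comp_apply]

theorem adjoint_toEuclideanLin (M : Matrix (Fin a) (Fin b) ℝ) :
    M.toEuclideanLin.adjoint = Mᵀ.toEuclideanLin := by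
  rw [← Matrix.toEuclideanLin_conjTranspose_eq_adjoint,
    Matrix.conjTranspose_eq_transpose_of_trivial]

theorem norm_toEuclideanLin_of_orthonormal {U : Matrix (Fin n) (Fin r) ℝ} (hU : Uᵀ * U = 1)
    (x : EuclideanSpace ℝ (Fin r)) : ‖U.toEuclideanLin x‖ = ‖x‖ := by
  have hinner : ⟪U.toEuclideanLin x, U.toEuclideanLin x⟫ = ⟪x, x⟫ := by
    rw [← LinearMap.adjoint_inner_right, adjoint_toEuclideanLin, ← toEuclideanLin_mul_apply, hU,
      Matrix.toLpLin_one, LinearMap.id_apply]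
  rw [real_inner_self_eq_norm_sq, real_inner_self_eq_norm_sq] at hinner
  exact (sq_eq_sq₀ (norm_nonneg _) (norm_nonneg _)).1 hinner

theorem finrank_range_of_orthonormal {U : Matrix (Fin n) (Fin r) ℝ} (hU : Uᵀ * U = 1) :
    Module.finrank ℝ (LinearMap.range U.toEuclideanLin) = r := by
  have hinj : Function.Injective U.toEuclideanLin :=
    (injective_iff_map_eq_zero _).2 fun x hx => by
      rwa [← norm_eq_zero, norm_toEuclideanLin_of_orthonormal hU, norm_eq_zero] at hx
  rw [LinearMap.finrank_range_of_inj hinj, finrank_euclideanSpace_fin]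

theorem norm_transpose_toEuclideanLin_le {W : Matrix (Fin a) (Fin b) ℝ} {ε : ℝ}
    (hε : 0 ≤ ε) (hW : ∀ w, ‖W.toEuclideanLin w‖ ≤ ε * ‖w‖) (u : EuclideanSpace ℝ (Fin a)) :
    ‖Wᵀ.toEuclideanLin u‖ ≤ ε * ‖u‖ := by
  rcases (norm_nonneg (Wᵀ.toEuclideanLin u)).eq_or_lt with hzero | hpos
  · rw [← hzero]
    positivity
  · refine le_of_mul_le_mul_right ?_ hpos
    calc ‖Wᵀ.toEuclideanLin u‖ * ‖Wᵀ.toEuclideanLin u‖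
        = ⟪u, W.toEuclideanLin (Wᵀ.toEuclideanLin u)⟫ := by
          rw [← real_inner_self_eq_norm_mul_norm, ← adjoint_toEuclideanLin,
            LinearMap.adjoint_inner_left]
      _ ≤ ‖u‖ * (ε * ‖Wᵀ.toEuclideanLin u‖) :=
          (real_inner_le_norm _ _).trans (mul_le_mul_of_nonneg_left (hW _) (norm_nonneg u))
      _ = ε * ‖u‖ * ‖Wᵀ.toEuclideanLin u‖ := by ring

/-! ### Projections and the subspace distance -/

theorem proj_mul_self {U : Matrix (Fin n) (Fin r) ℝ} (hU : Uᵀ * U = 1) :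
    U * Uᵀ * (U * Uᵀ) = U * Uᵀ := by
  rw [Matrix.mul_assoc, ← Matrix.mul_assoc Uᵀ, hU, Matrix.one_mul]

theorem trace_proj {U : Matrix (Fin n) (Fin r) ℝ} (hU : Uᵀ * U = 1) : (U * Uᵀ).trace = r := by
  rw [Matrix.trace_mul_comm, hU, Matrix.trace_one, Fintype.card_fin]

theorem proj_compl_mul_self {U : Matrix (Fin n) (Fin r) ℝ} (hU : Uᵀ * U = 1) :
    (1 - U * Uᵀ) * U = 0 := by
  rw [Matrix.sub_mul, Matrix.one_mul, Matrix.mul_assoc, hU, Matrix.mul_one, sub_self]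

theorem transpose_proj_compl_mul_proj_compl {U : Matrix (Fin n) (Fin r) ℝ} (hU : Uᵀ * U = 1) :
    (1 - U * Uᵀ)ᵀ * (1 - U * Uᵀ) = 1 - U * Uᵀ := by
  have hsymm : (1 - U * Uᵀ)ᵀ = 1 - U * Uᵀ := by simp
  rw [hsymm, Matrix.mul_sub, Matrix.mul_one, ← Matrix.mul_assoc, proj_compl_mul_self hU,
    Matrix.zero_mul, sub_zero]

theorem norm_proj_compl_le {U : Matrix (Fin n) (Fin r) ℝ} (hU : Uᵀ * U = 1)
    (z : EuclideanSpace ℝ (Fin n)) : ‖(1 - U * Uᵀ).toEuclideanLin z‖ ≤ ‖z‖ := by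
  set w := (1 - U * Uᵀ).toEuclideanLin z with hw
  have hsq : ‖w‖ * ‖w‖ ≤ ‖w‖ * ‖z‖ := by
    rw [← real_inner_self_eq_norm_mul_norm]
    calc ⟪w, w⟫ = ⟪w, z⟫ := by
          conv_lhs => rw [hw, ← LinearMap.adjoint_inner_left, adjoint_toEuclideanLin,
            ← toEuclideanLin_mul_apply, transpose_proj_compl_mul_proj_compl hU]
      _ ≤ ‖w‖ * ‖z‖ := real_inner_le_norm _ _
  rcases (norm_nonneg w).eq_or_lt with hzero | hpos
  · rw [← hzero]
    exact norm_nonneg z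
  · exact le_of_mul_le_mul_left hsq hpos

theorem subspaceDist_sq {U Z : Matrix (Fin n) (Fin r) ℝ} (hU : Uᵀ * U = 1)
    (hZ : Zᵀ * Z = 1) : subspaceDist U Z ^ 2 = r - (U * Uᵀ * (Z * Zᵀ)).trace := by
  unfold subspaceDist
  rw [frob_sq_eq_trace, Matrix.transpose_mul, Matrix.mul_assoc, ← Matrix.mul_assoc (1 - U * Uᵀ)ᵀ,
    transpose_proj_compl_mul_proj_compl hU, Matrix.sub_mul, Matrix.mul_sub, Matrix.one_mul, hZ,
    Matrix.trace_sub, Matrix.trace_one, Fintype.card_fin, Matrix.trace_mul_comm, Matrix.mul_assoc]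

theorem norm_vec_proj_sub_sq {U Z : Matrix (Fin n) (Fin r) ℝ} (hU : Uᵀ * U = 1)
    (hZ : Zᵀ * Z = 1) : ‖vec (Z * Zᵀ) - vec (U * Uᵀ)‖ ^ 2 = 2 * subspaceDist U Z ^ 2 := by
  have hsymm : (Z * Zᵀ - U * Uᵀ)ᵀ = Z * Zᵀ - U * Uᵀ := by simp
  change ‖vec (Z * Zᵀ - U * Uᵀ)‖ ^ 2 = _
  rw [norm_vec_sq, frob_sq_eq_trace, subspaceDist_sq hU hZ, hsymm, Matrix.sub_mul, Matrix.mul_sub,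
    Matrix.mul_sub, proj_mul_self hU, proj_mul_self hZ, Matrix.trace_sub, Matrix.trace_sub,
    Matrix.trace_sub, trace_proj hU, trace_proj hZ, Matrix.trace_mul_comm (Z * Zᵀ) (U * Uᵀ)]
  ring

theorem norm_vec_proj_sq {Z : Matrix (Fin n) (Fin r) ℝ} (hZ : Zᵀ * Z = 1) :
    ‖vec (Z * Zᵀ)‖ ^ 2 = r := by
  have hsymm : (Z * Zᵀ)ᵀ = Z * Zᵀ := by simp
  rw [norm_vec_sq, frob_sq_eq_trace, hsymm, proj_mul_self hZ, trace_proj hZ]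

/-- The bound is on the column space of `Y`, of which `Z` is an orthonormal basis. -/
theorem subspaceDist_le_of_eq_mul {U Y Z : Matrix (Fin n) (Fin r) ℝ}
    {R : Matrix (Fin r) (Fin r) ℝ} (hZ : Zᵀ * Z = 1) (hY : Y = Z * R) {δ : ℝ} (hδ : 0 ≤ δ)
    (hinj : ∀ x, x ≠ 0 → Y.toEuclideanLin x ≠ 0)
    (hclose : ∀ x, x ≠ 0 →
      ‖(1 - U * Uᵀ).toEuclideanLin (Y.toEuclideanLin x)‖ ≤ δ * ‖Y.toEuclideanLin x‖) :
    subspaceDist U Z ≤ √r * δ := by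
  subst hY
  have hRinj : Function.Injective R.toEuclideanLin :=
    (injective_iff_map_eq_zero _).2 fun x hx => by
      by_contra hx0
      exact hinj x hx0 (by rw [toEuclideanLin_mul_apply, hx, map_zero])
  have hcol : ∀ j, ‖((1 - U * Uᵀ) * Z).toEuclideanLin (EuclideanSpace.single j 1)‖ ≤ δ := by
    intro j
    obtain ⟨x, hx⟩ := LinearMap.injective_iff_surjective.1 hRinj (EuclideanSpace.single j 1)
    have hx0 : x ≠ 0 := by
      rintro rfl
      simpa using hx.symm
    have hle := hclose x hx0
    rw [toEuclideanLin_mul_apply Z, hx, norm_toEuclideanLin_of_orthonormal hZ] at hle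
    simpa [toEuclideanLin_mul_apply] using hle
  refine le_of_sq_le_sq ?_ (by positivity)
  calc subspaceDist U Z ^ 2
      = ∑ j, ‖((1 - U * Uᵀ) * Z).toEuclideanLin (EuclideanSpace.single j 1)‖ ^ 2 :=
        frob_sq_eq_sum_norm_sq _
    _ ≤ ∑ _j : Fin r, δ ^ 2 :=
        Finset.sum_le_sum fun j _ => pow_le_pow_left₀ (norm_nonneg _) (hcol j) 2
    _ = (√r * δ) ^ 2 := by
        rw [Finset.sum_const, Finset.card_univ, Fintype.card_fin, nsmul_eq_mul, mul_pow,
          Real.sq_sqrt (Nat.cast_nonneg r)]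

/-! ### The power method for a perturbed low rank matrix -/

/-- The linear combinations of the vectors `u j` have a component in the span of the orthonormal
family `Q` that is at least `1 / c` times their norm: the block power method, with dominant
eigenspace `span Q`, may be started from `u`. -/
def StartGood {E : Type*} [NormedAddCommGroup E] [InnerProductSpace ℝ E] (Q u : Fin r → E)
    (c : ℝ) : Prop :=
  ∀ x : Fin r → ℝ, x ≠ 0 → 0 < ‖∑ j, x j • u j‖ ∧
    ‖∑ j, x j • u j‖ ≤ c * √(∑ i, ⟪Q i, ∑ j, x j • u j⟫ ^ 2)

/-- The columns of a matrix, as vectors of Euclidean space. -/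
def cols (M : Fin n → Fin r → ℝ) (j : Fin r) : EuclideanSpace ℝ (Fin n) :=
  WithLp.toLp 2 fun i => M i j

theorem toEuclideanLin_eq_sum_cols (M : Matrix (Fin n) (Fin r) ℝ)
    (x : EuclideanSpace ℝ (Fin r)) : M.toEuclideanLin x = ∑ j, x j • cols M j := by
  ext i
  simp [cols, Matrix.toLpLin_apply, Matrix.mulVec, dotProduct, mul_comm]

section LowRank

variable {U : Matrix (Fin n) (Fin r) ℝ} (hU : Uᵀ * U = 1) {W : Matrix (Fin n) (Fin q) ℝ}
  (G : Matrix (Fin r) (Fin q) ℝ) {ε : ℝ} (hW : ∀ w, ‖W.toEuclideanLin w‖ ≤ ε * ‖w‖)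

include hU hW

theorem norm_proj_compl_add_le (w : EuclideanSpace ℝ (Fin q)) :
    ‖(1 - U * Uᵀ).toEuclideanLin ((U * G + W).toEuclideanLin w)‖ ≤ ε * ‖w‖ := by
  rw [← toEuclideanLin_mul_apply, Matrix.mul_add, ← Matrix.mul_assoc, proj_compl_mul_self hU,
    Matrix.zero_mul, zero_add, toEuclideanLin_mul_apply]
  exact (norm_proj_compl_le hU _).trans (hW w)

theorem mul_norm_le_norm_transpose_add {θ : ℝ} (hε : 0 ≤ ε) (hεθ : ε ≤ θ)
    (hG : ∀ u, 2 * θ * ‖u‖ ≤ ‖Gᵀ.toEuclideanLin u‖) (x : EuclideanSpace ℝ (Fin r)) :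
    θ * ‖U.toEuclideanLin x‖ ≤ ‖(U * G + W)ᵀ.toEuclideanLin (U.toEuclideanLin x)‖ := by
  have hsplit : (U * G + W)ᵀ.toEuclideanLin (U.toEuclideanLin x) =
      Gᵀ.toEuclideanLin x + Wᵀ.toEuclideanLin (U.toEuclideanLin x) := by
    rw [← toEuclideanLin_mul_apply, Matrix.transpose_add, Matrix.transpose_mul, Matrix.add_mul,
      Matrix.mul_assoc, hU, Matrix.mul_one, map_add, LinearMap.add_apply,
      toEuclideanLin_mul_apply]
  have hnoise := norm_transpose_toEuclideanLin_le hε hW (U.toEuclideanLin x)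
  rw [norm_toEuclideanLin_of_orthonormal hU] at hnoise ⊢
  rw [hsplit]
  calc θ * ‖x‖ ≤ 2 * θ * ‖x‖ - ε * ‖x‖ := by nlinarith [norm_nonneg x]
    _ ≤ ‖Gᵀ.toEuclideanLin x‖ - ‖Wᵀ.toEuclideanLin (U.toEuclideanLin x)‖ :=
      sub_le_sub (hG x) hnoise
    _ ≤ _ := norm_sub_le_norm_add _ _

end LowRank

theorem exists_orthonormal_subspaceDist_le {U : Matrix (Fin n) (Fin r) ℝ} (hU : Uᵀ * U = 1)
    (M : Matrix (Fin n) (Fin q) ℝ) {ε θ : ℝ} (hθ : 0 < θ) (hε : 0 ≤ ε)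
    (hcompl : ∀ w, ‖(1 - U * Uᵀ).toEuclideanLin (M.toEuclideanLin w)‖ ≤ ε * ‖w‖)
    (hrange : ∀ x, θ * ‖U.toEuclideanLin x‖ ≤ ‖Mᵀ.toEuclideanLin (U.toEuclideanLin x)‖) :
    ∃ Q : Fin r → EuclideanSpace ℝ (Fin n), Orthonormal ℝ Q ∧
      ∀ (T : ℕ) (U₀ Z : Matrix (Fin n) (Fin r) ℝ) (R : Matrix (Fin r) (Fin r) ℝ),
        StartGood Q (cols U₀) (4 ^ (T + 1)) → Zᵀ * Z = 1 → (M * Mᵀ) ^ (T + 1) * U₀ = Z * R →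
        subspaceDist U Z ≤ √r * (2 * ε / θ) := by
  obtain ⟨Q, hQ, hpower⟩ := exists_orthonormal_power_method M.toEuclideanLin
    (1 - U * Uᵀ).toEuclideanLin hθ hε (by exact hcompl) (LinearMap.range U.toEuclideanLin)
    (by
      rintro _ ⟨x, rfl⟩
      rw [adjoint_toEuclideanLin]
      exact hrange x)
    (finrank_range_of_orthonormal hU)
  rw [adjoint_toEuclideanLin, ← Matrix.toLpLin_mul_same] at hpower
  refine ⟨Q, hQ, fun T U₀ Z R hstart hZ hR => ?_⟩
  have happ : ∀ x, ((M * Mᵀ) ^ (T + 1) * U₀).toEuclideanLin x =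
      ((M * Mᵀ) ^ (T + 1)).toEuclideanLin (∑ j, x j • cols U₀ j) := fun x => by
    rw [toEuclideanLin_mul_apply, toEuclideanLin_eq_sum_cols U₀]
  refine subspaceDist_le_of_eq_mul hZ hR (by positivity) (fun x hx => ?_) fun x hx => ?_ <;>
    obtain ⟨hpos, hle⟩ := hstart x (by simpa using hx) <;>
    obtain ⟨hclose, hgrowth⟩ := hpower T _ hle <;>
    rw [← Matrix.toLpLin_pow] at hclose hgrowth <;>
    rw [happ]
  · exact norm_pos_iff.1 (lt_of_lt_of_le (by positivity) hgrowth)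
  · exact hclose

end Matrices

/-! ## Probability tools -/

section Tools

theorem measure_ofReal_le_le_of_lintegral_le {α : Type*} [MeasurableSpace α] {μ : Measure α}
    {f : α → ℝ≥0∞} (hf : AEMeasurable f μ) {t a : ℝ} (ht : 0 < t)
    (hle : ∫⁻ x, f x ∂μ ≤ ENNReal.ofReal a) :
    μ {x | ENNReal.ofReal t ≤ f x} ≤ ENNReal.ofReal (a / t) := by
  rw [ENNReal.ofReal_div_of_pos ht]
  exact (meas_ge_le_lintegral_div hf (by simpa using ht) ENNReal.ofReal_ne_top).trans (by gcongr)

theorem ofReal_one_sub_le_iff {α : Type*} [MeasurableSpace α] {μ : Measure α}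
    [IsProbabilityMeasure μ] {G : Set α} {a : ℝ} :
    ENNReal.ofReal (1 - a) ≤ μ G ↔ 1 - a ≤ μ.real G :=
  ENNReal.ofReal_le_iff_le_toReal (measure_ne_top _ _)

-- `E` need not be measurable, so Markov's inequality is applied to a measurable hull of it.
theorem one_sub_le_prod_real {α β : Type*} [MeasurableSpace α] [MeasurableSpace β]
    {μ : Measure α} {ν : Measure β} [IsProbabilityMeasure μ] [IsProbabilityMeasure ν]
    {G : Set α} {E : Set (α × β)} {a b : ℝ} (ha : 0 ≤ a) (hb : 0 ≤ b)
    (hG : 1 - a ≤ μ.real G) (hE : ∀ x ∈ G, 1 - b ≤ ν.real {y | (x, y) ∈ E}) :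
    1 - a - b ≤ (μ.prod ν).real E := by
  rcases le_or_gt 1 b with hb1 | hb1
  · exact le_trans (by linarith) measureReal_nonneg
  set M := toMeasurable (μ.prod ν) E with hM
  have hMm : MeasurableSet M := measurableSet_toMeasurable _ _
  have hslice : ∀ x ∈ G, ENNReal.ofReal (1 - b) ≤ ν (Prod.mk x ⁻¹' M) := fun x hx =>
    (ofReal_one_sub_le_iff.2 (hE x hx)).trans
      (measure_mono fun _ hy => subset_toMeasurable (μ.prod ν) E hy)
  have hmarkov := mul_meas_ge_le_lintegral (μ := μ) (f := fun x => ν (Prod.mk x ⁻¹' M))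
    (measurable_measure_prodMk_left hMm) (ENNReal.ofReal (1 - b))
  rw [← Measure.prod_apply hMm, hM, measure_toMeasurable] at hmarkov
  have hprod : ENNReal.ofReal ((1 - b) * (1 - a)) ≤ (μ.prod ν) E := by
    rw [ENNReal.ofReal_mul (by linarith)]
    refine le_trans (mul_le_mul_right ?_ _) hmarkov
    exact (ofReal_one_sub_le_iff.2 hG).trans (measure_mono hslice)
  rw [ENNReal.ofReal_le_iff_le_toReal (measure_ne_top _ _)] at hprod
  exact le_trans (by nlinarith [mul_nonneg ha hb]) hprod

theorem one_sub_le_measureReal_of_compl {α : Type*} [MeasurableSpace α] {μ : Measure α}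
    [IsProbabilityMeasure μ] {G : Set α} {a : ℝ} (ha : 0 ≤ a)
    (h : μ Gᶜ ≤ ENNReal.ofReal a) : 1 - a ≤ μ.real G := by
  have hunion := measureReal_union_le (μ := μ) G Gᶜ
  have hcompl : μ.real Gᶜ ≤ a := ENNReal.toReal_le_of_le_ofReal ha h
  rw [Set.union_compl_self, probReal_univ] at hunion
  linarith

theorem measure_lt_card_filter_le {Ω ι : Type*} [MeasurableSpace Ω] {ν : Measure Ω} (G : Finset ι)
    (B : ι → Set Ω) {p θ : ℝ} (hθ : 0 < θ) (hB : ∀ i ∈ G, ν (B i) ≤ ENNReal.ofReal p) {N : ℕ}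
    (hN : 0 < N) (hG : G.card ≤ N) [∀ u, DecidablePred fun i => u ∈ B i] :
    ν {u | θ * (N : ℝ) < (G.filter fun i => u ∈ B i).card} ≤ ENNReal.ofReal (p / θ) := by
  have hN' : (0 : ℝ) < N := by exact_mod_cast hN
  have hmeas : ∀ i ∈ G, Measurable ((toMeasurable ν (B i)).indicator (1 : Ω → ℝ≥0∞)) :=
    fun i _ => measurable_one.indicator (measurableSet_toMeasurable _ _)
  have hexpect : ∫⁻ u, ∑ i ∈ G, (toMeasurable ν (B i)).indicator 1 u ∂ν ≤
      ENNReal.ofReal (N * p) := by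
    rw [lintegral_finsetSum _ hmeas]
    calc _ = ∑ i ∈ G, ν (B i) := Finset.sum_congr rfl fun i _ => by
            rw [lintegral_indicator_one (measurableSet_toMeasurable _ _), measure_toMeasurable]
      _ ≤ ∑ _i ∈ G, ENNReal.ofReal p := Finset.sum_le_sum hB
      _ = G.card * ENNReal.ofReal p := by simp
      _ ≤ N * ENNReal.ofReal p := by gcongr
      _ = _ := by rw [ENNReal.ofReal_mul (Nat.cast_nonneg N), ENNReal.ofReal_natCast]
  have hcard : ∀ u, ((G.filter fun i => u ∈ B i).card : ℝ≥0∞) ≤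
      ∑ i ∈ G, (toMeasurable ν (B i)).indicator 1 u := fun u => by
    rw [Finset.card_filter, Nat.cast_sum]
    refine Finset.sum_le_sum fun i _ => ?_
    split_ifs with h
    · rw [Set.indicator_of_mem (subset_toMeasurable ν (B i) h)]; simp
    · simp
  refine (measure_mono fun u hu => ?_).trans ((measure_ofReal_le_le_of_lintegral_le
    (Finset.measurable_fun_sum _ hmeas).aemeasurable (mul_pos hθ hN') hexpect).trans_eq ?_)
  · refine le_trans ?_ (hcard u)
    rw [← ENNReal.ofReal_natCast]
    exact ENNReal.ofReal_le_ofReal (le_of_lt hu)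
  · rw [mul_comm θ, mul_div_mul_left _ _ hN'.ne']

end Tools

/-! ## The random start -/

section Start

variable {E : Type*} [NormedAddCommGroup E] [InnerProductSpace ℝ E]

theorem exists_sum_sq_eq_one_inner_sum_smul_eq_zero {ι κ : Type*} [Fintype ι] [Fintype κ]
    (hcard : Fintype.card κ < Fintype.card ι) (Q : ι → E) (v : κ → E) :
    ∃ w : ι → ℝ, ∑ i, w i ^ 2 = 1 ∧ ∀ k, ⟪∑ i, w i • Q i, v k⟫ = 0 := by
  let f : EuclideanSpace ℝ ι →ₗ[ℝ] (κ → ℝ) :=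
    { toFun := fun w k => ∑ i, w i * ⟪Q i, v k⟫
      map_add' := fun a b => by ext k; simp [add_mul, Finset.sum_add_distrib]
      map_smul' := fun c a => by ext k; simp [Finset.mul_sum, mul_assoc] }
  have hker := LinearMap.ker_ne_bot_of_finrank_lt (f := f) (by simpa using hcard)
  obtain ⟨w, hw, hw0⟩ := (Submodule.ne_bot_iff _).1 hker
  have hnorm : ‖w‖ ≠ 0 := norm_ne_zero_iff.2 hw0
  refine ⟨fun i => ‖w‖⁻¹ * w i, ?_, fun k => ?_⟩
  · simp_rw [mul_pow]
    rw [← Finset.mul_sum, ← EuclideanSpace.real_norm_sq_eq]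
    field_simp
  · have horth : ∑ i, w i * ⟪Q i, v k⟫ = 0 := congrFun (LinearMap.mem_ker.1 hw) k
    rw [sum_inner]
    simp only [inner_smul_left, conj_trivial, mul_assoc]
    rw [← Finset.mul_sum, horth, mul_zero]

theorem norm_sum_smul_of_orthonormal {ι : Type*} [Fintype ι] {Q : ι → E} (hQ : Orthonormal ℝ Q)
    {w : ι → ℝ} (hw : ∑ i, w i ^ 2 = 1) : ‖∑ i, w i • Q i‖ = 1 := by
  have hsq : ‖∑ i, w i • Q i‖ ^ 2 = 1 := by
    rw [← real_inner_self_eq_norm_sq, hQ.inner_sum, ← hw]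
    simp [sq]
  exact (sq_eq_sq₀ (norm_nonneg _) zero_le_one).1 (by rw [hsq, one_pow])

theorem norm_sum_smul_le_mul_sqrt {r : ℕ} (u : Fin r → E) {x : Fin r → ℝ} {c : ℝ}
    (hc : 0 ≤ c) (hx : ∀ k, |x k| ≤ c) :
    ‖∑ k, x k • u k‖ ≤ c * √(r * ∑ k, ‖u k‖ ^ 2) := by
  calc ‖∑ k, x k • u k‖ ≤ ∑ k, c * ‖u k‖ := (norm_sum_le _ _).trans <| Finset.sum_le_sum
        fun k _ => by rw [norm_smul, Real.norm_eq_abs]; gcongr; exact hx k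
    _ = c * ∑ k, ‖u k‖ := by rw [Finset.mul_sum]
    _ ≤ _ := by
      gcongr
      refine Real.le_sqrt_of_sq_le ?_
      simpa using sq_sum_le_card_mul_sum_sq (s := Finset.univ) (f := fun k => ‖u k‖)

/-- The families `u` for which, after projection to the span of an orthonormal family `Q`, the
vector `u j` is at distance less than `s` from the span of the other ones. -/
def nearSpan {ι : Type*} [Fintype ι] (Q : ι → E) (j : ι) (s : ℝ) : Set (ι → E) :=
  {u | ∃ x : ι → ℝ, x j = 1 ∧ ∑ i, ⟪Q i, ∑ k, x k • u k⟫ ^ 2 < s ^ 2}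

theorem measurableSet_nearSpan {ι : Type*} [Fintype ι] [FiniteDimensional ℝ E]
    [MeasurableSpace E] [BorelSpace E] (Q : ι → E) (j : ι) (s : ℝ) :
    MeasurableSet (nearSpan Q j s) := by
  have hunion : nearSpan Q j s = ⋃ x : {x : ι → ℝ // x j = 1},
      {u | ∑ i, ⟪Q i, ∑ k, x.1 k • u k⟫ ^ 2 < s ^ 2} := by
    ext u; simp [nearSpan]
  rw [hunion]
  exact (isOpen_iUnion fun x => isOpen_lt (by fun_prop) continuous_const).measurableSet

theorem abs_mul_le_sqrt_of_notMem_nearSpan {ι : Type*} [Fintype ι] {Q u : ι → E} {j : ι} {s : ℝ}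
    (hu : u ∉ nearSpan Q j s) (x : ι → ℝ) :
    |x j| * s ≤ √(∑ i, ⟪Q i, ∑ k, x k • u k⟫ ^ 2) := by
  rcases eq_or_ne (x j) 0 with hxj | hxj
  · simp [hxj]
  refine Real.le_sqrt_of_sq_le ?_
  by_contra! hlt
  refine hu ⟨fun k => (x j)⁻¹ * x k, inv_mul_cancel₀ hxj, ?_⟩
  simp_rw [mul_smul, ← Finset.smul_sum, inner_smul_right, mul_pow]
  rw [← Finset.mul_sum, inv_pow, inv_mul_lt_iff₀ (by positivity), ← sq_abs, ← mul_pow]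
  exact hlt

theorem startGood_of_notMem_nearSpan {r : ℕ} {Q u : Fin r → E} {s c : ℝ} (hs : 0 < s)
    (hu : ∀ j, u ∉ nearSpan Q j s) (hc : √(r * ∑ k, ‖u k‖ ^ 2) ≤ c * s) : StartGood Q u c := by
  intro x hx
  obtain ⟨i, hi⟩ := Function.ne_iff.1 hx
  obtain ⟨j, -, hj⟩ := Finset.exists_max_image Finset.univ (fun j => |x j|) ⟨i, Finset.mem_univ i⟩
  have hxj : 0 < |x j| := (abs_pos.2 hi).trans_le (hj i (Finset.mem_univ i))
  have hlow := abs_mul_le_sqrt_of_notMem_nearSpan (hu j) x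
  have hup := norm_sum_smul_le_mul_sqrt u hxj.le fun k => hj k (Finset.mem_univ k)
  have hc0 : 0 ≤ c := nonneg_of_mul_nonneg_left ((Real.sqrt_nonneg _).trans hc) hs
  refine ⟨norm_pos_iff.2 fun h0 => ?_, ?_⟩
  · rw [h0] at hlow
    simp only [inner_zero_right, ne_eq, OfNat.ofNat_ne_zero, not_false_eq_true, zero_pow,
      Finset.sum_const_zero, Real.sqrt_zero] at hlow
    exact (mul_pos hxj hs).not_ge hlow
  · calc _ ≤ |x j| * (c * s) := hup.trans (by gcongr)
      _ = c * (|x j| * s) := by ring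
      _ ≤ _ := by gcongr

variable [FiniteDimensional ℝ E] [MeasurableSpace E] [BorelSpace E]

theorem gaussianReal_abs_lt_le (s : ℝ) :
    gaussianReal 0 1 {y | |y| < s} ≤ ENNReal.ofReal s := by
  have hdensity : ∀ y, gaussianPDFReal 0 1 y ≤ 1 / 2 := fun y => by
    have hexp : Real.exp (-(y - 0) ^ 2 / (2 * ((1 : NNReal) : ℝ))) ≤ 1 :=
      Real.exp_le_one_iff.2 (div_nonpos_of_nonpos_of_nonneg (by simp [sq_nonneg]) (by simp))
    have hsqrt : (2 : ℝ) ≤ √(2 * Real.pi * ((1 : NNReal) : ℝ)) :=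
      Real.le_sqrt_of_sq_le (by simp only [NNReal.coe_one]; linarith [Real.pi_gt_three])
    calc _ ≤ (2 : ℝ)⁻¹ * 1 := by unfold gaussianPDFReal; gcongr
      _ = _ := by norm_num
  have hset : {y : ℝ | |y| < s} = Set.Ioo (-s) s := by ext y; simp [abs_lt]
  rw [gaussianReal_apply 0 one_ne_zero]
  calc ∫⁻ y in {y : ℝ | |y| < s}, gaussianPDF 0 1 y
      ≤ ∫⁻ _ in {y : ℝ | |y| < s}, ENNReal.ofReal (1 / 2) :=
        lintegral_mono fun y => ENNReal.ofReal_le_ofReal (hdensity y)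
    _ = ENNReal.ofReal s := by
        rw [setLIntegral_const, hset, Real.volume_Ioo, ← ENNReal.ofReal_mul (by norm_num)]
        congr 1; ring

theorem measure_abs_inner_lt_le {e : E} (he : ‖e‖ = 1) (s : ℝ) :
    stdGaussian E {a | |⟪e, a⟫| < s} ≤ ENNReal.ofReal s := by
  have h := gaussianReal_abs_lt_le s
  rwa [← Real.toNNReal_one, ← one_pow 2, ← he, ← map_inner_stdGaussian e,
    Measure.map_apply (by fun_prop) (measurableSet_lt (by fun_prop) measurable_const)] at h

theorem lintegral_sq_gaussianReal : ∫⁻ y, ENNReal.ofReal (y ^ 2) ∂gaussianReal 0 1 = 1 := by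
  have hint : Integrable (fun y : ℝ => y ^ 2) (gaussianReal 0 1) :=
    (memLp_id_gaussianReal 2).integrable_sq
  have hvar := variance_id_gaussianReal (μ := 0) (v := 1)
  rw [variance_eq_integral (by fun_prop)] at hvar
  simp only [id_eq, integral_id_gaussianReal, sub_zero, NNReal.coe_one] at hvar
  rw [← ofReal_integral_eq_lintegral_ofReal hint
    (Filter.Eventually.of_forall fun _ => sq_nonneg _), hvar, ENNReal.ofReal_one]

theorem lintegral_norm_sq_stdGaussian :
    ∫⁻ a, ENNReal.ofReal (‖a‖ ^ 2) ∂(stdGaussian E) = Module.finrank ℝ E := by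
  set b := stdOrthonormalBasis ℝ E
  simp_rw [← b.sum_sq_inner_right, ENNReal.ofReal_sum_of_nonneg fun _ _ => sq_nonneg _]
  rw [lintegral_finsetSum _ fun i _ => by fun_prop]
  have hcoord : ∀ i, ∫⁻ a, ENNReal.ofReal (⟪b i, a⟫ ^ 2) ∂(stdGaussian E) = 1 := fun i =>
    (lintegral_comp_inner_stdGaussian (b.norm_eq_one i) (f := fun y => ENNReal.ofReal (y ^ 2))
      (by fun_prop)).trans lintegral_sq_gaussianReal
  simp [hcoord]

/-- Given the other vectors, some unit vector of the span of `Q` is orthogonal to all of them, and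
`u j` has a standard Gaussian component in its direction. -/
theorem measure_nearSpan_le {r : ℕ} {Q : Fin r → E} (hQ : Orthonormal ℝ Q) (j : Fin r)
    {s : ℝ} (hs : 0 ≤ s) :
    Measure.pi (fun _ : Fin r => stdGaussian E) (nearSpan Q j s) ≤ ENNReal.ofReal s := by
  obtain ⟨r, rfl⟩ : ∃ k, r = k + 1 := ⟨r - 1, by have := j.pos; omega⟩
  set e := MeasurableEquiv.piFinSuccAbove (fun _ : Fin (r + 1) => E) j
  have hmp := measurePreserving_piFinSuccAbove (fun _ : Fin (r + 1) => stdGaussian E) j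
  rw [← hmp.symm.measure_preimage_equiv, Measure.prod_apply_symm
    (e.symm.measurable (measurableSet_nearSpan Q j s))]
  suffices hslice : ∀ v, stdGaussian E {a | e.symm (a, v) ∈ nearSpan Q j s} ≤ ENNReal.ofReal s from
    (lintegral_mono hslice).trans_eq (by simp)
  intro v
  obtain ⟨w, hw, hwv⟩ := exists_sum_sq_eq_one_inner_sum_smul_eq_zero (by simp) Q v
  refine (measure_mono ?_).trans (measure_abs_inner_lt_le (norm_sum_smul_of_orthonormal hQ hw) s)
  rintro a ⟨x, hxj, hx⟩
  have hsum : ∑ k, x k • e.symm (a, v) k = a + ∑ k, x (j.succAbove k) • v k := by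
    have hins : e.symm (a, v) = j.insertNth (α := fun _ => E) a v := rfl
    rw [Fin.sum_univ_succAbove _ j, hxj, one_smul, hins]
    simp
  have hinner : ⟪∑ i, w i • Q i, a⟫ = ∑ i, w i * ⟪Q i, ∑ k, x k • e.symm (a, v) k⟫ := by
    calc _ = ⟪∑ i, w i • Q i, ∑ k, x k • e.symm (a, v) k⟫ := by
          rw [hsum, inner_add_right, inner_sum]
          simp [inner_smul_right, hwv]
      _ = _ := by simp [sum_inner, inner_smul_left]
  have hcauchy := Finset.sum_mul_sq_le_sq_mul_sq Finset.univ w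
    (fun i => ⟪Q i, ∑ k, x k • e.symm (a, v) k⟫)
  rw [← hinner, hw, one_mul] at hcauchy
  exact abs_lt_of_sq_lt_sq (hcauchy.trans_lt hx) hs

theorem measure_sum_norm_sq_ge_le {r : ℕ} {t : ℝ} (ht : 0 < t) :
    Measure.pi (fun _ : Fin r => stdGaussian E) {u | t ≤ ∑ j, ‖u j‖ ^ 2} ≤
      ENNReal.ofReal (Module.finrank ℝ E * r / t) := by
  have hcoord : ∀ j, ∫⁻ u, ENNReal.ofReal (‖u j‖ ^ 2) ∂Measure.pi (fun _ : Fin r => stdGaussian E) =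
      Module.finrank ℝ E := fun j =>
    ((measurePreserving_eval (fun _ : Fin r => stdGaussian E) j).lintegral_comp
      (f := fun a => ENNReal.ofReal (‖a‖ ^ 2)) (by fun_prop)).trans lintegral_norm_sq_stdGaussian
  refine (measure_mono fun u hu => ENNReal.ofReal_le_ofReal hu).trans
    (measure_ofReal_le_le_of_lintegral_le (Measurable.aemeasurable (by fun_prop)) ht (le_of_eq ?_))
  simp_rw [ENNReal.ofReal_sum_of_nonneg fun _ _ => sq_nonneg _]
  rw [lintegral_finsetSum _ fun i _ => by fun_prop, ENNReal.ofReal_mul (Nat.cast_nonneg _)]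
  simp only [hcoord, Finset.sum_const, Finset.card_univ, Fintype.card_fin, nsmul_eq_mul,
    ENNReal.ofReal_natCast, mul_comm]

theorem measure_not_startGood_le {r : ℕ} (hr : 0 < r) {Q : Fin r → E} (hQ : Orthonormal ℝ Q)
    {η c : ℝ} (hη : 0 < η) (hη1 : η ≤ 1) (hc : (Module.finrank ℝ E : ℝ) ^ 3 / η ^ 2 ≤ c) :
    Measure.pi (fun _ : Fin r => stdGaussian E) {u | ¬ StartGood Q u c} ≤
      ENNReal.ofReal (2 * η) := by
  set N : ℝ := (Module.finrank ℝ E : ℝ)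
  have hr1 : (1 : ℝ) ≤ r := by exact_mod_cast hr
  have hrN : (r : ℝ) ≤ N :=
    Nat.cast_le.2 (by simpa using hQ.linearIndependent.fintype_card_le_finrank)
  have hN : 1 ≤ N := hr1.trans hrN
  have hscale : √(r * (N * r / η)) ≤ c * (η / r) := by
    calc √(r * (N * r / η)) ≤ N ^ 2 / η := Real.sqrt_le_iff.2 ⟨by positivity, ?_⟩
      _ ≤ N ^ 3 / η ^ 2 * (η / r) := by
        rw [div_mul_div_comm, div_le_div_iff₀ hη (by positivity)]
        have : N ^ 2 * r * η ^ 2 ≤ N ^ 2 * N * η ^ 2 := by gcongr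
        nlinarith
      _ ≤ c * (η / r) := by gcongr
    calc r * (N * r / η) ≤ N * (N * N / η) := by gcongr
      _ = N ^ 3 / η := by ring
      _ ≤ N ^ 4 / η ^ 2 := by gcongr <;> first | exact hN | nlinarith
      _ = (N ^ 2 / η) ^ 2 := by ring
  have hsub : {u | ¬ StartGood Q u c} ⊆
      {u | N * r / η ≤ ∑ j, ‖u j‖ ^ 2} ∪ ⋃ j, nearSpan Q j (η / r) := by
    intro u hu
    contrapose! hu
    simp only [Set.mem_union, Set.mem_iUnion, not_or, not_exists, Set.mem_ofPred_eq,
      not_le] at hu ⊢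
    rw [not_not]
    exact startGood_of_notMem_nearSpan (by positivity) hu.2
      (hscale.trans' (Real.sqrt_le_sqrt (by gcongr; exact hu.1.le)))
  have hnear : Measure.pi (fun _ : Fin r => stdGaussian E) (⋃ j, nearSpan Q j (η / r)) ≤
      ENNReal.ofReal η := (measure_iUnion_fintype_le _ _).trans <| by
    calc _ ≤ ∑ _j : Fin r, ENNReal.ofReal (η / r) :=
          Finset.sum_le_sum fun j _ => measure_nearSpan_le hQ j (by positivity)
      _ = ENNReal.ofReal η := by
        rw [Finset.sum_const, Finset.card_univ, Fintype.card_fin, ← ENNReal.ofReal_nsmul,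
          nsmul_eq_mul, mul_div_cancel₀ _ (by positivity)]
  refine (measure_mono hsub).trans ((measure_union_le _ _).trans ((add_le_add
    (measure_sum_norm_sq_ge_le (by positivity)) hnear).trans_eq ?_))
  rw [div_div_cancel₀ (by positivity), ← ENNReal.ofReal_add hη.le hη.le, two_mul]

end Start

section Columns

theorem measurePreserving_curry {ι κ X : Type*} [Fintype ι] [Fintype κ] [MeasurableSpace X]
    (μ : Measure X) [IsProbabilityMeasure μ] :
    MeasurePreserving (MeasurableEquiv.curry ι κ X)
      (Measure.pi fun _ => μ) (Measure.pi fun _ => Measure.pi fun _ => μ) := by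
  refine ⟨MeasurableEquiv.measurable _, ?_⟩
  simpa only [Measure.infinitePi_eq_pi] using
    Measure.infinitePi_map_curry (ι := ι) (κ := κ) (X := X) (μ := fun _ _ => μ)

theorem measurePreserving_transpose {ι κ X : Type*} [Fintype ι] [Fintype κ] [MeasurableSpace X]
    (μ : Measure X) [IsProbabilityMeasure μ] :
    MeasurePreserving (fun (U : ι → κ → X) j i => U i j)
      (Measure.pi fun _ => Measure.pi fun _ => μ) (Measure.pi fun _ => Measure.pi fun _ => μ) :=
  (measurePreserving_curry μ).comp
    ((measurePreserving_piCongrLeft (fun _ => μ) (Equiv.prodComm ι κ)).comp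
      ((measurePreserving_curry μ).symm _))

theorem measurePreserving_cols {n r : ℕ} : MeasurePreserving (cols (n := n) (r := r))
    (Measure.pi fun _ => Measure.pi fun _ => gaussianReal 0 1)
    (Measure.pi fun _ : Fin r => stdGaussian (EuclideanSpace ℝ (Fin n))) :=
  (measurePreserving_pi _ _ fun _ => ⟨by fun_prop, map_pi_eq_stdGaussian⟩).comp
    (measurePreserving_transpose (gaussianReal 0 1))

end Columns

/-! ## Sampling in one mini-batch -/

theorem measure_not_forall_opNorm_le {E F Ω ι : Type*} [NormedAddCommGroup E]
    [InnerProductSpace ℝ E] [FiniteDimensional ℝ E] [NormedAddCommGroup F] [InnerProductSpace ℝ F]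
    [FiniteDimensional ℝ F] [MeasurableSpace Ω] {ν : Measure Ω} (T : ι → Ω → E →L[ℝ] F)
    {t p : ℝ} (hp : ∀ u v, ‖u‖ ≤ 1 → ‖v‖ ≤ 1 →
      ν {ω | ∃ i, t / 4 < ⟪u, T i ω v⟫} ≤ ENNReal.ofReal p) :
    ν {ω | ¬ ∀ i, ‖T i ω‖ ≤ t} ≤
      ENNReal.ofReal (5 ^ (Module.finrank ℝ E + Module.finrank ℝ F) * p) := by
  obtain ⟨Nu, hNu, hNu1, hNu2⟩ := exists_finset_isCover_closedBall F
  obtain ⟨Nv, hNv, hNv1, hNv2⟩ := exists_finset_isCover_closedBall E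
  have hsub : {ω | ¬ ∀ i, ‖T i ω‖ ≤ t} ⊆ ⋃ u ∈ Nu, ⋃ v ∈ Nv, {ω | ∃ i, t / 4 < ⟪u, T i ω v⟫} := by
    intro ω hω
    by_contra hcon
    simp only [Set.mem_iUnion, Set.mem_ofPred_eq, not_exists, not_lt] at hcon
    refine hω fun i => ?_
    have hop := opNorm_le_two_mul_of_isCover hNv2 (T i ω) fun v hv =>
      norm_le_two_mul_of_isCover hNu2 fun u hu => hcon u hu v hv i
    linarith
  have hcard : ((Nu.card * Nv.card : ℕ) : ℝ) ≤ 5 ^ (Module.finrank ℝ E + Module.finrank ℝ F) := by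
    rw [pow_add, mul_comm (5 ^ _)]
    exact_mod_cast Nat.mul_le_mul hNu hNv
  calc _ ≤ ∑ u ∈ Nu, ν (⋃ v ∈ Nv, {ω | ∃ i, t / 4 < ⟪u, T i ω v⟫}) :=
        (measure_mono hsub).trans (measure_biUnion_finset_le _ _)
    _ ≤ ∑ _u ∈ Nu, ∑ _v ∈ Nv, ENNReal.ofReal p :=
        Finset.sum_le_sum fun u hu => (measure_biUnion_finset_le _ _).trans
          (Finset.sum_le_sum fun v hv => hp u v (hNu1 u hu) (hNv1 v hv))
    _ = ENNReal.ofReal (Nu.card * Nv.card : ℕ) * ENNReal.ofReal p := by simp [mul_assoc]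
    _ ≤ _ := by
        rw [ENNReal.ofReal_mul (p := 5 ^ _) (by positivity)]
        gcongr

theorem inner_eq_norm_mul_inner_normalize {E : Type*} [NormedAddCommGroup E]
    [InnerProductSpace ℝ E] (x a : E) : ⟪x, a⟫ = ‖x‖ * ⟪NormedSpace.normalize x, a⟫ := by
  rw [← real_inner_smul_left, NormedSpace.norm_smul_normalize]

section Batch

variable {n q r mt ρ : ℕ}

/-- Indices of the measurements of one mini-batch: node, column, row. -/
abbrev BatchIndex (ρ q mt : ℕ) : Type := Fin ρ × Fin q × Fin mt

theorem sum_batchIndex (f : Fin q → ℝ) :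
    ∑ p : BatchIndex ρ q mt, f p.2.1 = ρ * mt * ∑ k, f k := by
  simp only [Fintype.sum_prod_type, Finset.sum_const, Finset.card_univ, Fintype.card_fin,
    nsmul_eq_mul, ← Finset.mul_sum]
  ring

theorem sum_batchIndex_mul (f : Fin q → ℝ) (g : BatchIndex ρ q mt → ℝ) :
    ∑ p : BatchIndex ρ q mt, f p.2.1 * g p = ∑ k, f k * ∑ l, ∑ i, g (l, k, i) := by
  simp only [Fintype.sum_prod_type, Finset.mul_sum]
  rw [Finset.sum_comm]

/-- The law of the measurement vectors of one mini-batch. -/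
noncomputable def batchLaw (n q mt ρ : ℕ) :
    Measure (BatchIndex ρ q mt → EuclideanSpace ℝ (Fin n)) :=
  Measure.pi fun _ => stdGaussian (EuclideanSpace ℝ (Fin n))

instance : IsProbabilityMeasure (batchLaw n q mt ρ) := by unfold batchLaw; infer_instance

section Energy

variable (x : Fin q → EuclideanSpace ℝ (Fin n)) {M : ℝ}

theorem truncMean_mul_sub_sum_sq_inner_le (b : ℝ)
    (ω : BatchIndex ρ q mt → EuclideanSpace ℝ (Fin n)) :
    truncMean b * (ρ * mt * ∑ k, ‖x k‖ ^ 2) - ∑ p, ⟪x p.2.1, ω p⟫ ^ 2 ≤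
      ∑ p, -‖x p.2.1‖ ^ 2 *
        (truncSq b ⟪NormedSpace.normalize (x p.2.1), ω p⟫ - truncMean b) := by
  rw [← sum_batchIndex, Finset.mul_sum, ← Finset.sum_sub_distrib]
  refine Finset.sum_le_sum fun p _ => ?_
  rw [inner_eq_norm_mul_inner_normalize (x p.2.1), mul_pow]
  have := mul_le_mul_of_nonneg_left
    (truncSq_le_sq b ⟪NormedSpace.normalize (x p.2.1), ω p⟫) (sq_nonneg ‖x p.2.1‖)
  linarith

theorem batchLaw_sum_sq_inner_le_le (hM : 0 < M) (hx : ∀ k, ‖x k‖ ^ 2 ≤ M) :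
    batchLaw n q mt ρ {ω | ∑ p, ⟪x p.2.1, ω p⟫ ^ 2 ≤
        truncMean 1 / 2 * (ρ * mt * ∑ k, ‖x k‖ ^ 2)} ≤
      ENNReal.ofReal (Real.exp (-(truncMean 1 ^ 2 / 2 * (ρ * mt * (∑ k, ‖x k‖ ^ 2) / M)))) := by
  have htail := measure_truncSq_sum_ge_le (I := BatchIndex ρ q mt)
    (fun p => NormedSpace.normalize (x p.2.1)) (fun p => -‖x p.2.1‖ ^ 2)
    (fun p hp => NormedSpace.norm_normalize fun hx0 => hp (by simp [hx0])) 1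
    (t := truncMean 1 / 2 * (ρ * mt * ∑ k, ‖x k‖ ^ 2)) (S := M * (ρ * mt * ∑ k, ‖x k‖ ^ 2))
    (by have := truncMean_pos one_pos; positivity) (by
      rw [← sum_batchIndex, Finset.mul_sum]
      refine Finset.sum_le_sum fun p _ => ?_
      rw [neg_sq, sq (‖x p.2.1‖ ^ 2)]
      gcongr
      exact hx _)
  refine (measure_mono fun ω hω => ?_).trans (htail.trans_eq ?_)
  · have hle := truncMean_mul_sub_sum_sq_inner_le x 1 ω
    simp only [Set.mem_ofPred_eq] at hω ⊢
    linarith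
  · congr 3
    rcases eq_or_ne ((ρ : ℝ) * mt * ∑ k, ‖x k‖ ^ 2) 0 with h0 | _
    · simp [h0]
    · field_simp

theorem batchLaw_le_sum_sq_inner_le (hM : 0 < M) (hx : ∀ k, ‖x k‖ ^ 2 ≤ M) :
    batchLaw n q mt ρ {ω | 4 * expSqMean * (ρ * mt * ∑ k, ‖x k‖ ^ 2) ≤
        ∑ p, ⟪x p.2.1, ω p⟫ ^ 2} ≤
      ENNReal.ofReal (Real.exp (-(ρ * mt * (∑ k, ‖x k‖ ^ 2) / M))) := by
  have htail := measure_sq_sum_ge_le (I := BatchIndex ρ q mt)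
    (fun p => NormedSpace.normalize (x p.2.1)) (fun p => ‖x p.2.1‖ ^ 2) hM
    (fun p => sq_nonneg _) (fun p => hx _)
    (fun p hp => NormedSpace.norm_normalize fun hx0 => hp (by simp [hx0]))
  rw [sum_batchIndex (fun k => ‖x k‖ ^ 2)] at htail
  simp only [← mul_pow, ← inner_eq_norm_mul_inner_normalize] at htail
  exact htail

end Energy

section Noise

variable (x : Fin q → EuclideanSpace ℝ (Fin n))

/-- The part of the truncated measurements orthogonal to the signals. -/
noncomputable def noisePart (s : ℝ) (ω : BatchIndex ρ q mt → EuclideanSpace ℝ (Fin n)) :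
    Matrix (Fin n) (Fin q) ℝ :=
  Matrix.of fun j k => ∑ l, ∑ i, if |⟪x k, ω (l, k, i)⟫| ≤ s then
    ⟪x k, ω (l, k, i)⟫ * (ℝ ∙ x k)ᗮ.starProjection (ω (l, k, i)) j else 0

theorem noisePart_toEuclideanLin (s : ℝ) (ω : BatchIndex ρ q mt → EuclideanSpace ℝ (Fin n))
    (v : EuclideanSpace ℝ (Fin q)) :
    (noisePart x s ω).toEuclideanLin v = ∑ p, if |⟪x p.2.1, ω p⟫| ≤ s then
      (v p.2.1 * ⟪x p.2.1, ω p⟫) • (ℝ ∙ x p.2.1)ᗮ.starProjection (ω p) else 0 := by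
  ext j
  simp only [Matrix.toLpLin_apply, Matrix.mulVec, dotProduct, noisePart, Matrix.of_apply,
    WithLp.ofLp_sum, Finset.sum_apply, Fintype.sum_prod_type, Finset.sum_mul]
  rw [Finset.sum_comm]
  refine Finset.sum_congr rfl fun l _ => Finset.sum_congr rfl fun k _ =>
    Finset.sum_congr rfl fun i _ => ?_
  split_ifs
  · simp only [PiLp.smul_apply, smul_eq_mul]
    ring
  · simp

theorem inner_noisePart (s : ℝ) (ω : BatchIndex ρ q mt → EuclideanSpace ℝ (Fin n))
    (u : EuclideanSpace ℝ (Fin n)) (v : EuclideanSpace ℝ (Fin q)) :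
    ⟪u, (noisePart x s ω).toEuclideanLin v⟫ = ∑ p, if |⟪x p.2.1, ω p⟫| ≤ s then
      v p.2.1 * (⟪x p.2.1, ω p⟫ * ⟪(ℝ ∙ x p.2.1)ᗮ.starProjection u, ω p⟫) else 0 := by
  rw [noisePart_toEuclideanLin, inner_sum]
  refine Finset.sum_congr rfl fun p _ => ?_
  split_ifs
  · rw [inner_smul_right, ← Submodule.inner_starProjection_left_eq_right, mul_assoc]
  · exact inner_zero_right u

theorem batchLaw_not_norm_noisePart_le_le {s₀ ε : ℝ} (hε : 0 ≤ ε) :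
    batchLaw n q mt ρ {ω | ¬ ∀ s ≤ s₀, ∀ w, ‖(noisePart x s ω).toEuclideanLin w‖ ≤ ε * ‖w‖} ≤
      ENNReal.ofReal (5 ^ (n + q) * (2 * Real.exp (-(ε ^ 2 / (32 * (s₀ ^ 2 * (ρ * mt))))))) := by
  have htail : ∀ (u : EuclideanSpace ℝ (Fin n)) (v : EuclideanSpace ℝ (Fin q)), ‖u‖ ≤ 1 →
      ‖v‖ ≤ 1 → batchLaw n q mt ρ
        {ω | ∃ s : Set.Iic s₀, ε / 4 < ⟪u, (noisePart x s ω).toEuclideanLin v⟫} ≤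
      ENNReal.ofReal (2 * Real.exp (-(ε ^ 2 / (32 * (s₀ ^ 2 * (ρ * mt)))))) := by
    intro u v hu hv
    have h := measure_exists_trunc_sum_gt_le (fun p : BatchIndex ρ q mt => x p.2.1)
      (fun p => v p.2.1) hu (s₀ := s₀) (ε := ε / 4) (S := ρ * mt) (by positivity) (by
        rw [sum_batchIndex (fun k => v k ^ 2), ← EuclideanSpace.real_norm_sq_eq]
        exact mul_le_of_le_one_right (by positivity) (pow_le_one₀ (norm_nonneg _) hv))
    refine (measure_mono ?_).trans (h.trans_eq ?_)
    · rintro ω ⟨⟨s, hs⟩, hlt⟩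
      exact ⟨s, hs, by rwa [inner_noisePart] at hlt⟩
    rw [ENNReal.ofReal_mul zero_le_two, ENNReal.ofReal_ofNat, div_pow, div_div]
    congr 5
    ring
  have hunion := measure_not_forall_opNorm_le (fun (s : Set.Iic s₀) ω =>
    (noisePart x s ω).toEuclideanLin.toContinuousLinearMap) htail
  rw [finrank_euclideanSpace_fin, finrank_euclideanSpace_fin, add_comm q] at hunion
  refine (measure_mono fun ω => _root_.mt fun hop s hs w => ?_).trans hunion
  exact ContinuousLinearMap.le_of_opNorm_le _ (hop ⟨s, hs⟩) w

end Noise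

section Signal

variable (e : Fin q → EuclideanSpace ℝ (Fin n)) (v : Fin q → EuclideanSpace ℝ (Fin r))

/-- The deviation from its mean of the weighted covariance
`w ↦ ∑ₖ ⟪vₖ, w⟫ (∑ₗᵢ truncSq b ⟪eₖ, ωₗₖᵢ⟫) vₖ`, with the sign for which an upper bound on it bounds
the covariance from below. -/
noncomputable def signalDeficit (b : ℝ) (ω : BatchIndex ρ q mt → EuclideanSpace ℝ (Fin n)) :
    EuclideanSpace ℝ (Fin r) →L[ℝ] EuclideanSpace ℝ (Fin r) :=
  ∑ p : BatchIndex ρ q mt, (-(truncSq b ⟪e p.2.1, ω p⟫ - truncMean b)) •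
    (innerSL ℝ (v p.2.1)).smulRight (v p.2.1)

theorem inner_signalDeficit (b : ℝ) (ω : BatchIndex ρ q mt → EuclideanSpace ℝ (Fin n))
    (u w : EuclideanSpace ℝ (Fin r)) :
    ⟪u, signalDeficit e v b ω w⟫ = ∑ p, -(⟪v p.2.1, u⟫ * ⟪v p.2.1, w⟫) *
      (truncSq b ⟪e p.2.1, ω p⟫ - truncMean b) := by
  simp only [signalDeficit, sum_apply, inner_sum, smul_apply,
    ContinuousLinearMap.smulRight_apply, innerSL_apply_apply, inner_smul_right]
  refine Finset.sum_congr rfl fun p _ => ?_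
  rw [real_inner_comm (v p.2.1) u]
  ring

variable {v} (hv : ∀ u w, ∑ k, ⟪v k, u⟫ * ⟪v k, w⟫ = ⟪u, w⟫)

include hv

theorem inner_signalDeficit_self (b : ℝ) (ω : BatchIndex ρ q mt → EuclideanSpace ℝ (Fin n))
    (w : EuclideanSpace ℝ (Fin r)) :
    ⟪w, signalDeficit e v b ω w⟫ = truncMean b * (ρ * mt) * ‖w‖ ^ 2 -
      ∑ k, ⟪v k, w⟫ ^ 2 * ∑ l, ∑ i, truncSq b ⟪e k, ω (l, k, i)⟫ := by
  rw [inner_signalDeficit,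
    ← sum_batchIndex_mul (fun k => ⟪v k, w⟫ ^ 2) (fun p => truncSq b ⟪e p.2.1, ω p⟫),
    ← real_inner_self_eq_norm_sq, ← hv, mul_assoc, ← sum_batchIndex, Finset.mul_sum,
    ← Finset.sum_sub_distrib]
  exact Finset.sum_congr rfl fun p _ => by ring

theorem sum_sq_mul_inner_le {M : ℝ} (hM : 0 ≤ M) (hvM : ∀ k, ‖v k‖ ^ 2 ≤ M)
    {u w : EuclideanSpace ℝ (Fin r)} (hu : ‖u‖ ≤ 1) (hw : ‖w‖ ≤ 1) :
    ∑ k, (⟪v k, u⟫ * ⟪v k, w⟫) ^ 2 ≤ M := by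
  have hbound : ∀ k, ⟪v k, u⟫ ^ 2 ≤ M := fun k => by
    calc ⟪v k, u⟫ ^ 2 ≤ (‖v k‖ * ‖u‖) ^ 2 :=
          sq_le_sq.2 ((abs_real_inner_le_norm _ _).trans (le_abs_self _))
      _ ≤ (‖v k‖ * 1) ^ 2 := by gcongr
      _ ≤ M := by rw [mul_one]; exact hvM k
  calc ∑ k, (⟪v k, u⟫ * ⟪v k, w⟫) ^ 2 ≤ ∑ k, M * (⟪v k, w⟫ * ⟪v k, w⟫) := by
        refine Finset.sum_le_sum fun k _ => ?_
        rw [mul_pow, sq ⟪v k, w⟫]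
        exact mul_le_mul_of_nonneg_right (hbound k) (mul_self_nonneg _)
    _ = M * ‖w‖ ^ 2 := by rw [← Finset.mul_sum, hv, real_inner_self_eq_norm_sq]
    _ ≤ M := mul_le_of_le_one_right hM (pow_le_one₀ (norm_nonneg _) hw)

variable {e}

theorem batchLaw_lt_inner_signalDeficit_le {M : ℝ} (hM : 0 ≤ M) (hvM : ∀ k, ‖v k‖ ^ 2 ≤ M)
    (he : ∀ k, v k ≠ 0 → ‖e k‖ = 1) {b : ℝ} (hb : 0 < b) {u w : EuclideanSpace ℝ (Fin r)}
    (hu : ‖u‖ ≤ 1) (hw : ‖w‖ ≤ 1) :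
    batchLaw n q mt ρ
        {ω | truncMean b / 2 * (ρ * mt) / 4 < ⟪u, signalDeficit e v b ω w⟫} ≤
      ENNReal.ofReal (Real.exp (-(truncMean b ^ 2 / (32 * b ^ 4) * (ρ * mt / M)))) := by
  have hβ := truncMean_pos hb
  have htail := measure_truncSq_sum_ge_le (I := BatchIndex ρ q mt) (fun p => e p.2.1)
    (fun p => -(⟪v p.2.1, u⟫ * ⟪v p.2.1, w⟫))
    (fun p hp => he _ fun hv0 => hp (by simp [hv0])) b
    (t := truncMean b / 2 * (ρ * mt) / 4) (S := ρ * mt * M) (by positivity) (by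
      simp_rw [neg_sq]
      rw [sum_batchIndex (fun k => (⟪v k, u⟫ * ⟪v k, w⟫) ^ 2)]
      gcongr
      exact sum_sq_mul_inner_le hv hM hvM hu hw)
  refine (measure_mono fun ω hω => ?_).trans (htail.trans_eq ?_)
  · simp only [Set.mem_ofPred_eq, inner_signalDeficit] at hω ⊢
    exact hω.le
  · congr 3
    rcases eq_or_ne ((ρ : ℝ) * mt) 0 with h0 | _
    · simp [h0]
    · field_simp
      ring

theorem batchLaw_not_signal_le {M : ℝ} (hM : 0 ≤ M) (hvM : ∀ k, ‖v k‖ ^ 2 ≤ M)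
    (he : ∀ k, v k ≠ 0 → ‖e k‖ = 1) {b : ℝ} (hb : 0 < b) :
    batchLaw n q mt ρ {ω | ¬ ∀ w, truncMean b / 2 * (ρ * mt) * ‖w‖ ^ 2 ≤
        ∑ k, ⟪v k, w⟫ ^ 2 * ∑ l, ∑ i, truncSq b ⟪e k, ω (l, k, i)⟫} ≤
      ENNReal.ofReal (25 ^ r * Real.exp (-(truncMean b ^ 2 / (32 * b ^ 4) * (ρ * mt / M)))) := by
  have hunion := measure_not_forall_opNorm_le (ν := batchLaw n q mt ρ)
    (fun (_ : Unit) ω => signalDeficit e v b ω) (t := truncMean b / 2 * (ρ * mt))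
    (fun u w hu hw => by
      simpa only [exists_const] using
        batchLaw_lt_inner_signalDeficit_le (ρ := ρ) (mt := mt) hv hM hvM he hb hu hw)
  rw [finrank_euclideanSpace_fin, ← two_mul, pow_mul, show (5 : ℝ) ^ 2 = 25 by norm_num] at hunion
  refine (measure_mono fun ω => _root_.mt fun hop w => ?_).trans hunion
  have hquad : ⟪w, signalDeficit e v b ω w⟫ ≤ truncMean b / 2 * (ρ * mt) * ‖w‖ ^ 2 := by
    calc _ ≤ ‖w‖ * ‖signalDeficit e v b ω w‖ := real_inner_le_norm _ _
      _ ≤ ‖w‖ * (truncMean b / 2 * (ρ * mt) * ‖w‖) := by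
        gcongr
        exact ContinuousLinearMap.le_of_opNorm_le _ (hop ()) w
      _ = _ := by ring
  rw [inner_signalDeficit_self e hv] at hquad
  linarith

end Signal

end Batch

/-! ## The median -/

theorem sort_mem_Icc {K : ℕ} {a : Fin K → ℝ} {lo hi : ℝ} (G : Finset (Fin K))
    (hG : ∀ i ∈ G, a i ∈ Set.Icc lo hi) (hcard : K < 2 * G.card) (m : Fin K)
    (hm : 2 * (m : ℕ) ≤ K) (hm' : K ≤ 2 * (m + 1)) :
    a (Tuple.sort a m) ∈ Set.Icc lo hi := by
  classical
  have hmono := Tuple.monotone_sort a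
  have hpacked : ∀ B : Finset (Fin K), (∀ j ∈ B, Tuple.sort a j ∉ G) → G.card + B.card ≤ K := by
    intro B hB
    have hdisj : Disjoint G (B.map (Tuple.sort a).toEmbedding) := by
      rw [Finset.disjoint_right]
      exact Finset.forall_mem_map.2 hB
    have hle := Finset.card_le_univ (G ∪ B.map (Tuple.sort a).toEmbedding)
    rwa [Finset.card_union_of_disjoint hdisj, Finset.card_map, Fintype.card_fin] at hle
  constructor
  · by_contra! hlt
    have hle := hpacked (Finset.Iic m) fun j hj hjG =>
      ((hmono (Finset.mem_Iic.1 hj)).trans_lt hlt).not_ge (hG _ hjG).1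
    rw [Fin.card_Iic] at hle
    omega
  · by_contra! hlt
    have hle := hpacked (Finset.Ici m) fun j hj hjG =>
      (hlt.trans_le (hmono (Finset.mem_Ici.1 hj))).not_ge (hG _ hjG).2
    rw [Fin.card_Ici] at hle
    omega

theorem median_mem_Icc {K : ℕ} {a : Fin K → ℝ} {lo hi : ℝ} (G : Finset (Fin K))
    (hG : ∀ i ∈ G, a i ∈ Set.Icc lo hi) (hcard : K < 2 * G.card) :
    median a ∈ Set.Icc lo hi := by
  have hK : 0 < K := by
    have hle := Finset.card_le_univ G
    rw [Fintype.card_fin] at hle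
    omega
  have hleft := sort_mem_Icc G hG hcard ⟨(K - 1) / 2, by omega⟩ (by simp only; omega)
    (by simp only; omega)
  have hright := sort_mem_Icc G hG hcard ⟨K / 2, by omega⟩ (by simp only; omega)
    (by simp only; omega)
  rw [median, dif_pos hK]
  constructor
  · linarith [hleft.1, hright.1]
  · linarith [hleft.2, hright.2]

/-! ## Singular values and columns -/

namespace ReducedSVD

variable {n q r : ℕ} {X : Matrix (Fin n) (Fin q) ℝ} (D : ReducedSVD X r)

theorem sigmaMin_le (i : Fin r) : D.sigmaMin ≤ D.σ i := ciInf_le (Finite.bddBelow_range _) i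

theorem le_sigmaMax (i : Fin r) : D.σ i ≤ D.sigmaMax := le_ciSup (Finite.bddAbove_range _) i

theorem sigmaMin_pos (hr : 0 < r) : 0 < D.sigmaMin := by
  have : Nonempty (Fin r) := ⟨⟨0, hr⟩⟩
  obtain ⟨i, hi⟩ := exists_eq_ciInf_of_finite (f := D.σ)
  rw [sigmaMin, ← hi]
  exact D.σ_pos i

theorem sigmaMax_eq (hr : 0 < r) : D.sigmaMax = D.kappa * D.sigmaMin :=
  (div_mul_cancel₀ _ (D.sigmaMin_pos hr).ne').symm

theorem one_le_kappa (hr : 0 < r) : 1 ≤ D.kappa := by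
  rw [kappa, one_le_div (D.sigmaMin_pos hr)]
  exact (D.sigmaMin_le ⟨0, hr⟩).trans (D.le_sigmaMax _)

theorem eq_mul_B : X = D.U * D.B := by
  rw [B, ← Matrix.mul_assoc]
  exact D.eq

theorem B_apply (i : Fin r) (k : Fin q) : D.B i k = D.σ i * D.V k i := by
  rw [B, Matrix.diagonal_mul, Matrix.transpose_apply]

theorem norm_col_sq (k : Fin q) : ‖cols X k‖ ^ 2 = ∑ i, D.B i k ^ 2 := by
  have hcol : cols X k = D.U.toEuclideanLin (WithLp.toLp 2 fun i => D.B i k) := by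
    ext j
    conv_lhs => rw [D.eq_mul_B]
    rfl
  rw [hcol, norm_toEuclideanLin_of_orthonormal D.U_orthonormal, EuclideanSpace.real_norm_sq_eq]

/-- The rows of the right singular factor `V`, as vectors of Euclidean space. -/
def row (k : Fin q) : EuclideanSpace ℝ (Fin r) := WithLp.toLp 2 fun i => D.V k i

theorem inner_row (k : Fin q) (u : EuclideanSpace ℝ (Fin r)) :
    ⟪D.row k, u⟫ = ∑ i, D.V k i * u i := by
  simp [row, PiLp.inner_apply, mul_comm]

theorem sum_inner_row (u w : EuclideanSpace ℝ (Fin r)) :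
    ∑ k, ⟪D.row k, u⟫ * ⟪D.row k, w⟫ = ⟪u, w⟫ := by
  have hmulVec : ∀ x : EuclideanSpace ℝ (Fin r), D.V *ᵥ x.ofLp = fun k => ⟪D.row k, x⟫ :=
    fun x => funext fun k => (D.inner_row k x).symm
  calc ∑ k, ⟪D.row k, u⟫ * ⟪D.row k, w⟫ = (D.V *ᵥ u.ofLp) ⬝ᵥ (D.V *ᵥ w.ofLp) := by
        rw [hmulVec, hmulVec]
        rfl
    _ = u.ofLp ⬝ᵥ ((D.Vᵀ * D.V) *ᵥ w.ofLp) := by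
        rw [Matrix.dotProduct_mulVec, Matrix.vecMul_mulVec, ← Matrix.dotProduct_mulVec]
    _ = ⟪u, w⟫ := by
        rw [D.V_orthonormal, Matrix.one_mulVec]
        simp [PiLp.inner_apply, dotProduct, mul_comm]

theorem sum_V_sq (i : Fin r) : ∑ k, D.V k i ^ 2 = 1 := by
  have hdiag := congrFun (congrFun D.V_orthonormal i) i
  rw [Matrix.mul_apply, Matrix.one_apply_eq] at hdiag
  simpa only [Matrix.transpose_apply, ← sq] using hdiag

theorem sum_norm_col_sq : ∑ k, ‖cols X k‖ ^ 2 = ∑ i, D.σ i ^ 2 := by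
  simp_rw [D.norm_col_sq, D.B_apply]
  rw [Finset.sum_comm]
  simp_rw [mul_pow, ← Finset.mul_sum, D.sum_V_sq, mul_one]

theorem le_sum_norm_col_sq (hr : 0 < r) : r * D.sigmaMin ^ 2 ≤ ∑ k, ‖cols X k‖ ^ 2 := by
  rw [D.sum_norm_col_sq]
  calc (r : ℝ) * D.sigmaMin ^ 2 = ∑ _i : Fin r, D.sigmaMin ^ 2 := by simp
    _ ≤ _ := Finset.sum_le_sum fun i _ =>
      pow_le_pow_left₀ (D.sigmaMin_pos hr).le (D.sigmaMin_le i) 2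

theorem sum_norm_col_sq_le : ∑ k, ‖cols X k‖ ^ 2 ≤ r * D.sigmaMax ^ 2 := by
  rw [D.sum_norm_col_sq]
  calc _ ≤ ∑ _i : Fin r, D.sigmaMax ^ 2 := Finset.sum_le_sum fun i _ =>
        pow_le_pow_left₀ (D.σ_pos i).le (D.le_sigmaMax i) 2
    _ = _ := by simp

include D in
theorem q_pos (hr : 0 < r) : 0 < q := by
  have hrank := Matrix.rank_le_height D.V
  have hle : (D.Vᵀ * D.V).rank ≤ D.V.rank := Matrix.rank_mul_le_right _ _
  rw [D.V_orthonormal, Matrix.rank_one, Fintype.card_fin] at hle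
  exact hr.trans_le (hle.trans hrank)

include D in
theorem r_le_n : r ≤ n := by
  have hrank := Matrix.rank_le_height D.U
  have hle : (D.Uᵀ * D.U).rank ≤ D.U.rank := Matrix.rank_mul_le_right _ _
  rw [D.U_orthonormal, Matrix.rank_one, Fintype.card_fin] at hle
  exact hle.trans hrank

theorem norm_col_sq_le {μ : ℝ} (h : D.Incoherent μ) (k : Fin q) :
    ‖cols X k‖ ^ 2 ≤ μ ^ 2 * (r / q) * D.sigmaMax ^ 2 := by
  have hsq := pow_le_pow_left₀ (Real.sqrt_nonneg _) (h k) 2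
  rwa [Real.sq_sqrt (Finset.sum_nonneg fun _ _ => sq_nonneg _), mul_pow, mul_pow,
    Real.sq_sqrt (by positivity), ← D.norm_col_sq] at hsq

theorem pos_of_incoherent (hr : 0 < r) {μ : ℝ} (h : D.Incoherent μ) : 0 < μ := by
  have hσ := D.sigmaMin_pos hr
  obtain ⟨k, -, hk⟩ := Finset.exists_lt_of_sum_lt (s := Finset.univ) (f := fun _ : Fin q => (0 : ℝ))
    (g := fun k => ‖cols X k‖ ^ 2)
    (by simpa using (show 0 < r * D.sigmaMin ^ 2 by positivity).trans_le (D.le_sum_norm_col_sq hr))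
  rw [D.norm_col_sq] at hk
  have hpos := (Real.sqrt_pos.2 hk).trans_le (h k)
  rw [mul_assoc] at hpos
  refine pos_of_mul_pos_left hpos (mul_nonneg (Real.sqrt_nonneg _) ?_)
  exact hσ.le.trans ((D.sigmaMin_le ⟨0, hr⟩).trans (D.le_sigmaMax _))

theorem norm_row_sq_le_col (hr : 0 < r) (k : Fin q) :
    D.sigmaMin ^ 2 * ‖D.row k‖ ^ 2 ≤ ‖cols X k‖ ^ 2 := by
  rw [D.norm_col_sq, EuclideanSpace.real_norm_sq_eq, Finset.mul_sum]
  refine Finset.sum_le_sum fun i _ => ?_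
  rw [D.B_apply, mul_pow]
  have := D.sigmaMin_pos hr
  exact mul_le_mul_of_nonneg_right (pow_le_pow_left₀ this.le (D.sigmaMin_le i) 2) (sq_nonneg _)

theorem col_ne_zero (hr : 0 < r) {k : Fin q} (hk : D.row k ≠ 0) : cols X k ≠ 0 := by
  intro hzero
  have hle := D.norm_row_sq_le_col hr k
  have hσ := D.sigmaMin_pos hr
  have hrow := norm_pos_iff.2 hk
  have : 0 < D.sigmaMin ^ 2 * ‖D.row k‖ ^ 2 := by positivity
  rw [hzero, norm_zero, zero_pow two_ne_zero] at hle
  linarith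

theorem toEuclideanLin_diagonal_apply {s : ℕ} (a : Fin s → ℝ) (x : EuclideanSpace ℝ (Fin s))
    (i : Fin s) : (Matrix.diagonal a).toEuclideanLin x i = a i * x i :=
  Matrix.mulVec_diagonal a _ i

theorem sigmaMin_mul_norm_le (hr : 0 < r) (u : EuclideanSpace ℝ (Fin r)) :
    D.sigmaMin * ‖u‖ ≤ ‖(Matrix.diagonal D.σ).toEuclideanLin u‖ := by
  have hσ := D.sigmaMin_pos hr
  refine le_of_sq_le_sq ?_ (norm_nonneg _)
  rw [mul_pow, EuclideanSpace.real_norm_sq_eq, EuclideanSpace.real_norm_sq_eq, Finset.mul_sum]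
  refine Finset.sum_le_sum fun i _ => ?_
  rw [toEuclideanLin_diagonal_apply, mul_pow]
  exact mul_le_mul_of_nonneg_right (pow_le_pow_left₀ hσ.le (D.sigmaMin_le i) 2) (sq_nonneg _)

theorem norm_transpose_B_mul_diagonal_sq (a : Fin q → ℝ) (u : EuclideanSpace ℝ (Fin r)) :
    ‖(D.B * Matrix.diagonal a)ᵀ.toEuclideanLin u‖ ^ 2 =
      ∑ k, (a k * ⟪D.row k, (Matrix.diagonal D.σ).toEuclideanLin u⟫) ^ 2 := by
  have hfactor : (D.B * Matrix.diagonal a)ᵀ =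
      Matrix.diagonal a * (D.V * Matrix.diagonal D.σ) := by
    rw [B, Matrix.transpose_mul, Matrix.transpose_mul, Matrix.transpose_transpose,
      Matrix.diagonal_transpose, Matrix.diagonal_transpose]
  rw [hfactor, toEuclideanLin_mul_apply, toEuclideanLin_mul_apply, EuclideanSpace.real_norm_sq_eq]
  simp only [inner_row]
  refine Finset.sum_congr rfl fun k _ => ?_
  rw [toEuclideanLin_diagonal_apply]
  rfl

end ReducedSVD

/-! ## The matrix of one mini-batch -/

theorem mul_norm_sq_le_sum_sq_of_tight {ι E : Type*} [Fintype ι] [NormedAddCommGroup E]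
    [InnerProductSpace ℝ E] {v : ι → E} {t : ι → ℝ} {c : ℝ} {w : E} (hc : 0 ≤ c)
    (hv : ∑ k, ⟪v k, w⟫ ^ 2 = ‖w‖ ^ 2) (hw : c * ‖w‖ ^ 2 ≤ ∑ k, ⟪v k, w⟫ ^ 2 * t k) :
    (c * ‖w‖) ^ 2 ≤ ∑ k, (t k * ⟪v k, w⟫) ^ 2 := by
  rcases eq_or_ne w 0 with rfl | hw0
  · rw [norm_zero, mul_zero, zero_pow two_ne_zero]
    positivity
  have hcauchy := Finset.sum_mul_sq_le_sq_mul_sq Finset.univ (fun k => t k * ⟪v k, w⟫)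
    (fun k => ⟪v k, w⟫)
  refine le_of_mul_le_mul_right (a := ‖w‖ ^ 2) ?_ (by positivity)
  calc (c * ‖w‖) ^ 2 * ‖w‖ ^ 2 = (c * ‖w‖ ^ 2) ^ 2 := by ring
    _ ≤ (∑ k, ⟪v k, w⟫ ^ 2 * t k) ^ 2 := pow_le_pow_left₀ (by positivity) hw 2
    _ = (∑ k, t k * ⟪v k, w⟫ * ⟪v k, w⟫) ^ 2 := by
        congr 1
        exact Finset.sum_congr rfl fun k _ => by ring
    _ ≤ _ := by rwa [hv] at hcauchy

section BatchMatrix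

variable {n q r mt Lt ρ : ℕ}

/-- The measurement vectors of the mini-batch `ϑ`. -/
def batchView (ϑ : Fin Lt) (A : Sensing n q mt Lt ρ) :
    BatchIndex ρ q mt → EuclideanSpace ℝ (Fin n) :=
  fun p => WithLp.toLp 2 (A (ϑ, p.1) p.2.1 p.2.2)

theorem measurePreserving_batchView (ϑ : Fin Lt) :
    MeasurePreserving (batchView ϑ) (sensingLaw n q mt Lt ρ) (batchLaw n q mt ρ) := by
  have huncurry := fun ι κ : Type => fun [Fintype ι] [Fintype κ] =>
    (measurePreserving_curry (ι := ι) (κ := κ)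
      (Measure.pi fun _ : Fin n => gaussianReal 0 1)).symm (MeasurableEquiv.curry ι κ _)
  have htoLp : MeasurePreserving
      (fun (u : BatchIndex ρ q mt → Fin n → ℝ) p => WithLp.toLp 2 (u p))
      (Measure.pi fun _ => Measure.pi fun _ => gaussianReal 0 1) (batchLaw n q mt ρ) :=
    measurePreserving_pi _ _ fun _ => ⟨by fun_prop, map_pi_eq_stdGaussian⟩
  exact htoLp.comp ((huncurry (Fin ρ) (Fin q × Fin mt)).comp
    ((measurePreserving_pi _ _ fun _ => huncurry (Fin q) (Fin mt)).comp
      ((measurePreserving_eval _ ϑ).comp (measurePreserving_curry _))))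

variable (p : Protocol n q r mt Lt ρ)

theorem y_eq_inner (A : Sensing n q mt Lt ρ) (ϑ : Fin Lt) (l : Fin ρ) (k : Fin q) (i : Fin mt) :
    p.y A (ϑ, l) k i = ⟪cols p.X k, batchView ϑ A (l, k, i)⟫ := by
  simp [Protocol.y, cols, batchView, PiLp.inner_apply]

/-- The factors by which truncation rescales the columns of the signal. -/
noncomputable def columnScale (x : Fin q → EuclideanSpace ℝ (Fin n)) (s : ℝ)
    (ω : BatchIndex ρ q mt → EuclideanSpace ℝ (Fin n)) (k : Fin q) : ℝ :=
  ∑ l, ∑ i, if |⟪x k, ω (l, k, i)⟫| ≤ s then ⟪x k, ω (l, k, i)⟫ ^ 2 / ‖x k‖ ^ 2 else 0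

theorem sum_X0_eq (D : ReducedSVD p.X r) (d : Data n q mt Lt ρ) (ϑ : Fin Lt) :
    ∑ l, p.X0 d (ϑ, l) = D.U * (D.B * Matrix.diagonal
      (columnScale (cols p.X) (Real.sqrt (p.alpha d)) (batchView ϑ d.2))) +
      noisePart (cols p.X) (Real.sqrt (p.alpha d)) (batchView ϑ d.2) := by
  rw [← Matrix.mul_assoc, ← D.eq_mul_B]
  ext j k
  rw [Matrix.add_apply, Matrix.mul_diagonal, Matrix.sum_apply]
  simp only [Protocol.X0, Matrix.of_apply, columnScale, noisePart, Finset.mul_sum,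
    ← Finset.sum_add_distrib, y_eq_inner]
  refine Finset.sum_congr rfl fun l _ => Finset.sum_congr rfl fun i _ => ?_
  change batchView ϑ d.2 (l, k, i) j * _ = cols p.X k j * _ + _
  split_ifs
  · rw [Submodule.starProjection_orthogonal_val, Submodule.starProjection_singleton]
    simp only [PiLp.sub_apply, PiLp.smul_apply, smul_eq_mul, RCLike.ofReal_real_eq_id, id_eq]
    ring
  · simp

theorem sum_truncSq_le_columnScale {x : Fin q → EuclideanSpace ℝ (Fin n)} {k : Fin q}
    (hx : x k ≠ 0) {s b : ℝ} (hs : b * ‖x k‖ ≤ s)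
    (ω : BatchIndex ρ q mt → EuclideanSpace ℝ (Fin n)) :
    ∑ l, ∑ i, truncSq b ⟪NormedSpace.normalize (x k), ω (l, k, i)⟫ ≤ columnScale x s ω k := by
  have hpos := norm_pos_iff.2 hx
  refine Finset.sum_le_sum fun l _ => Finset.sum_le_sum fun i _ => ?_
  rw [inner_eq_norm_mul_inner_normalize (x k), mul_pow, mul_div_cancel_left₀ _ (by positivity),
    abs_mul, abs_norm, truncSq]
  split_ifs with hb hlarge hlarge
  · exact le_rfl
  · exact absurd ((mul_comm _ b ▸ mul_le_mul_of_nonneg_left hb hpos.le).trans hs) hlarge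
  · positivity
  · exact le_rfl

theorem norm_scaled_signal_ge {X : Matrix (Fin n) (Fin q) ℝ} (D : ReducedSVD X r) (hr : 0 < r)
    {s b c : ℝ} (hc : 0 ≤ c) (ω : BatchIndex ρ q mt → EuclideanSpace ℝ (Fin n))
    (hs : ∀ k, b * ‖cols X k‖ ≤ s)
    (hω : ∀ w, c * ‖w‖ ^ 2 ≤ ∑ k, ⟪D.row k, w⟫ ^ 2 *
      ∑ l, ∑ i, truncSq b ⟪NormedSpace.normalize (cols X k), ω (l, k, i)⟫)
    (u : EuclideanSpace ℝ (Fin r)) :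
    c * D.sigmaMin * ‖u‖ ≤
      ‖(D.B * Matrix.diagonal (columnScale (cols X) s ω))ᵀ.toEuclideanLin u‖ := by
  set w := (Matrix.diagonal D.σ).toEuclideanLin u with hw
  have htight : ∑ k, ⟪D.row k, w⟫ ^ 2 = ‖w‖ ^ 2 := by
    simpa only [sq, real_inner_self_eq_norm_mul_norm] using D.sum_inner_row w w
  calc c * D.sigmaMin * ‖u‖ ≤ c * ‖w‖ := by
        rw [mul_assoc]
        exact mul_le_mul_of_nonneg_left (D.sigmaMin_mul_norm_le hr u) hc
    _ ≤ _ := le_of_sq_le_sq ?_ (norm_nonneg _)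
  refine (mul_norm_sq_le_sum_sq_of_tight hc htight (hω w)).trans ?_
  rw [D.norm_transpose_B_mul_diagonal_sq]
  refine Finset.sum_le_sum fun k _ => ?_
  rw [← hw, mul_pow, mul_pow]
  rcases eq_or_ne (D.row k) 0 with hzero | hrow
  · simp [hzero]
  · exact mul_le_mul_of_nonneg_right (pow_le_pow_left₀
      (Finset.sum_nonneg fun _ _ => Finset.sum_nonneg fun _ _ => (truncSq_mem_Icc _ _).1)
      (sum_truncSq_le_columnScale (D.col_ne_zero hr hrow) (hs k) ω) 2) (sq_nonneg _)

end BatchMatrix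

/-! ## Mini-batches without Byzantine nodes -/

section CleanBatches

variable {n q r mt Lt ρ : ℕ}

/-- The mini-batches without Byzantine nodes. -/
def Protocol.cleanBatches (p : Protocol n q r mt Lt ρ) : Finset (Fin Lt) :=
  (p.byz.image Prod.fst)ᶜ

theorem Protocol.notMem_byz_of_clean {p : Protocol n q r mt Lt ρ} {ϑ : Fin Lt}
    (hϑ : ϑ ∈ p.cleanBatches) (l : Fin ρ) : (ϑ, l) ∉ p.byz := fun hbyz =>
  Finset.mem_compl.1 hϑ (Finset.mem_image.2 ⟨_, hbyz, rfl⟩)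

theorem Protocol.le_card_cleanBatches (p : Protocol n q r mt Lt ρ) :
    (Lt : ℝ) - p.byz.card ≤ p.cleanBatches.card := by
  have hcompl := Finset.card_compl_add_card (p.byz.image Prod.fst)
  rw [Fintype.card_fin] at hcompl
  have himage := Finset.card_image_le (s := p.byz) (f := Prod.fst)
  rw [sub_le_iff_le_add]
  exact_mod_cast hcompl.symm.trans_le (Nat.add_le_add_left himage _)

/-- The data are good to accuracy `δ`: up to small noise, the matrix of every clean mini-batch is
well conditioned and has the column space of the signal. -/
def DataGood (p : Protocol n q r mt Lt ρ) (D : ReducedSVD p.X r) (δ : ℝ)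
    (d : Data n q mt Lt ρ) : Prop :=
  ∀ ϑ ∈ p.cleanBatches, ∃ (G : Matrix (Fin r) (Fin q) ℝ) (W : Matrix (Fin n) (Fin q) ℝ) (θ : ℝ),
    ∑ l, p.X0 d (ϑ, l) = D.U * G + W ∧ 0 < θ ∧
    (∀ w, ‖W.toEuclideanLin w‖ ≤ δ * θ / (200 * Real.sqrt r) * ‖w‖) ∧
    ∀ u, 2 * θ * ‖u‖ ≤ ‖G.transpose.toEuclideanLin u‖

end CleanBatches

/-! ## Good events of one mini-batch -/

section BatchEvents

variable {n q r mt ρ : ℕ}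

/-- The truncation level, relative to the size of the columns of the signal, that the threshold is
guaranteed to exceed. -/
noncomputable def truncLevel : ℝ := Real.sqrt (9 / 2 * truncMean 1)

theorem truncLevel_pos : 0 < truncLevel :=
  Real.sqrt_pos.2 (by have := truncMean_pos one_pos; positivity)

theorem truncLevel_sq : truncLevel ^ 2 = 9 / 2 * truncMean 1 :=
  Real.sq_sqrt (by have := truncMean_pos one_pos; positivity)

/-- The energy of the measurements of a mini-batch is within constant factors of its mean
`ρ mt ∑ₖ ‖xₖ‖²`. -/
def EnergyGood (x : Fin q → EuclideanSpace ℝ (Fin n))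
    (ω : BatchIndex ρ q mt → EuclideanSpace ℝ (Fin n)) : Prop :=
  truncMean 1 / 2 * (ρ * mt * ∑ k, ‖x k‖ ^ 2) < ∑ i, ⟪x i.2.1, ω i⟫ ^ 2 ∧
    ∑ i, ⟪x i.2.1, ω i⟫ ^ 2 < 4 * expSqMean * (ρ * mt * ∑ k, ‖x k‖ ^ 2)

/-- Whatever the truncation threshold `s ≤ s₀`, the noise part of the mini-batch matrix has operator
norm at most `ε`, and its signal part is well conditioned. -/
def SpectrumGood {X : Matrix (Fin n) (Fin q) ℝ} (D : ReducedSVD X r) (s₀ ε : ℝ)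
    (ω : BatchIndex ρ q mt → EuclideanSpace ℝ (Fin n)) : Prop :=
  (∀ s ≤ s₀, ∀ w, ‖(noisePart (cols X) s ω).toEuclideanLin w‖ ≤ ε * ‖w‖) ∧
    ∀ w, truncMean truncLevel / 2 * (ρ * mt) * ‖w‖ ^ 2 ≤ ∑ k, ⟪D.row k, w⟫ ^ 2 *
      ∑ l, ∑ i, truncSq truncLevel ⟪NormedSpace.normalize (cols X k), ω (l, k, i)⟫

theorem batchLaw_not_energyGood_le (x : Fin q → EuclideanSpace ℝ (Fin n)) {M a : ℝ} (hM : 0 < M)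
    (hx : ∀ k, ‖x k‖ ^ 2 ≤ M) (hlow : a ≤ truncMean 1 ^ 2 / 2 * (ρ * mt * (∑ k, ‖x k‖ ^ 2) / M))
    (hhigh : a ≤ ρ * mt * (∑ k, ‖x k‖ ^ 2) / M) :
    batchLaw n q mt ρ {ω | ¬ EnergyGood x ω} ≤ ENNReal.ofReal (2 * Real.exp (-a)) := by
  have hsub : {ω : BatchIndex ρ q mt → EuclideanSpace ℝ (Fin n) | ¬ EnergyGood x ω} ⊆
      {ω | ∑ i, ⟪x i.2.1, ω i⟫ ^ 2 ≤ truncMean 1 / 2 * (ρ * mt * ∑ k, ‖x k‖ ^ 2)} ∪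
      {ω | 4 * expSqMean * (ρ * mt * ∑ k, ‖x k‖ ^ 2) ≤ ∑ i, ⟪x i.2.1, ω i⟫ ^ 2} := fun ω hω =>
    (not_and_or.1 hω).imp not_lt.1 not_lt.1
  rw [two_mul, ENNReal.ofReal_add (by positivity) (by positivity)]
  refine (measure_mono hsub).trans ((measure_union_le _ _).trans (add_le_add ?_ ?_))
  · exact (batchLaw_sum_sq_inner_le_le x hM hx).trans (by gcongr)
  · exact (batchLaw_le_sum_sq_inner_le x hM hx).trans (by gcongr)

theorem batchLaw_not_spectrumGood_le {X : Matrix (Fin n) (Fin q) ℝ} (D : ReducedSVD X r)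
    (hr : 0 < r) {M s₀ ε a : ℝ} (hM : 0 ≤ M) (hrow : ∀ k, ‖D.row k‖ ^ 2 ≤ M) (hε : 0 ≤ ε)
    (hnoise : a ≤ ε ^ 2 / (32 * (s₀ ^ 2 * (ρ * mt))))
    (hsignal : a ≤ truncMean truncLevel ^ 2 / (32 * truncLevel ^ 4) * (ρ * mt / M)) :
    batchLaw n q mt ρ {ω | ¬ SpectrumGood D s₀ ε ω} ≤
      ENNReal.ofReal ((5 ^ (n + q) * 2 + 25 ^ r) * Real.exp (-a)) := by
  have hunit : ∀ k, D.row k ≠ 0 → ‖NormedSpace.normalize (cols X k)‖ = 1 := fun k hk =>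
    NormedSpace.norm_normalize (D.col_ne_zero hr hk)
  have hsub : {ω : BatchIndex ρ q mt → EuclideanSpace ℝ (Fin n) | ¬ SpectrumGood D s₀ ε ω} ⊆
      {ω | ¬ ∀ s ≤ s₀, ∀ w, ‖(noisePart (cols X) s ω).toEuclideanLin w‖ ≤ ε * ‖w‖} ∪
      {ω | ¬ ∀ w, truncMean truncLevel / 2 * (ρ * mt) * ‖w‖ ^ 2 ≤ ∑ k, ⟪D.row k, w⟫ ^ 2 *
        ∑ l, ∑ i, truncSq truncLevel ⟪NormedSpace.normalize (cols X k), ω (l, k, i)⟫} :=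
    fun ω hω => not_and_or.1 hω
  rw [add_mul, mul_assoc, ENNReal.ofReal_add (by positivity) (by positivity)]
  refine (measure_mono hsub).trans ((measure_union_le _ _).trans (add_le_add ?_ ?_))
  · exact (batchLaw_not_norm_noisePart_le_le (cols X) hε).trans (by gcongr)
  · exact (batchLaw_not_signal_le D.sum_inner_row hM hrow hunit truncLevel_pos).trans (by gcongr)

end BatchEvents

/-! ## The threshold, and good data from good events -/

section GoodData

variable {n q r mt Lt ρ : ℕ}

/-- `κ² μ² ∑ₖ ‖xₖ‖² / q`, a ninth of the mean of `α_ℓ`; by incoherence it dominates every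
`‖xₖ‖²`. -/
noncomputable def Protocol.energyScale (p : Protocol n q r mt Lt ρ) : ℝ :=
  p.κ ^ 2 * p.μ ^ 2 * (∑ k, ‖cols p.X k‖ ^ 2) / q

/-- An upper bound for the truncation threshold `√α` on the good events. -/
noncomputable def Protocol.maxThreshold (p : Protocol n q r mt Lt ρ) : ℝ :=
  Real.sqrt (36 * expSqMean * p.energyScale)

/-- Half of the lower bound for the singular values of the signal part of a clean mini-batch. -/
noncomputable def Protocol.signalGap (p : Protocol n q r mt Lt ρ) (D : ReducedSVD p.X r) : ℝ :=
  truncMean truncLevel * (ρ * mt) * D.sigmaMin / 4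

/-- The noise level at which the power method reaches accuracy `δ`. -/
noncomputable def Protocol.noiseTolerance (p : Protocol n q r mt Lt ρ) (D : ReducedSVD p.X r)
    (δ : ℝ) : ℝ :=
  δ * p.signalGap D / (200 * Real.sqrt r)

variable {p : Protocol n q r mt Lt ρ}

theorem batchMean_alphaNode (hmt : 0 < mt) (hρ : 0 < ρ) (hq : 0 < q) {ϑ : Fin Lt}
    (hϑ : ϑ ∈ p.cleanBatches) (d : Data n q mt Lt ρ) :
    (∑ l, p.alphaNode d (ϑ, l)) / ρ = 9 * p.κ ^ 2 * p.μ ^ 2 / (ρ * mt * q) *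
      ∑ i, ⟪cols p.X i.2.1, batchView ϑ d.1 i⟫ ^ 2 := by
  have hnode : ∀ l, p.alphaNode d (ϑ, l) = 9 * p.κ ^ 2 * p.μ ^ 2 / ((mt : ℝ) * q) *
      ∑ k, ∑ i, ⟪cols p.X k, batchView ϑ d.1 (l, k, i)⟫ ^ 2 := fun l => by
    simp only [Protocol.alphaNode, if_neg (Protocol.notMem_byz_of_clean hϑ l), y_eq_inner]
  simp only [hnode, Fintype.sum_prod_type]
  rw [← Finset.mul_sum]
  field_simp

theorem alpha_mem_Icc (hmt : 0 < mt) (hρ : 0 < ρ) (hq : 0 < q)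
    (hbyz : (p.byz.card : ℝ) < 0.4 * Lt) {d : Data n q mt Lt ρ}
    (henergy : ∀ ϑ ∈ p.cleanBatches, EnergyGood (cols p.X) (batchView ϑ d.1)) :
    p.alpha d ∈
      Set.Icc (9 / 2 * truncMean 1 * p.energyScale) (36 * expSqMean * p.energyScale) := by
  have hmajority : Lt < 2 * p.cleanBatches.card := by
    have hclean := p.le_card_cleanBatches
    have : (0 : ℝ) ≤ Lt := Nat.cast_nonneg _
    have hcast : (Lt : ℝ) < 2 * p.cleanBatches.card := by norm_num at hbyz; linarith
    exact_mod_cast hcast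
  refine median_mem_Icc p.cleanBatches (fun ϑ hϑ => ?_) hmajority
  obtain ⟨hlow, hhigh⟩ := henergy ϑ hϑ
  have hpos : 0 ≤ 9 * p.κ ^ 2 * p.μ ^ 2 / (ρ * mt * q) := by positivity
  rw [batchMean_alphaNode hmt hρ hq hϑ, Protocol.energyScale]
  refine ⟨?_, ?_⟩
  · refine le_trans (le_of_eq ?_) (mul_le_mul_of_nonneg_left hlow.le hpos)
    field_simp
  · refine (mul_le_mul_of_nonneg_left hhigh.le hpos).trans_eq ?_
    field_simp
    ring

theorem dataGood_of_batches (D : ReducedSVD p.X r) (hr : 0 < r) (hmt : 0 < mt) (hρ : 0 < ρ)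
    (hx : ∀ k, ‖cols p.X k‖ ^ 2 ≤ p.energyScale) (hbyz : (p.byz.card : ℝ) < 0.4 * Lt) {δ : ℝ}
    {d : Data n q mt Lt ρ}
    (henergy : ∀ ϑ ∈ p.cleanBatches, EnergyGood (cols p.X) (batchView ϑ d.1))
    (hspectrum : ∀ ϑ ∈ p.cleanBatches,
      SpectrumGood D p.maxThreshold (p.noiseTolerance D δ) (batchView ϑ d.2)) :
    DataGood p D δ d := by
  have hα := alpha_mem_Icc hmt hρ (D.q_pos hr) hbyz henergy
  have hσ := D.sigmaMin_pos hr
  have hβ := truncMean_pos truncLevel_pos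
  have hβ1 := truncMean_pos one_pos
  have hthreshold : ∀ k, truncLevel * ‖cols p.X k‖ ≤ Real.sqrt (p.alpha d) := fun k => by
    refine Real.le_sqrt_of_sq_le (le_trans ?_ hα.1)
    rw [mul_pow, truncLevel_sq]
    exact mul_le_mul_of_nonneg_left (hx k) (by positivity)
  intro ϑ hϑ
  obtain ⟨hnoise, hsignal⟩ := hspectrum ϑ hϑ
  refine ⟨_, _, p.signalGap D, sum_X0_eq p D d ϑ, by unfold Protocol.signalGap; positivity,
    hnoise _ (Real.sqrt_le_sqrt hα.2), fun u => ?_⟩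
  refine le_trans (le_of_eq ?_)
    (norm_scaled_signal_ge D hr (by positivity) (batchView ϑ d.2) hthreshold hsignal u)
  rw [Protocol.signalGap]
  ring

end GoodData

/-! ## Failure probability of the data -/

section Sampling

variable {n q r mt Lt ρ : ℕ}

instance : IsProbabilityMeasure (sensingLaw n q mt Lt ρ) := by
  unfold sensingLaw; infer_instance

theorem sensingLaw_iUnion_batchView_le (B : Set (BatchIndex ρ q mt → EuclideanSpace ℝ (Fin n))) :
    sensingLaw n q mt Lt ρ (⋃ ϑ : Fin Lt, batchView ϑ ⁻¹' B) ≤ Lt * batchLaw n q mt ρ B := by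
  refine (measure_iUnion_fintype_le _ _).trans ((Finset.sum_le_card_nsmul _ _ _ fun ϑ _ =>
    (measurePreserving_batchView ϑ).measure_preimage_le B).trans_eq ?_)
  rw [Finset.card_univ, Fintype.card_fin, nsmul_eq_mul]

theorem measure_not_forall_batchView_le
    {P Q : (BatchIndex ρ q mt → EuclideanSpace ℝ (Fin n)) → Prop} :
    ((sensingLaw n q mt Lt ρ).prod (sensingLaw n q mt Lt ρ))
        {d | ¬ ∀ ϑ : Fin Lt, P (batchView ϑ d.1) ∧ Q (batchView ϑ d.2)} ≤
      Lt * (batchLaw n q mt ρ {ω | ¬ P ω} + batchLaw n q mt ρ {ω | ¬ Q ω}) := by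
  have hsub : {d : Data n q mt Lt ρ |
        ¬ ∀ ϑ : Fin Lt, P (batchView ϑ d.1) ∧ Q (batchView ϑ d.2)} ⊆
      (⋃ ϑ, batchView ϑ ⁻¹' {ω | ¬ P ω}) ×ˢ Set.univ ∪
        Set.univ ×ˢ ⋃ ϑ, batchView ϑ ⁻¹' {ω | ¬ Q ω} := by
    intro d hd
    obtain ⟨ϑ, hϑ⟩ := not_forall.1 hd
    exact (not_and_or.1 hϑ).imp (fun hP => ⟨Set.mem_iUnion.2 ⟨ϑ, hP⟩, trivial⟩)
      fun hQ => ⟨trivial, Set.mem_iUnion.2 ⟨ϑ, hQ⟩⟩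
  refine (measure_mono hsub).trans ((measure_union_le _ _).trans ?_)
  rw [Measure.prod_prod, Measure.prod_prod, measure_univ, one_mul, mul_one, mul_add]
  exact add_le_add (sensingLaw_iUnion_batchView_le _) (sensingLaw_iUnion_batchView_le _)

/-- `ρ mt q δ² / (r² κ⁴ μ²)`, the order of the exponents of all failure probabilities of a
mini-batch at accuracy `δ`. -/
noncomputable def Protocol.sampleExponent (p : Protocol n q r mt Lt ρ) (δ : ℝ) : ℝ :=
  ρ * mt * q * δ ^ 2 / (r ^ 2 * p.κ ^ 4 * p.μ ^ 2)

/-- The smallest of the constants in front of the exponents of the failure probabilities of a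
mini-batch; the last two come from the signal and the noise part. -/
noncomputable def batchRate : ℝ :=
  min (min (truncMean 1 ^ 2 / 2) 1) (min (truncMean truncLevel ^ 2 / (32 * truncLevel ^ 4))
    (truncMean truncLevel ^ 2 / (16 * 40000 * 32 * 36 * expSqMean)))

theorem batchRate_pos : 0 < batchRate := by
  have hβ1 := truncMean_pos one_pos
  have hβ := truncMean_pos truncLevel_pos
  have hb := truncLevel_pos
  have hK := zero_lt_one.trans_le one_le_expSqMean
  refine lt_min (lt_min ?_ one_pos) (lt_min ?_ ?_) <;> positivity

theorem batchRate_le : (batchRate ≤ truncMean 1 ^ 2 / 2 ∧ batchRate ≤ 1) ∧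
    batchRate ≤ truncMean truncLevel ^ 2 / (32 * truncLevel ^ 4) ∧
    batchRate ≤ truncMean truncLevel ^ 2 / (16 * 40000 * 32 * 36 * expSqMean) := by
  have hle := le_refl batchRate
  conv_rhs at hle => rw [batchRate]
  simpa only [le_min_iff] using hle

section Exponents

variable {p : Protocol n q r mt Lt ρ} (D : ReducedSVD p.X r) (hr : 0 < r) (hκ : p.κ = D.kappa)

include hr hκ

theorem sigmaMax_sq_eq : D.sigmaMax ^ 2 = p.κ ^ 2 * D.sigmaMin ^ 2 := by
  rw [D.sigmaMax_eq hr, ← hκ, mul_pow]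

theorem norm_col_sq_le_energyScale (hinc : D.Incoherent p.μ) (k : Fin q) :
    ‖cols p.X k‖ ^ 2 ≤ p.energyScale := by
  refine (D.norm_col_sq_le hinc k).trans ?_
  rw [sigmaMax_sq_eq D hr hκ, Protocol.energyScale]
  calc p.μ ^ 2 * (r / q) * (p.κ ^ 2 * D.sigmaMin ^ 2)
      = p.κ ^ 2 * p.μ ^ 2 * (r * D.sigmaMin ^ 2) / q := by ring
    _ ≤ _ := by gcongr; exact D.le_sum_norm_col_sq hr

theorem norm_row_sq_le (hinc : D.Incoherent p.μ) (k : Fin q) :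
    ‖D.row k‖ ^ 2 ≤ p.κ ^ 2 * p.μ ^ 2 * r / q := by
  have hcol := (D.norm_row_sq_le_col hr k).trans (D.norm_col_sq_le hinc k)
  rw [sigmaMax_sq_eq D hr hκ] at hcol
  have hσ := D.sigmaMin_pos hr
  refine le_of_mul_le_mul_left (hcol.trans_eq ?_) (show 0 < D.sigmaMin ^ 2 by positivity)
  ring

theorem energyScale_pos (hμ : 0 < p.μ) : 0 < p.energyScale := by
  have hσ := D.sigmaMin_pos hr
  have hκ1 : 0 < p.κ := hκ ▸ zero_lt_one.trans_le (D.one_le_kappa hr)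
  have hq := D.q_pos hr
  have hF : 0 < ∑ k, ‖cols p.X k‖ ^ 2 :=
    (show 0 < r * D.sigmaMin ^ 2 by positivity).trans_le (D.le_sum_norm_col_sq hr)
  unfold Protocol.energyScale
  positivity

theorem sampleExponent_le_signal (hμ : 0 < p.μ) {δ : ℝ} (hδ : 0 < δ) (hδ1 : δ < 1) :
    p.sampleExponent δ ≤ ρ * mt / (p.κ ^ 2 * p.μ ^ 2 * r / q) := by
  have hκ1 : 1 ≤ p.κ := hκ ▸ D.one_le_kappa hr
  have hr1 : (1 : ℝ) ≤ r := by exact_mod_cast hr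
  have hq := D.q_pos hr
  have hδκ : δ ^ 2 ≤ r * p.κ ^ 2 := (pow_le_one₀ hδ.le hδ1.le).trans
    (one_le_mul_of_one_le_of_one_le hr1 (one_le_pow₀ hκ1))
  rw [Protocol.sampleExponent, div_div_eq_mul_div, div_le_div_iff₀ (by positivity) (by positivity)]
  calc ρ * mt * q * δ ^ 2 * (p.κ ^ 2 * p.μ ^ 2 * r)
      = ρ * mt * q * (p.κ ^ 2 * p.μ ^ 2 * r) * δ ^ 2 := by ring
    _ ≤ ρ * mt * q * (p.κ ^ 2 * p.μ ^ 2 * r) * (r * p.κ ^ 2) := by gcongr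
    _ = _ := by ring

theorem sampleExponent_le_energy (hμ : 0 < p.μ) {δ : ℝ} (hδ : 0 < δ) (hδ1 : δ < 1) :
    p.sampleExponent δ ≤ ρ * mt * (∑ k, ‖cols p.X k‖ ^ 2) / p.energyScale := by
  have hκ1 : 0 < p.κ := hκ ▸ zero_lt_one.trans_le (D.one_le_kappa hr)
  have hr1 : (1 : ℝ) ≤ r := by exact_mod_cast hr
  have hq := D.q_pos hr
  have hscale := energyScale_pos D hr hκ hμ
  refine (sampleExponent_le_signal D hr hκ hμ hδ hδ1).trans ?_
  rw [div_le_div_iff₀ (by positivity) hscale, Protocol.energyScale]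
  calc ρ * mt * (p.κ ^ 2 * p.μ ^ 2 * (∑ k, ‖cols p.X k‖ ^ 2) / q)
      = ρ * mt * (∑ k, ‖cols p.X k‖ ^ 2) * (p.κ ^ 2 * p.μ ^ 2 * 1 / q) := by ring
    _ ≤ ρ * mt * (∑ k, ‖cols p.X k‖ ^ 2) * (p.κ ^ 2 * p.μ ^ 2 * r / q) := by gcongr

theorem mul_sampleExponent_le_noise (hμ : 0 < p.μ) (hmt : 0 < mt) (hρ : 0 < ρ) (δ : ℝ) :
    truncMean truncLevel ^ 2 / (16 * 40000 * 32 * 36 * expSqMean) * p.sampleExponent δ ≤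
      p.noiseTolerance D δ ^ 2 / (32 * (p.maxThreshold ^ 2 * (ρ * mt))) := by
  have hκ1 : 0 < p.κ := hκ ▸ zero_lt_one.trans_le (D.one_le_kappa hr)
  have hK := zero_lt_one.trans_le one_le_expSqMean
  have hq := D.q_pos hr
  have hscale := energyScale_pos D hr hκ hμ
  have hF : ∑ k, ‖cols p.X k‖ ^ 2 ≤ r * (p.κ ^ 2 * D.sigmaMin ^ 2) :=
    D.sum_norm_col_sq_le.trans_eq (by rw [sigmaMax_sq_eq D hr hκ])
  rw [Protocol.maxThreshold, Real.sq_sqrt (by positivity), Protocol.noiseTolerance,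
    Protocol.signalGap, div_pow, mul_pow (200 : ℝ), Real.sq_sqrt (Nat.cast_nonneg r), div_div,
    le_div_iff₀ (by positivity), Protocol.sampleExponent, Protocol.energyScale]
  calc truncMean truncLevel ^ 2 / (16 * 40000 * 32 * 36 * expSqMean) *
        (ρ * mt * q * δ ^ 2 / (r ^ 2 * p.κ ^ 4 * p.μ ^ 2)) * (200 ^ 2 * r * (32 * (36 * expSqMean *
          (p.κ ^ 2 * p.μ ^ 2 * (∑ k, ‖cols p.X k‖ ^ 2) / q) * (ρ * mt))))
      = truncMean truncLevel ^ 2 * (ρ * mt) ^ 2 * δ ^ 2 / (16 * r * p.κ ^ 2) *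
          ∑ k, ‖cols p.X k‖ ^ 2 := by
        field_simp
        ring
    _ ≤ truncMean truncLevel ^ 2 * (ρ * mt) ^ 2 * δ ^ 2 / (16 * r * p.κ ^ 2) *
          (r * (p.κ ^ 2 * D.sigmaMin ^ 2)) := by gcongr
    _ = _ := by
        field_simp
        ring

theorem batchLaw_not_energyGood_le_exp (hinc : D.Incoherent p.μ) {δ : ℝ} (hδ : 0 < δ)
    (hδ1 : δ < 1) :
    batchLaw n q mt ρ {ω | ¬ EnergyGood (cols p.X) ω} ≤
      ENNReal.ofReal (2 * Real.exp (-(batchRate * p.sampleExponent δ))) := by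
  obtain ⟨⟨hrate, hrate1⟩, -, -⟩ := batchRate_le
  have hμ := D.pos_of_incoherent hr hinc
  have hE := sampleExponent_le_energy D hr hκ hμ hδ hδ1
  have hE0 : 0 ≤ p.sampleExponent δ := by unfold Protocol.sampleExponent; positivity
  exact batchLaw_not_energyGood_le _ (energyScale_pos D hr hκ hμ)
    (norm_col_sq_le_energyScale D hr hκ hinc) (mul_le_mul hrate hE hE0 (by positivity))
    ((mul_le_of_le_one_left hE0 hrate1).trans hE)

theorem batchLaw_not_spectrumGood_le_exp (hinc : D.Incoherent p.μ) (hmt : 0 < mt) (hρ : 0 < ρ)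
    {δ : ℝ} (hδ : 0 < δ) (hδ1 : δ < 1) :
    batchLaw n q mt ρ {ω | ¬ SpectrumGood D p.maxThreshold (p.noiseTolerance D δ) ω} ≤
      ENNReal.ofReal ((5 ^ (n + q) * 2 + 25 ^ r) *
        Real.exp (-(batchRate * p.sampleExponent δ))) := by
  obtain ⟨-, hsignal, hnoise⟩ := batchRate_le
  have hμ := D.pos_of_incoherent hr hinc
  have hE := sampleExponent_le_signal D hr hκ hμ hδ hδ1
  have hE0 : 0 ≤ p.sampleExponent δ := by unfold Protocol.sampleExponent; positivity
  have hσ := D.sigmaMin_pos hr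
  have hβ := truncMean_pos truncLevel_pos
  exact batchLaw_not_spectrumGood_le D hr (by positivity) (norm_row_sq_le D hr hκ hinc)
    (by unfold Protocol.noiseTolerance Protocol.signalGap; positivity)
    ((mul_le_mul_of_nonneg_right hnoise hE0).trans
      (mul_sampleExponent_le_noise D hr hκ hμ hmt hρ δ))
    (mul_le_mul hsignal hE hE0 (by positivity))

end Exponents

theorem net_sizes_le (hrn : r ≤ n + q) (hnq : 1 ≤ n + q) :
    (2 + (5 ^ (n + q) * 2 + 25 ^ r) : ℝ) ≤ 125 ^ (n + q) := by
  have hone : (1 : ℝ) ≤ 25 ^ (n + q) := one_le_pow₀ (by norm_num)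
  have hfive : (5 : ℝ) ^ (n + q) ≤ 25 ^ (n + q) := by gcongr; norm_num
  have hr : (25 : ℝ) ^ r ≤ 25 ^ (n + q) := pow_le_pow_right₀ (by norm_num) hrn
  calc (2 + (5 ^ (n + q) * 2 + 25 ^ r) : ℝ) ≤ 5 * 25 ^ (n + q) := by linarith
    _ ≤ 5 ^ (n + q) * 25 ^ (n + q) := by
        gcongr
        exact le_self_pow₀ (by norm_num) (Nat.one_le_iff_ne_zero.1 hnq)
    _ = 125 ^ (n + q) := by rw [← mul_pow]; norm_num

theorem pow_le_exp_six_mul (k : ℕ) : (125 : ℝ) ^ k ≤ Real.exp (6 * k) := by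
  have hexp : (125 : ℝ) ≤ Real.exp 6 := by
    calc (125 : ℝ) ≤ 2.7 ^ 6 := by norm_num
      _ ≤ Real.exp 1 ^ 6 := by gcongr; linarith [Real.exp_one_gt_d9]
      _ = Real.exp 6 := by rw [← Real.exp_nat_mul]; norm_num
  rw [mul_comm, Real.exp_nat_mul]
  gcongr

theorem net_sizes_mul_exp_le {c E : ℝ} (hc : 0 < c) (hrn : r ≤ n + q) (hnq : 1 ≤ n + q)
    (hE : 12 / c * (n + q) ≤ E) :
    (2 + (5 ^ (n + q) * 2 + 25 ^ r)) * Real.exp (-(c * E)) ≤ Real.exp (-(c / 2 * E)) := by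
  have hexponent : 6 * ((n + q : ℕ) : ℝ) ≤ c / 2 * E := by
    calc 6 * ((n + q : ℕ) : ℝ) = c / 2 * (12 / c * (n + q)) := by push_cast; field_simp; ring
      _ ≤ c / 2 * E := by gcongr
  calc (2 + (5 ^ (n + q) * 2 + 25 ^ r)) * Real.exp (-(c * E))
      ≤ Real.exp (c / 2 * E) * Real.exp (-(c * E)) := by
        gcongr
        exact (net_sizes_le hrn hnq).trans
          ((pow_le_exp_six_mul _).trans (Real.exp_le_exp.2 hexponent))
    _ = Real.exp (-(c / 2 * E)) := by rw [← Real.exp_add]; congr 1; ring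

theorem measure_not_dataGood_le {p : Protocol n q r mt Lt ρ} (D : ReducedSVD p.X r) (hr : 0 < r)
    (hκ : p.κ = D.kappa) (hinc : D.Incoherent p.μ) (hbyz : (p.byz.card : ℝ) < 0.4 * Lt) {δ : ℝ}
    (hδ : 0 < δ) (hδ1 : δ < 1) (hE : 12 / batchRate * (n + q) ≤ p.sampleExponent δ) :
    ((sensingLaw n q mt Lt ρ).prod (sensingLaw n q mt Lt ρ)) {d | ¬ DataGood p D δ d} ≤
      ENNReal.ofReal (Lt * Real.exp (-(batchRate / 2 * p.sampleExponent δ))) := by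
  have hq := D.q_pos hr
  have hrate := batchRate_pos
  have hE0 : p.sampleExponent δ ≠ 0 :=
    ((show 0 < 12 / batchRate * (n + q : ℝ) by positivity).trans_le hE).ne'
  have hρ : 0 < ρ := Nat.pos_of_ne_zero (by rintro rfl; simp [Protocol.sampleExponent] at hE0)
  have hmt : 0 < mt := Nat.pos_of_ne_zero (by rintro rfl; simp [Protocol.sampleExponent] at hE0)
  refine (measure_mono fun d => _root_.mt fun hgood => dataGood_of_batches D hr hmt hρ
    (norm_col_sq_le_energyScale D hr hκ hinc) hbyz (fun ϑ _ => (hgood ϑ).1)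
    fun ϑ _ => (hgood ϑ).2).trans (measure_not_forall_batchView_le.trans ?_)
  calc (Lt : ℝ≥0∞) * (_ + _) ≤ Lt * (_ + _) := mul_le_mul_right (add_le_add
        (batchLaw_not_energyGood_le_exp D hr hκ hinc hδ hδ1)
        (batchLaw_not_spectrumGood_le_exp D hr hκ hinc hmt hρ hδ hδ1)) _
    _ ≤ _ := by
        rw [← ENNReal.ofReal_add (by positivity) (by positivity), ← add_mul,
          ENNReal.ofReal_mul (Nat.cast_nonneg Lt), ENNReal.ofReal_natCast]
        exact mul_le_mul_right (ENNReal.ofReal_le_ofReal (net_sizes_mul_exp_le hrate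
          (D.r_le_n.trans (Nat.le_add_right _ _)) (Nat.succ_le_of_lt (by positivity)) hE)) _

end Sampling

/-! ## The power methods of the clean mini-batches -/

section CleanPower

variable {n q r mt Lt ρ : ℕ} {p : Protocol n q r mt Lt ρ}

theorem Protocol.powerIterate_succ_of_clean {w : World n q r mt Lt ρ} {ϑ : Fin Lt}
    (hϑ : ϑ ∈ p.cleanBatches) (t : ℕ) :
    p.powerIterate w (t + 1) ϑ = p.qr.toFun
      ((∑ l, p.X0 w.1 (ϑ, l)) * (∑ l, p.X0 w.1 (ϑ, l))ᵀ * p.powerIterate w t ϑ) := by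
  have hV : p.VBatch w t (p.powerIterate w t) ϑ =
      (∑ l, p.X0 w.1 (ϑ, l))ᵀ * p.powerIterate w t ϑ := by
    simp only [Protocol.VBatch, Protocol.VNode, if_neg (Protocol.notMem_byz_of_clean hϑ _),
      Matrix.transpose_sum, Matrix.sum_mul]
  have hU : ∑ l, p.UNode w t (p.powerIterate w t) (ϑ, l) =
      (∑ l, p.X0 w.1 (ϑ, l)) * p.VBatch w t (p.powerIterate w t) ϑ := by
    simp only [Protocol.UNode, if_neg (Protocol.notMem_byz_of_clean hϑ _), Matrix.sum_mul]
  rw [Protocol.powerIterate]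
  beta_reduce
  rw [hU, hV, Matrix.mul_assoc]

theorem Protocol.exists_pow_mul_eq_powerIterate (w : World n q r mt Lt ρ) {ϑ : Fin Lt}
    (hϑ : ϑ ∈ p.cleanBatches) (t : ℕ) :
    ∃ R : Matrix (Fin r) (Fin r) ℝ,
      ((∑ l, p.X0 w.1 (ϑ, l)) * (∑ l, p.X0 w.1 (ϑ, l))ᵀ) ^ t * Matrix.of w.2 =
        p.powerIterate w t ϑ * R := by
  induction t with
  | zero => exact ⟨1, by simp [Protocol.powerIterate]⟩
  | succ t ih =>
    obtain ⟨R, hR⟩ := ih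
    obtain ⟨R', -, hR'⟩ := p.qr.factor
      ((∑ l, p.X0 w.1 (ϑ, l)) * (∑ l, p.X0 w.1 (ϑ, l))ᵀ * p.powerIterate w t ϑ)
    refine ⟨R' * R, ?_⟩
    rw [pow_succ', Matrix.mul_assoc, hR, p.powerIterate_succ_of_clean hϑ, ← Matrix.mul_assoc,
      ← Matrix.mul_assoc, ← hR']

theorem Protocol.exists_pow_mul_eq_basis (w : World n q r mt Lt ρ) {ϑ : Fin Lt}
    (hϑ : ϑ ∈ p.cleanBatches) (t : ℕ) :
    ∃ R : Matrix (Fin r) (Fin r) ℝ,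
      ((∑ l, p.X0 w.1 (ϑ, l)) * (∑ l, p.X0 w.1 (ϑ, l))ᵀ) ^ t * Matrix.of w.2 =
        p.basis w t ϑ * R := by
  obtain ⟨R, hR⟩ := p.exists_pow_mul_eq_powerIterate w hϑ t
  obtain ⟨R', -, hR'⟩ := p.qr.factor (p.powerIterate w t ϑ)
  exact ⟨R' * R, by rw [hR, ← Matrix.mul_assoc, Protocol.basis, ← hR']⟩

theorem Protocol.basis_orthonormal (p : Protocol n q r mt Lt ρ) (w : World n q r mt Lt ρ)
    (T : ℕ) (ϑ : Fin Lt) : (p.basis w T ϑ)ᵀ * p.basis w T ϑ = 1 :=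
  p.qr.orthonormal _

theorem DataGood.exists_subspaceDist_basis_le {D : ReducedSVD p.X r} (hr : 0 < r) {δ : ℝ}
    (hδ : 0 < δ) (hδ1 : δ < 1) {d : Data n q mt Lt ρ} (hd : DataGood p D δ d) {ϑ : Fin Lt}
    (hϑ : ϑ ∈ p.cleanBatches) :
    ∃ Q : Fin r → EuclideanSpace ℝ (Fin n), Orthonormal ℝ Q ∧ ∀ (T : ℕ) (u : Fin n → Fin r → ℝ),
      StartGood Q (cols u) (4 ^ (T + 1)) →
        subspaceDist D.U (p.basis (d, u) (T + 1) ϑ) ≤ δ / 100 := by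
  obtain ⟨G, W, θ, hM, hθ, hW, hG⟩ := hd ϑ hϑ
  have hsqrt : 1 ≤ √(r : ℝ) := Real.one_le_sqrt.2 (by exact_mod_cast hr)
  have hεθ : δ * θ / (200 * √r) ≤ θ := by
    rw [div_le_iff₀ (by positivity)]
    nlinarith
  have hε : 0 ≤ δ * θ / (200 * √r) := by positivity
  obtain ⟨Q, hQ, hpower⟩ := exists_orthonormal_subspaceDist_le D.U_orthonormal (D.U * G + W) hθ hε
    (by exact norm_proj_compl_add_le D.U_orthonormal G hW)
    (mul_norm_le_norm_transpose_add D.U_orthonormal G hW hε hεθ hG)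
  refine ⟨Q, hQ, fun T u hu => ?_⟩
  obtain ⟨R, hR⟩ := p.exists_pow_mul_eq_basis (d, u) hϑ (T + 1)
  rw [hM] at hR
  refine (hpower T (Matrix.of u) _ R hu (p.basis_orthonormal _ _ _) hR).trans_eq ?_
  field_simp
  norm_num

/-- At least `55%` of the mini-batches have an estimate of accuracy `δ / 100` after `T` iterations,
enough for the subspace median to be accurate. -/
def WorldGood (p : Protocol n q r mt Lt ρ) (D : ReducedSVD p.X r) (δ : ℝ) (T : ℕ)
    (w : World n q r mt Lt ρ) : Prop :=
  ∃ G : Finset (Fin Lt), 0.55 * (Lt : ℝ) ≤ G.card ∧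
    ∀ ϑ ∈ G, subspaceDist D.U (p.basis w T ϑ) ≤ δ / 100

theorem WorldGood.of_card_filter_le {D : ReducedSVD p.X r} {δ : ℝ} {T : ℕ}
    {w : World n q r mt Lt ρ} {Bad : Fin Lt → Prop} [DecidablePred Bad]
    (hbyz : (p.byz.card : ℝ) < 0.4 * Lt)
    (hbad : ((p.cleanBatches.filter Bad).card : ℝ) ≤ 1 / 20 * Lt)
    (hgood : ∀ ϑ ∈ p.cleanBatches, ¬ Bad ϑ → subspaceDist D.U (p.basis w T ϑ) ≤ δ / 100) :
    WorldGood p D δ T w := by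
  refine ⟨p.cleanBatches.filter fun ϑ => ¬ Bad ϑ, ?_, fun ϑ hϑ =>
    hgood ϑ (Finset.mem_filter.1 hϑ).1 (Finset.mem_filter.1 hϑ).2⟩
  have hclean := p.le_card_cleanBatches
  rw [← Finset.card_filter_add_card_filter_not (s := p.cleanBatches) Bad, Nat.cast_add] at hclean
  linarith

/-- A start is bad for a clean mini-batch with probability at most `2 η`, so by Markov's inequality
more than `Lt / 20` clean mini-batches have a bad start with probability at most `40 η`. -/
theorem DataGood.one_sub_le_worldGood {D : ReducedSVD p.X r} (hr : 0 < r) (hLt : 0 < Lt)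
    (hbyz : (p.byz.card : ℝ) < 0.4 * Lt) {δ : ℝ}
    (hδ : 0 < δ) (hδ1 : δ < 1) {d : Data n q mt Lt ρ} (hd : DataGood p D δ d) {η : ℝ}
    (hη : 0 < η) (hη1 : η ≤ 1) {T : ℕ} (hT : (n : ℝ) ^ 3 / η ^ 2 ≤ 4 ^ (T + 1)) :
    1 - 40 * η ≤ (Measure.pi fun _ : Fin n => Measure.pi fun _ : Fin r => gaussianReal 0 1).real
      {u | WorldGood p D δ (T + 1) (d, u)} := by
  classical
  choose! Q hQ hclose using fun ϑ (hϑ : ϑ ∈ p.cleanBatches) =>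
    hd.exists_subspaceDist_basis_le hr hδ hδ1 hϑ
  have hstart : ∀ ϑ ∈ p.cleanBatches,
      (Measure.pi fun _ : Fin n => Measure.pi fun _ : Fin r => gaussianReal 0 1)
        (cols ⁻¹' {v | ¬ StartGood (Q ϑ) v (4 ^ (T + 1))}) ≤ ENNReal.ofReal (2 * η) := fun ϑ hϑ =>
    (measurePreserving_cols.measure_preimage_le _).trans
      (measure_not_startGood_le hr (hQ ϑ hϑ) hη hη1 (by rwa [finrank_euclideanSpace_fin]))
  have hmarkov := measure_lt_card_filter_le p.cleanBatches _ (show (0 : ℝ) < 1 / 20 by norm_num)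
    hstart hLt ((Finset.card_le_univ _).trans_eq (Fintype.card_fin _))
  refine one_sub_le_measureReal_of_compl (by positivity)
    ((measure_mono fun u => ?_).trans (hmarkov.trans_eq (by ring_nf)))
  contrapose
  intro hcard
  rw [Set.mem_ofPred_eq, not_lt] at hcard
  rw [Set.notMem_compl_iff]
  exact WorldGood.of_card_filter_le hbyz hcard fun ϑ hϑ hgood => hclose ϑ hϑ T u (not_not.1 hgood)

end CleanPower

/-! ## The subspace median -/

section SubspaceMedian

variable {K : ℕ} {E : Type} [NormedAddCommGroup E] [NormedSpace ℝ E]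

theorem gmObjective_center_le {z : Fin K → E} {B : ℝ} (hz : ∀ i, ‖z i‖ ≤ B) :
    gmObjective z (gmCenter z) ≤ 2 * K * B := by
  rcases K.eq_zero_or_pos with rfl | hK
  · simp [gmObjective]
  have hK' : (0 : ℝ) < K := by exact_mod_cast hK
  have hcenter : ‖gmCenter z‖ ≤ B := by
    unfold gmCenter
    rw [norm_smul, Real.norm_of_nonneg (by positivity), inv_mul_le_iff₀ hK']
    refine (norm_sum_le _ _).trans ((Finset.sum_le_sum fun i _ => hz i).trans ?_)
    simp
  calc gmObjective z (gmCenter z) ≤ ∑ _i : Fin K, 2 * B :=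
        Finset.sum_le_sum fun i _ => (norm_sub_le _ _).trans (by linarith [hz i])
    _ = 2 * K * B := by simp; ring

theorem gmObjective_center_of_one (z : Fin 1 → E) : gmObjective z (gmCenter z) = 0 := by
  simp [gmObjective, gmCenter]

theorem exp_one_div_le : Real.exp (1 / 601) ≤ 1 + 1 / 600 := by
  have hinv := Real.one_sub_le_exp_neg (1 / 601)
  rw [Real.exp_neg, le_inv_comm₀ (by norm_num) (Real.exp_pos _)] at hinv
  exact hinv.trans_eq (by norm_num)

/-- `12621 = 21 · 601`, and `log (1 + 1 / 600) ≥ 1 / 601`. -/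
theorem pow_le_pow_of_log_le {x : ℝ} {T : ℕ} (hx : 0 < x) (hT : 12621 * Real.log x ≤ T) :
    x ^ 21 ≤ (1 + 1 / 600) ^ T := by
  calc x ^ 21 = Real.exp ((21 : ℕ) * Real.log x) := by rw [Real.exp_nat_mul, Real.exp_log hx]
    _ ≤ Real.exp (T * (1 / 601)) := by
        apply Real.exp_le_exp.2
        push_cast
        linarith
    _ = Real.exp (1 / 601) ^ T := Real.exp_nat_mul _ _
    _ ≤ _ := by gcongr; exact exp_one_div_le

theorem gm_error_le {T : ℕ} {L B δ C : ℝ} (hK : 0 < K) (hL : (K : ℝ) ≤ L) (hB : 1 ≤ B)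
    (hδ : 0 < δ) (hδ1 : δ < 1) (hC : 12621 ≤ C) (hT : C * Real.log (L * B / δ) ≤ T)
    {z : Fin K → E} (hz : ∀ i, ‖z i‖ ≤ B) :
    4000 * gmObjective z (gmCenter z) / (1 + 1 / 600) ^ T ≤ δ / 100 := by
  rcases (Nat.succ_le_of_lt hK).eq_or_lt with rfl | hK2
  · rw [gmObjective_center_of_one, mul_zero, zero_div]
    positivity
  have hK2' : (2 : ℝ) ≤ K := by exact_mod_cast hK2
  set x := L * B / δ with hx
  have hKx : K * B ≤ x * δ := by
    rw [hx, div_mul_cancel₀ _ hδ.ne']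
    gcongr
  have hx2 : 2 ≤ x := by
    rw [hx, le_div_iff₀ hδ]
    nlinarith
  have hlog : 0 ≤ Real.log x := Real.log_nonneg (by linarith)
  have hpow := pow_le_pow_of_log_le (by linarith) (le_trans (by gcongr) hT)
  rw [div_le_iff₀ (by positivity)]
  calc 4000 * gmObjective z (gmCenter z) ≤ 4000 * (2 * K * B) := by
        gcongr
        exact gmObjective_center_le hz
    _ ≤ 8000 * (x * δ) := by linarith
    _ ≤ 2 ^ 20 / 100 * (x * δ) := by gcongr; norm_num
    _ ≤ x ^ 20 / 100 * (x * δ) := by gcongr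
    _ = δ / 100 * x ^ 21 := by ring
    _ ≤ _ := by gcongr

theorem norm_sub_le_of_closest {E : Type*} [SeminormedAddCommGroup E] {a b o c : E} {d e : ℝ}
    (hclosest : ‖a - o‖ ≤ ‖b - o‖) (hb : ‖b - c‖ ≤ d) (ho : ‖o - c‖ ≤ e) :
    ‖a - c‖ ≤ d + 2 * e := by
  have hao := norm_sub_le_norm_sub_add_norm_sub a o c
  have hbo := norm_sub_le_norm_sub_add_norm_sub b c o
  rw [norm_sub_rev c o] at hbo
  linarith

section Output

variable {n q r mt Lt ρ : ℕ}

theorem norm_vec_proj_sub_le {U Z : Matrix (Fin n) (Fin r) ℝ} (hU : Uᵀ * U = 1) (hZ : Zᵀ * Z = 1)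
    {δ : ℝ} (hUZ : subspaceDist U Z ≤ δ) : ‖vec (Z * Zᵀ) - vec (U * Uᵀ)‖ ≤ 2 * δ := by
  have hnonneg : 0 ≤ subspaceDist U Z := Real.sqrt_nonneg _
  refine le_of_sq_le_sq ?_ (by linarith)
  rw [norm_vec_proj_sub_sq hU hZ]
  nlinarith

theorem subspaceDist_le_norm_vec_proj_sub {U Z : Matrix (Fin n) (Fin r) ℝ} (hU : Uᵀ * U = 1)
    (hZ : Zᵀ * Z = 1) : subspaceDist U Z ≤ ‖vec (Z * Zᵀ) - vec (U * Uᵀ)‖ := by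
  refine le_of_sq_le_sq ?_ (norm_nonneg _)
  rw [norm_vec_proj_sub_sq hU hZ]
  linarith [sq_nonneg (subspaceDist U Z)]

theorem norm_vec_proj_le (hr : 0 < r) {Z : Matrix (Fin n) (Fin r) ℝ} (hZ : Zᵀ * Z = 1) :
    ‖vec (Z * Zᵀ)‖ ≤ r := by
  have hr1 : (1 : ℝ) ≤ r := by exact_mod_cast hr
  refine le_of_sq_le_sq ?_ (Nat.cast_nonneg r)
  rw [norm_vec_proj_sq hZ]
  exact le_self_pow₀ hr1 two_ne_zero

variable {p : Protocol n q r mt Lt ρ} {S : Type} [MeasurableSpace S]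
  {gm : MedianRoutine Lt (EuclideanSpace ℝ (Fin n × Fin n)) S} {Tpow Tgm : ℕ} {εc L C : ℝ}
  {D : ReducedSVD p.X r}

theorem WorldGood.subspaceDist_output_le (hr : 0 < r) (hLt : 0 < Lt) (hL : (Lt : ℝ) ≤ L) {δ : ℝ}
    (hδ : 0 < δ) (hδ1 : δ < 1) (hC : 12621 ≤ C) (hT : C * Real.log (L * r / δ) ≤ Tgm)
    (hε : εc ≤ 1) {w : World n q r mt Lt ρ} (hw : WorldGood p D δ Tpow w) {s : S}
    (hs : gmObjective (p.proj w Tpow) (gmCenter (p.proj w Tpow)) ≠ 0 →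
      gm.LineSearchesSucceed Tgm εc (p.proj w Tpow) s)
    {Uout : Matrix (Fin n) (Fin r) ℝ} (hU : p.IsOutput gm Tpow Tgm w s Uout) :
    subspaceDist D.U Uout ≤ δ := by
  obtain ⟨G, hcard, hG⟩ := hw
  obtain ⟨ϑ, hbest, rfl⟩ := hU
  have hG0 : G.Nonempty := by
    have : (0 : ℝ) < Lt := by exact_mod_cast hLt
    rw [← Finset.card_pos, ← Nat.cast_pos (α := ℝ)]
    linarith
  have horth := p.basis_orthonormal w Tpow
  have hnear : ∀ ϑ ∈ G, ‖p.proj w Tpow ϑ - vec (D.U * D.Uᵀ)‖ ≤ 2 * (δ / 100) := fun ϑ hϑ =>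
    norm_vec_proj_sub_le D.U_orthonormal (horth ϑ) (hG ϑ hϑ)
  have hmedian := gm.norm_output_sub_le hε hs hG0 hnear hcard
  have herror := gm_error_le hLt hL (by exact_mod_cast hr) hδ hδ1 hC hT (z := p.proj w Tpow)
    fun ϑ => norm_vec_proj_le hr (horth ϑ)
  obtain ⟨ϑ', hϑ'⟩ := hG0
  refine (subspaceDist_le_norm_vec_proj_sub D.U_orthonormal (horth ϑ)).trans
    ((norm_sub_le_of_closest (hbest ϑ') (hnear ϑ' hϑ') hmedian).trans ?_)
  linarith

end Output

end SubspaceMedian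

/-! ## Success probability -/

section Success

variable {n q r mt Lt ρ : ℕ} {p : Protocol n q r mt Lt ρ} {D : ReducedSVD p.X r}
  {S : Type} [MeasurableSpace S] {ν : Measure S} [IsProbabilityMeasure ν]
  {gm : MedianRoutine Lt (EuclideanSpace ℝ (Fin n × Fin n)) S} {Tgm : ℕ} {εc cgm L C : ℝ}

instance : IsProbabilityMeasure (worldLaw n q r mt Lt ρ) := by
  unfold worldLaw; infer_instance

theorem WorldGood.one_sub_le_success (hr : 0 < r) (hLt : 0 < Lt) (hL : (Lt : ℝ) ≤ L) {δ : ℝ}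
    (hδ : 0 < δ) (hδ1 : δ < 1) (hC : 12621 ≤ C) (hT : C * Real.log (L * r / δ) ≤ Tgm)
    (hε : εc ≤ 1) (hcgm : 0 ≤ cgm) (hpath : gm.IsPathFollowing ν Tgm εc cgm) {Tpow : ℕ}
    {w : World n q r mt Lt ρ} (hw : WorldGood p D δ Tpow w) :
    1 - cgm ≤ ν.real {s | ∀ Uout, p.IsOutput gm Tpow Tgm w s Uout → subspaceDist D.U Uout ≤ δ} := by
  by_cases hobj : gmObjective (p.proj w Tpow) (gmCenter (p.proj w Tpow)) = 0
  · have huniv : {s | ∀ Uout, p.IsOutput gm Tpow Tgm w s Uout → subspaceDist D.U Uout ≤ δ} =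
        Set.univ := Set.eq_univ_of_forall fun s Uout =>
      hw.subspaceDist_output_le hr hLt hL hδ hδ1 hC hT hε fun hne => absurd hobj hne
    rw [huniv, probReal_univ]
    linarith
  · refine (hpath _ hobj).trans (measureReal_mono (fun s hs Uout => ?_) (measure_ne_top _ _))
    exact hw.subspaceDist_output_le hr hLt hL hδ hδ1 hC hT hε fun _ => hs

theorem one_sub_le_success (hr : 0 < r) (hLt : 0 < Lt) (hκ : p.κ = D.kappa)
    (hinc : D.Incoherent p.μ) (hbyz : (p.byz.card : ℝ) < 0.4 * Lt) {δ : ℝ} (hδ : 0 < δ)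
    (hδ1 : δ < 1) (hE : 12 / batchRate * (n + q) ≤ p.sampleExponent δ) {η : ℝ} (hη : 0 < η)
    (hη1 : η ≤ 1) {T : ℕ} (hTpow : (n : ℝ) ^ 3 / η ^ 2 ≤ 4 ^ (T + 1)) (hL : (Lt : ℝ) ≤ L)
    (hC : 12621 ≤ C) (hTgm : C * Real.log (L * r / δ) ≤ Tgm) (hε : εc ≤ 1) (hcgm : 0 ≤ cgm)
    (hpath : gm.IsPathFollowing ν Tgm εc cgm) :
    1 - Lt * Real.exp (-(batchRate / 2 * p.sampleExponent δ)) - 40 * η - cgm ≤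
      ((worldLaw n q r mt Lt ρ).prod ν).real
        {ω | ∀ Uout, p.IsOutput gm (T + 1) Tgm ω.1 ω.2 Uout → subspaceDist D.U Uout ≤ δ} := by
  have hdata := one_sub_le_measureReal_of_compl (G := {d | DataGood p D δ d}) (by positivity)
    (measure_not_dataGood_le D hr hκ hinc hbyz hδ hδ1 hE)
  have hworld := one_sub_le_prod_real (E := {w | WorldGood p D δ (T + 1) w}) (by positivity)
    (by positivity) hdata fun d hd =>
      DataGood.one_sub_le_worldGood hr hLt hbyz hδ hδ1 hd hη hη1 hTpow
  rw [sub_sub] at hworld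
  rw [sub_sub 1 _ (40 * η)]
  exact one_sub_le_prod_real (μ := worldLaw n q r mt Lt ρ) (by positivity) hcgm hworld fun w hw =>
    WorldGood.one_sub_le_success hr hLt hL hδ hδ1 hC hTgm hε hcgm hpath hw

end Success

/-! ## Numerical estimates -/

section Numerical

theorem start_error_le_pow {n s T : ℕ} (hn : 2 ≤ n) (hs : 1 ≤ s) (hT : 36 * s * Real.log n ≤ T) :
    (n : ℝ) ^ 3 / (1 / (80 * (n : ℝ) ^ (10 * s))) ^ 2 ≤ 4 ^ T := by
  have hn2 : (2 : ℝ) ≤ n := by exact_mod_cast hn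
  calc (n : ℝ) ^ 3 / (1 / (80 * (n : ℝ) ^ (10 * s))) ^ 2
      = (n : ℝ) ^ 3 * (6400 * (n : ℝ) ^ (20 * s)) := by field_simp; ring
    _ ≤ (n : ℝ) ^ 3 * ((n : ℝ) ^ 13 * (n : ℝ) ^ (20 * s)) := by
        gcongr
        exact le_trans (by norm_num) (pow_le_pow_left₀ zero_le_two hn2 13)
    _ = (n : ℝ) ^ (16 + 20 * s) := by rw [← pow_add, ← pow_add]; congr 1; ring
    _ ≤ (n : ℝ) ^ (36 * s) := pow_le_pow_right₀ (by linarith) (by omega)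
    _ = Real.exp ((36 * s : ℕ) * Real.log n) := by
        rw [Real.exp_nat_mul, Real.exp_log (by linarith)]
    _ ≤ Real.exp (T * 1) := by
        apply Real.exp_le_exp.2
        push_cast
        linarith
    _ = Real.exp 1 ^ T := Real.exp_nat_mul _ _
    _ ≤ 4 ^ T := by
        gcongr
        linarith [Real.exp_one_lt_d9]

theorem mul_log_le {a C κ x δ : ℝ} (ha : 0 ≤ a) (haC : a ≤ C) (hκ : 1 ≤ κ) (hx : 1 ≤ x)
    (hδ : 0 < δ) (hδ1 : δ < 1) : a * Real.log x ≤ C * κ ^ 2 * Real.log (x / δ) := by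
  have hlog : Real.log x ≤ Real.log (x / δ) :=
    Real.log_le_log (by linarith) ((le_div_iff₀ hδ).2 (by nlinarith))
  have hlog0 := Real.log_nonneg hx
  have hC := ha.trans haC
  have := hlog0.trans hlog
  calc a * Real.log x ≤ C * Real.log (x / δ) := by gcongr
    _ = C * 1 * Real.log (x / δ) := by ring
    _ ≤ _ := by gcongr; exact one_le_pow₀ hκ

theorem one_le_mul_log {C κ x δ : ℝ} (hC : 2 ≤ C) (hκ : 1 ≤ κ) (hx : 2 ≤ x) (hδ : 0 < δ)
    (hδ1 : δ < 1) : 1 ≤ C * κ ^ 2 * Real.log (x / δ) := by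
  refine le_trans ?_ (mul_log_le zero_le_two hC hκ (by linarith) hδ hδ1)
  linarith [Real.log_le_log two_pos hx, Real.log_two_gt_d9]

theorem psi_le_neg_log {a b : ℝ} (ha : 0 < a) (ha1 : a < 1) (hb : 0 < b) (hb2 : b ≤ 1 / 2) :
    psi a b ≤ -Real.log b := by
  have hlog_b : (1 - a) * Real.log b ≤ (1 - a) * Real.log (1 - b) := by
    gcongr
    linarith
  have hlog_a : a * Real.log a ≤ 0 :=
    mul_nonpos_of_nonneg_of_nonpos ha.le (Real.log_nonpos ha.le ha1.le)
  have hlog_compl : (1 - a) * Real.log (1 - a) ≤ 0 :=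
    mul_nonpos_of_nonneg_of_nonpos (by linarith) (Real.log_nonpos (by linarith) (by linarith))
  rw [psi, Real.log_div (by linarith) (by linarith), Real.log_div ha.ne' hb.ne']
  linarith

theorem pow_le_exp_neg_mul_psi {a b : ℝ} (ha : 0 < a) (ha1 : a < 1) (hb : 0 < b) (hb2 : b ≤ 1 / 2)
    (L : ℕ) : b ^ L ≤ Real.exp (-(L * psi a b)) := by
  rw [← Real.exp_log hb, ← Real.exp_nat_mul, Real.exp_log hb, Real.exp_le_exp, le_neg, ← mul_neg]
  exact mul_le_mul_of_nonneg_left (psi_le_neg_log ha ha1 hb hb2) L.cast_nonneg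

theorem two_mul_exp_neg_le_pow {k x y : ℝ} {L : ℕ} (hL : 1 ≤ L) (hk : k ≤ L) (hy : 2 ≤ y)
    (hx : 4 * L * y ≤ x) : 2 * (k * Real.exp (-x)) ≤ Real.exp (-(9 / 10 * y)) ^ L := by
  have hL1 : (1 : ℝ) ≤ L := by exact_mod_cast hL
  have hexp := Real.add_one_le_exp (L : ℝ)
  calc 2 * (k * Real.exp (-x)) ≤ Real.exp L * (Real.exp L * Real.exp (-x)) := by
        rw [← mul_assoc, ← mul_assoc]
        gcongr ?_ * _
        exact (mul_le_mul_of_nonneg_left (by linarith : k ≤ Real.exp L) zero_le_two).trans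
          (mul_le_mul_of_nonneg_right (by linarith) (Real.exp_nonneg _))
    _ = Real.exp (L + (L + -x)) := by rw [Real.exp_add, Real.exp_add]
    _ ≤ Real.exp (L * -(9 / 10 * y)) := by
        apply Real.exp_le_exp.2
        nlinarith
    _ = _ := Real.exp_nat_mul _ _

/-- Both error terms are at most half of `b ^ L`, where `b` is the second argument of `psi`. -/
theorem error_le_exp_neg_mul_psi {n q L : ℕ} (hn : 2 ≤ n) (hL : 1 ≤ L) {k a x : ℝ} (hk : k ≤ L)
    (ha : 0 < a) (ha1 : a < 1) (hx : 4 * L * (n + q) ≤ x) :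
    k * Real.exp (-x) + 1 / (2 * (n : ℝ) ^ (10 * L)) ≤
      Real.exp (-(L * psi a (Real.exp (-(9 / 10 * (n + q))) + 1 / (n : ℝ) ^ 10))) := by
  have hn2 : (2 : ℝ) ≤ n := by exact_mod_cast hn
  have hnq : (2 : ℝ) ≤ n + q := by linarith [q.cast_nonneg (α := ℝ)]
  have hexp := two_mul_exp_neg_le_pow hL hk hnq hx
  set e := Real.exp (-(9 / 10 * ((n : ℝ) + q)))
  have he0 : 0 < e := Real.exp_pos _
  have he : e ≤ 4 / 10 := by
    have hle : e ≤ Real.exp (-1) := Real.exp_le_exp.2 (by linarith)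
    linarith [Real.exp_neg_one_lt_d9]
  have hpow : 1 / (n : ℝ) ^ 10 ≤ 1 / 2 ^ 10 := by gcongr
  have hpow0 : 0 < 1 / (n : ℝ) ^ 10 := by positivity
  calc k * Real.exp (-x) + 1 / (2 * (n : ℝ) ^ (10 * L))
      = (2 * (k * Real.exp (-x)) + (1 / (n : ℝ) ^ 10) ^ L) / 2 := by
        rw [one_div_pow, ← pow_mul]
        field_simp
    _ ≤ ((e + 1 / (n : ℝ) ^ 10) ^ L + (e + 1 / (n : ℝ) ^ 10) ^ L) / 2 := by
        gcongr
        · exact hexp.trans (by gcongr; linarith)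
        · linarith
    _ = (e + 1 / (n : ℝ) ^ 10) ^ L := by ring
    _ ≤ _ := pow_le_exp_neg_mul_psi ha ha1 (by positivity) (by linarith) L

end Numerical

/-! ## Success probability and communication cost in terms of the sample size -/

section Main

variable {n q r mt Lt ρ : ℕ} {p : Protocol n q r mt Lt ρ} {D : ReducedSVD p.X r}
  {S : Type} [MeasurableSpace S] {ν : Measure S} [IsProbabilityMeasure ν]
  {gm : MedianRoutine Lt (EuclideanSpace ℝ (Fin n × Fin n)) S} {Tpow Tgm : ℕ}
  {δ εc cgm Cs Cpow C : ℝ} {L : ℕ}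

/-- The constant `C₀`: the summands suffice for the geometric median, for the sample size, and for
error terms below those of the large deviation bound when `L` is treated as a constant. -/
noncomputable def leadingConst : ℝ := 12621 + 12 / batchRate + 8 / batchRate

theorem leadingConst_bounds :
    12621 ≤ leadingConst ∧ 12 / batchRate ≤ leadingConst ∧ 8 / batchRate ≤ leadingConst := by
  have := batchRate_pos
  have h12 : 0 < 12 / batchRate := by positivity
  have h8 : 0 < 8 / batchRate := by positivity
  unfold leadingConst
  exact ⟨by linarith, by linarith, by linarith⟩

theorem Protocol.mul_le_sampleExponent (hκ : 1 ≤ p.κ) (hμ : 0 < p.μ) (hr : 0 < r) (hLt : 0 < Lt)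
    (hδ : 0 < δ) (hCs : 0 ≤ Cs)
    (hsample : Cs * Lt * (p.κ ^ 6 * p.μ ^ 2 * (n + q) * r ^ 2) / δ ^ 2 ≤
      ((mt * (Lt * ρ) : ℕ) : ℝ) * q) :
    Cs * (n + q) ≤ p.sampleExponent δ := by
  have : 0 < p.κ := by linarith
  have hLt0 : (0 : ℝ) < Lt := by exact_mod_cast hLt
  push_cast at hsample
  rw [div_le_iff₀ (by positivity)] at hsample
  rw [Protocol.sampleExponent, le_div_iff₀ (by positivity)]
  calc Cs * (n + q) * (r ^ 2 * p.κ ^ 4 * p.μ ^ 2)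
      = Cs * (p.κ ^ 4 * 1 * p.μ ^ 2 * (n + q) * r ^ 2) := by ring
    _ ≤ Cs * (p.κ ^ 4 * p.κ ^ 2 * p.μ ^ 2 * (n + q) * r ^ 2) := by
        gcongr
        exact one_le_pow₀ hκ
    _ ≤ ρ * mt * q * δ ^ 2 := le_of_mul_le_mul_left (by linarith) hLt0

theorem one_sub_le_success_of_log_le (hn : 2 ≤ n) (hr : 0 < r) (hLt : 0 < Lt) (hκ : p.κ = D.kappa)
    (hinc : D.Incoherent p.μ) (hbyz : (p.byz.card : ℝ) < 0.4 * Lt) (hδ : 0 < δ) (hδ1 : δ < 1)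
    (hE : 12 / batchRate * (n + q) ≤ p.sampleExponent δ) {s : ℕ} (hs : 1 ≤ s)
    (hTpow : 36 * s * Real.log n ≤ Tpow) (hL : Lt ≤ L) (hC : 12621 ≤ C)
    (hTgm : C * Real.log (L * r / δ) ≤ Tgm) (hε : εc ≤ 1) (hcgm : 0 ≤ cgm)
    (hpath : gm.IsPathFollowing ν Tgm εc cgm) :
    1 - cgm - 1 / (2 * (n : ℝ) ^ (10 * s)) -
        Lt * Real.exp (-(batchRate / 2 * p.sampleExponent δ)) ≤
      ((worldLaw n q r mt Lt ρ).prod ν).real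
        {ω | ∀ Uout, p.IsOutput gm Tpow Tgm ω.1 ω.2 Uout → subspaceDist D.U Uout ≤ δ} := by
  have hn2 : (2 : ℝ) ≤ n := by exact_mod_cast hn
  obtain ⟨T, rfl⟩ : ∃ T, Tpow = T + 1 := by
    have hlog : 0 < Real.log n := Real.log_pos (by linarith)
    have hT : (0 : ℝ) < Tpow := lt_of_lt_of_le (by positivity) hTpow
    exact Nat.exists_eq_add_one.2 (by exact_mod_cast hT)
  have hη1 : 1 / (80 * (n : ℝ) ^ (10 * s)) ≤ 1 := by
    rw [div_le_one (by positivity)]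
    linarith [one_le_pow₀ (n := 10 * s) (show (1 : ℝ) ≤ n by linarith)]
  have hη : 40 * (1 / (80 * (n : ℝ) ^ (10 * s))) = 1 / (2 * (n : ℝ) ^ (10 * s)) := by
    field_simp
    norm_num
  have hsuccess := one_sub_le_success (ν := ν) (gm := gm) hr hLt hκ hinc hbyz hδ hδ1 hE
    (by positivity) hη1 (start_error_le_pow hn hs hTpow) (by exact_mod_cast hL) hC hTgm hε hcgm
    hpath
  linarith

theorem one_sub_le_success_of_sample (hn : 2 ≤ n) (hr : 0 < r) (hLt : 0 < Lt) (hρ : 0 < ρ)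
    (hκ : p.κ = D.kappa) (hinc : D.Incoherent p.μ) (hbyz : (p.byz.card : ℝ) < 0.4 * Lt)
    (hδ : 0 < δ) (hδ1 : δ < 1) (hE : 12 / batchRate * (n + q) ≤ p.sampleExponent δ)
    (hTpow : 36 * Real.log n ≤ Tpow) (hL : Lt ≤ L) (hC : 12621 ≤ C)
    (hTgm : C * Real.log (L * r / δ) ≤ Tgm) (hε : εc ≤ 1) (hcgm : 0 ≤ cgm)
    (hpath : gm.IsPathFollowing ν Tgm εc cgm) :
    1 - cgm - 1 / (n : ℝ) ^ 10 -
        L * Real.exp (-(batchRate / 2 * mt * q * δ ^ 2 / (r ^ 2 * p.κ ^ 4 * p.μ ^ 2))) ≤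
      ((worldLaw n q r mt Lt ρ).prod ν).real
        {ω | ∀ Uout, p.IsOutput gm Tpow Tgm ω.1 ω.2 Uout → subspaceDist D.U Uout ≤ δ} := by
  have hsuccess := one_sub_le_success_of_log_le (ν := ν) (gm := gm) hn hr hLt hκ hinc hbyz hδ hδ1 hE
    le_rfl (by simpa using hTpow) hL hC hTgm hε hcgm hpath
  have hstart : 1 / (2 * (n : ℝ) ^ (10 * 1)) ≤ 1 / (n : ℝ) ^ 10 := by
    rw [mul_one]
    have hpow : 0 < (n : ℝ) ^ 10 := by positivity
    exact one_div_le_one_div_of_le hpow (by linarith)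
  have hdata : Lt * Real.exp (-(batchRate / 2 * p.sampleExponent δ)) ≤
      L * Real.exp (-(batchRate / 2 * mt * q * δ ^ 2 / (r ^ 2 * p.κ ^ 4 * p.μ ^ 2))) := by
    have hrate := batchRate_pos
    have hρ1 : (1 : ℝ) ≤ ρ := by exact_mod_cast hρ
    have hE1 : 0 ≤ batchRate / 2 * mt * q * δ ^ 2 / (r ^ 2 * p.κ ^ 4 * p.μ ^ 2) := by positivity
    gcongr
    calc _ ≤ ρ * (batchRate / 2 * mt * q * δ ^ 2 / (r ^ 2 * p.κ ^ 4 * p.μ ^ 2)) :=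
          le_mul_of_one_le_left hE1 hρ1
      _ = _ := by rw [Protocol.sampleExponent]; ring
  linarith

theorem one_sub_le_success_of_mul_le (hn : 2 ≤ n) (hr : 0 < r) (hLt : 0 < Lt) (hκ : p.κ = D.kappa)
    (hinc : D.Incoherent p.μ) (hbyz : (p.byz.card : ℝ) < 0.4 * Lt) (hδ : 0 < δ) (hδ1 : δ < 1)
    (hE : 12 / batchRate * (n + q) ≤ p.sampleExponent δ)
    (hEL : 8 / batchRate * L * (n + q) ≤ p.sampleExponent δ)
    (hTpow : 36 * L * Real.log n ≤ Tpow) (hL : Lt ≤ L) (hC : 12621 ≤ C)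
    (hTgm : C * Real.log (L * r / δ) ≤ Tgm) (hε : εc ≤ 1) (hcgm : 0 ≤ cgm)
    (hpath : gm.IsPathFollowing ν Tgm εc cgm) {a : ℝ} (ha : 0 < a) (ha1 : a < 1) :
    1 - cgm -
        Real.exp (-(L * psi a (Real.exp (-(9 / 10 * (n + q))) + 1 / (n : ℝ) ^ 10))) ≤
      ((worldLaw n q r mt Lt ρ).prod ν).real
        {ω | ∀ Uout, p.IsOutput gm Tpow Tgm ω.1 ω.2 Uout → subspaceDist D.U Uout ≤ δ} := by
  have hrate := batchRate_pos
  have hexponent : 4 * L * (n + q : ℝ) ≤ batchRate / 2 * p.sampleExponent δ := by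
    calc 4 * L * (n + q : ℝ) = batchRate / 2 * (8 / batchRate * L * (n + q)) := by
          field_simp
          ring
      _ ≤ _ := by gcongr
  have herror := error_le_exp_neg_mul_psi (k := Lt) hn (hLt.trans_le hL) (by exact_mod_cast hL)
    ha ha1 hexponent
  have hsuccess := one_sub_le_success_of_log_le (ν := ν) (gm := gm) hn hr hLt hκ hinc hbyz hδ hδ1 hE
    (hLt.trans_le hL) hTpow hL hC hTgm hε hcgm hpath
  linarith

theorem Protocol.commCost_eq (p : Protocol n q r mt Lt ρ) (w : World n q r mt Lt ρ) (T : ℕ)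
    (ℓ : Node Lt ρ) :
    p.commCost w T ℓ = 2 + n * r + T * (2 * (q * r) + 2 * (n * r)) := by
  simp only [Protocol.commCost, Protocol.transcript, List.map_append, List.sum_append,
    List.map_flatMap, List.map_cons, List.map_nil, Message.size]
  simp [List.flatMap_def, List.sum_flatten]
  ring

theorem Protocol.commCost_bounds (p : Protocol n q r mt Lt ρ) (w : World n q r mt Lt ρ)
    (ℓ : Node Lt ρ) (hn : 2 ≤ n) (hr : 0 < r) {x : ℝ} (hx : 1 ≤ x) :
    x * ((n + q) * r) ≤ p.commCost w ⌈x⌉₊ ℓ ∧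
      (p.commCost w ⌈x⌉₊ ℓ : ℝ) ≤ 6 * (x * ((n + q) * r)) := by
  have hceil := Nat.le_ceil x
  have hceil2 : (⌈x⌉₊ : ℝ) ≤ 2 * x := by linarith [Nat.ceil_lt_add_one (zero_le_one.trans hx)]
  have hr1 : (1 : ℝ) ≤ r := by exact_mod_cast hr
  have hn2 : (2 : ℝ) ≤ n := by exact_mod_cast hn
  have hqr : (0 : ℝ) ≤ q * r := by positivity
  have hnr : 2 ≤ (n : ℝ) * r := by nlinarith
  have hlower : x * ((n + q) * r) ≤ ⌈x⌉₊ * ((n + q) * r) := by gcongr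
  have hupper : ⌈x⌉₊ * (((n : ℝ) + q) * r) ≤ 2 * x * ((n + q) * r) := by gcongr
  have hone : 1 * (((n : ℝ) + q) * r) ≤ x * ((n + q) * r) := by gcongr
  rw [p.commCost_eq]
  push_cast
  constructor <;> linarith

theorem Protocol.commCost_le_of_le (p : Protocol n q r mt Lt ρ) (w : World n q r mt Lt ρ)
    (ℓ : Node Lt ρ) (hn : 2 ≤ n) (hr : 0 < r) (hqn : q ≤ n) {x : ℝ} (hx : 1 ≤ x) :
    (p.commCost w ⌈x⌉₊ ℓ : ℝ) ≤ 12 * (x * (n * r)) := by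
  have hqn' : (q : ℝ) ≤ n := by exact_mod_cast hqn
  calc (p.commCost w ⌈x⌉₊ ℓ : ℝ) ≤ 6 * (x * ((n + q) * r)) :=
        (p.commCost_bounds w ℓ hn hr hx).2
    _ ≤ 6 * (x * ((n + n) * r)) := by gcongr
    _ = 12 * (x * (n * r)) := by ring

end Main

end ByzLRCS

theorem mainTheorem4_general :
    ∃ C₀ c c' K : ℝ, 1 ≤ C₀ ∧ 0 < c ∧ c < 1 ∧ 0 < c' ∧ c' < 1 ∧ 1 ≤ K ∧
    ∀ (n q r mt Lt ρ L m : ℕ), 2 ≤ n → 0 < r → 0 < Lt → 0 < ρ → L = Lt * ρ → m = mt * L →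
    ∀ (p : ByzLRCS.Protocol n q r mt Lt ρ) (D : ByzLRCS.ReducedSVD p.X r),
      p.κ = D.kappa → D.Incoherent p.μ →
    ∀ τ : ℝ, (p.byz.card : ℝ) ≤ τ * L → τ < 0.4 * Lt / L →
    ∀ δ₀ : ℝ, 0 < δ₀ → δ₀ < 1 →
    ∀ Cs Cpow Cgm : ℝ, C₀ ≤ Cs → C₀ ≤ Cpow → C₀ ≤ Cgm →
    ∀ Tpow Tgm : ℕ,
      Tpow = ⌈Cpow * p.κ ^ 2 * Real.log (n / δ₀)⌉₊ →
      Tgm = ⌈Cgm * Real.log (L * r / δ₀)⌉₊ →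
    ∀ (S : Type) [MeasurableSpace S] (ν : MeasureTheory.Measure S)
      [MeasureTheory.IsProbabilityMeasure ν]
      (gm : ByzLRCS.MedianRoutine Lt (EuclideanSpace ℝ (Fin n × Fin n)) S) (εc cgm : ℝ),
      εc ≤ 1 → 0 ≤ cgm → gm.IsPathFollowing ν Tgm εc cgm →
      Cs * Lt * (p.κ ^ 6 * p.μ ^ 2 * (n + q) * r ^ 2) / δ₀ ^ 2 ≤ (m : ℝ) * q →
      (1 - cgm - 1 / (n : ℝ) ^ 10
          - L * Real.exp (-(c' * mt * q * δ₀ ^ 2 / (r ^ 2 * p.κ ^ 4 * p.μ ^ 2)))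
        ≤ ((ByzLRCS.worldLaw n q r mt Lt ρ).prod ν).real
            {ω | ∀ Uout, p.IsOutput gm Tpow Tgm ω.1 ω.2 Uout →
              ByzLRCS.subspaceDist D.U Uout ≤ δ₀}) ∧
      (C₀ * L ≤ Cs → C₀ * L ≤ Cpow →
        1 - cgm
          - Real.exp (-(L * ByzLRCS.psi (0.4 - τ)
              (Real.exp (-(c * (n + q))) + 1 / (n : ℝ) ^ 10)))
        ≤ ((ByzLRCS.worldLaw n q r mt Lt ρ).prod ν).real
            {ω | ∀ Uout, p.IsOutput gm Tpow Tgm ω.1 ω.2 Uout →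
              ByzLRCS.subspaceDist D.U Uout ≤ δ₀}) ∧
      (∀ (w : ByzLRCS.World n q r mt Lt ρ) (ℓ : ByzLRCS.Node Lt ρ),
        Cpow * p.κ ^ 2 * (n + q) * r * Real.log (n / δ₀) ≤ p.commCost w Tpow ℓ ∧
        (p.commCost w Tpow ℓ : ℝ) ≤ K * (Cpow * p.κ ^ 2 * (n + q) * r * Real.log (n / δ₀)) ∧
        (q ≤ n →
          (p.commCost w Tpow ℓ : ℝ) ≤ K * (Cpow * p.κ ^ 2 * n * r * Real.log (n / δ₀)))) := by
  obtain ⟨hC₀, hC₀E, hC₀L⟩ := ByzLRCS.leadingConst_bounds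
  have hrate := ByzLRCS.batchRate_pos
  have hrate1 := ByzLRCS.batchRate_le.1.2
  refine ⟨ByzLRCS.leadingConst, 9 / 10, ByzLRCS.batchRate / 2, 12, by linarith, by norm_num,
    by norm_num, by positivity, by linarith, by norm_num, ?_⟩
  rintro n q r mt Lt ρ L _ hn hr hLt hρ hL rfl p D hκ hinc τ hτ hτ_lt δ hδ hδ1 Cs Cpow Cgm hCs
    hCpow hCgm _ Tgm rfl hTgm S _ ν _ gm εc cgm hε hcgm hpath hsample
  have hκ1 : 1 ≤ p.κ := hκ ▸ D.one_le_kappa hr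
  have hn2 : (2 : ℝ) ≤ n := by exact_mod_cast hn
  have hLtL : Lt ≤ L := hL ▸ Nat.le_mul_of_pos_right Lt hρ
  have hL1 : (1 : ℝ) ≤ L := by exact_mod_cast hLt.trans_le hLtL
  have hτL : τ * L < 0.4 * Lt := (lt_div_iff₀ (by linarith)).1 hτ_lt
  have hE : Cs * (n + q) ≤ p.sampleExponent δ := ByzLRCS.Protocol.mul_le_sampleExponent hκ1
    (D.pos_of_incoherent hr hinc) hr hLt hδ (by linarith) (hL ▸ hsample)
  have hE12 : 12 / ByzLRCS.batchRate * (n + q : ℝ) ≤ p.sampleExponent δ :=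
    hE.trans' (by gcongr; linarith)
  have hiter : ∀ a, 0 ≤ a → a ≤ Cpow →
      a * Real.log n ≤ Cpow * p.κ ^ 2 * Real.log (n / δ) := fun a ha haC =>
    ByzLRCS.mul_log_le ha haC hκ1 (by linarith) hδ hδ1
  have hTgm_le : Cgm * Real.log (L * r / δ) ≤ Tgm := hTgm ▸ Nat.le_ceil _
  refine ⟨?_, fun hCsL hCpowL => ?_, fun w ℓ => ?_⟩
  · exact ByzLRCS.one_sub_le_success_of_sample hn hr hLt hρ hκ hinc (hτ.trans_lt hτL) hδ hδ1 hE12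
      ((hiter 36 (by norm_num) (by linarith)).trans (Nat.le_ceil _)) hLtL (by linarith) hTgm_le hε
      hcgm hpath
  · have hτ0 : 0 ≤ τ := nonneg_of_mul_nonneg_left ((Nat.cast_nonneg _).trans hτ) (by linarith)
    have hτ1 : τ < 0.4 := lt_of_mul_lt_mul_right (hτL.trans_le (by gcongr)) L.cast_nonneg
    exact ByzLRCS.one_sub_le_success_of_mul_le hn hr hLt hκ hinc (hτ.trans_lt hτL) hδ hδ1 hE12
      (hE.trans' (by gcongr; exact hCsL.trans' (by gcongr)))
      ((hiter _ (by positivity) (hCpowL.trans' (by gcongr; linarith))).trans (Nat.le_ceil _)) hLtL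
      (by linarith) hTgm_le hε hcgm hpath (by linarith) (by linarith)
  · have hx := ByzLRCS.one_le_mul_log (C := Cpow) (by linarith) hκ1 hn2 hδ hδ1
    obtain ⟨hlower, hupper⟩ := p.commCost_bounds w ℓ hn hr hx
    exact ⟨by linarith, by linarith, fun hqn => by
      linarith [p.commCost_le_of_le w ℓ hn hr hqn hx]⟩

theorem mainTheorem4 :
    ∃ C₀ c c' K : ℝ, 1 ≤ C₀ ∧ 0 < c ∧ c < 1 ∧ 0 < c' ∧ c' < 1 ∧ 1 ≤ K ∧
    ∀ (n q r mt Lt ρ L m : ℕ), 2 ≤ n → 0 < r → 0 < Lt → 0 < ρ → L = Lt * ρ → m = mt * L →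
    ∀ (p : ByzLRCS.Protocol n q r mt Lt ρ) (D : ByzLRCS.ReducedSVD p.X r),
      p.κ = D.kappa → 1 ≤ p.μ → D.Incoherent p.μ →
    ∀ τ : ℝ, (p.byz.card : ℝ) ≤ τ * L → τ < 0.4 * Lt / L →
    ∀ δ₀ : ℝ, 0 < δ₀ → δ₀ < 1 →
    ∀ Cs Cpow Cgm : ℝ, C₀ ≤ Cs → C₀ ≤ Cpow → C₀ ≤ Cgm →
    ∀ Tpow Tgm : ℕ,
      Tpow = ⌈Cpow * p.κ ^ 2 * Real.log (n / δ₀)⌉₊ →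
      Tgm = ⌈Cgm * Real.log (L * r / δ₀)⌉₊ →
    ∀ (S : Type) [MeasurableSpace S] (ν : MeasureTheory.Measure S)
      [MeasureTheory.IsProbabilityMeasure ν]
      (gm : ByzLRCS.MedianRoutine Lt (EuclideanSpace ℝ (Fin n × Fin n)) S) (εc cgm : ℝ),
      0 < εc → εc ≤ 1 → 0 ≤ cgm → gm.IsPathFollowing ν Tgm εc cgm →
      Cs * Lt * (p.κ ^ 6 * p.μ ^ 2 * (n + q) * r ^ 2) / δ₀ ^ 2 ≤ (m : ℝ) * q →
      (1 - cgm
          - Real.exp (-(Lt * ByzLRCS.psi (0.4 - τ * L / Lt)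
              (Real.exp (-(c * (n + q))) + 1 / (n : ℝ) ^ 10)))
          - 1 / (n : ℝ) ^ 10
          - L * Real.exp (-(c' * mt * q * δ₀ ^ 2 / (r ^ 2 * p.κ ^ 4 * p.μ ^ 2)))
        ≤ ((ByzLRCS.worldLaw n q r mt Lt ρ).prod ν).real
            {ω | ∀ Uout, p.IsOutput gm Tpow Tgm ω.1 ω.2 Uout →
              ByzLRCS.subspaceDist D.U Uout ≤ δ₀}) ∧
      (C₀ * L ≤ Cs → C₀ * L ≤ Cpow →
        1 - cgm
          - Real.exp (-(L * ByzLRCS.psi (0.4 - τ)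
              (Real.exp (-(c * (n + q))) + 1 / (n : ℝ) ^ 10)))
          - L * Real.exp (-(c' * mt * q * δ₀ ^ 2 / (r ^ 2 * p.κ ^ 4)))
        ≤ ((ByzLRCS.worldLaw n q r mt Lt ρ).prod ν).real
            {ω | ∀ Uout, p.IsOutput gm Tpow Tgm ω.1 ω.2 Uout →
              ByzLRCS.subspaceDist D.U Uout ≤ δ₀}) ∧
      (∀ (w : ByzLRCS.World n q r mt Lt ρ) (ℓ : ByzLRCS.Node Lt ρ),
        Cpow * p.κ ^ 2 * (n + q) * r * Real.log (n / δ₀) ≤ p.commCost w Tpow ℓ ∧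
        (p.commCost w Tpow ℓ : ℝ) ≤ K * (Cpow * p.κ ^ 2 * (n + q) * r * Real.log (n / δ₀)) ∧
        (q ≤ n →
          (p.commCost w Tpow ℓ : ℝ) ≤ K * (Cpow * p.κ ^ 2 * n * r * Real.log (n / δ₀)))) := by
  obtain ⟨C₀, c, c', K, hC₀, hc, hc1, hc', hc'1, hK, hgeneral⟩ := mainTheorem4_general
  refine ⟨C₀, c, c', K, hC₀, hc, hc1, hc', hc'1, hK, ?_⟩
  intro n q r mt Lt ρ L m hn hr hLt hρ hL hm p D hκ _ hinc τ hτ hτ_lt δ₀ hδ hδ1 Cs Cpow Cgm hCs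
    hCpow hCgm Tpow Tgm hTpow hTgm S _ ν _ gm εc cgm _ hε hcgm hpath hsample
  obtain ⟨hsmall, hconst, hcomm⟩ := hgeneral n q r mt Lt ρ L m hn hr hLt hρ hL hm p D hκ hinc τ hτ
    hτ_lt δ₀ hδ hδ1 Cs Cpow Cgm hCs hCpow hCgm Tpow Tgm hTpow hTgm S ν gm εc cgm hε hcgm hpath
    hsample
  refine ⟨hsmall.trans' ?_, fun hCsL hCpowL => (hconst hCsL hCpowL).trans' ?_, hcomm⟩
  · exact sub_le_sub_right (sub_le_sub_right (sub_le_self _ (Real.exp_nonneg _)) _) _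
  · exact sub_le_self _ (by positivity)
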